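/- Let $D=(-1,1)$ and, for $k\ge 1$, $\psi_k(x)=\sin\big(\tfrac{k\pi}{2}(x+1)\big)$ and $\bar\mu_k=(k\pi/2)^2$: these are the Dirichlet eigenpairs of $-\Delta$ on $D$, and $(\psi_k)_{k\geq 1}$ is an orthonormal basis of $L^2(D)$, with inner product $\langle\cdot,\cdot\rangle$. For $0<\alpha\le\gamma<2$ let $\mu_k=\bar\mu_k^{\alpha/2}+\bar\mu_k^{\gamma/2}$, let $\dot H^{\alpha,\gamma}=\{g\in L^2(D):\sum_{k\ge1}\mu_k^2\langle g,\psi_k\rangle^2<\infty\}$, normed by $\big(\sum_{k\ge1}\mu_k^2\langle g,\psi_k\rangle^2\big)^{1/2}$, and for $g\in\dot H^{\alpha,\gamma}$ let $\mathtt L^{\alpha,\gamma}_D g=-(-\Delta)^{\alpha/2}g-(-\Delta)^{\gamma/2}g:=-\sum_{k\ge1}\mu_k\langle g,\psi_k\rangle\psi_k$ in $L^2(D)$. For $0<\beta<1$ let $\partial_t^\beta q(t)=\frac1{\Gamma(1-\beta)}\int_0^t (t-s)^{-\beta}q'(s)\,ds$ be the Caputo derivative (for $L^2(D)$-valued $q$,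 as a Bochner integral, possibly improper at $s=0$). Let $T>0$ and $f\in L^2(D)$. A weak solution of $$\partial_t^\beta u=-(-\Delta)^{\alpha/2}u-(-\Delta)^{\gamma/2}u\ \text{ in }(0,T)\times D,\qquad u(t,\pm1)=0,\qquad u(0,\cdot)=f,$$ is a function $u\in C([0,T];L^2(D))\cap C((0,T];\dot H^{\alpha,\gamma})$ with $u(0,\cdot)=f$ a.e. in $D$ such that, for $0<t\le T$, $u(t,\cdot)$ is (represented by) a continuous function on $[-1,1]$ that belongs to $\dot H^{\alpha,\gamma}$ and vanishes at $\pm1$; such that $\lim_{t\downarrow0}u(t,x)=f(x)$ for almost every $x\in D$; and such that $t\mapsto u(t,\cdot)\in L^2(D)$ is differentiable on $(0,T)$ and $\partial_t^\beta u(t,\cdot)=\mathtt L^{\alpha,\gamma}_D u(t,\cdot)$ in $L^2(D)$ for $0<t<T$. **Theorem.** Let $0<\beta,\hat\beta<1$, $0<\alpha\le\gamma<2$, $0<\hat\alpha\le\hat\gamma<2$, $T>0$ and $f\in L^2(D)$. Suppose that either $\langle f,\psi_n\rangle>0$ for all odd $n\ge1$, or $\langle f,\psi_n\rangle<0$ for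 all odd $n\ge1$. Let $u$ be a weak solution of the problem above with parameters $(\beta,\alpha,\gamma)$ and initial datum $f$, and let $v$ be a weak solution of it with parameters $(\hat\beta,\hat\alpha,\hat\gamma)$ and the same $f$. If $u(t,0)=v(t,0)$ for all $0<t\le T$, then $\beta=\hat\beta$, $\alpha=\hat\alpha$ and $\gamma=\hat\gamma$. -/

import Mathlib

open Set Filter Topology MeasureTheory

noncomputable section

namespace DoubleScale

/-- The spatial domain `D = (-1, 1)`. -/
def D : Set ℝ := Ioo (-1) 1

/-- The real Hilbert space `L²(D)`. -/
abbrev L2D : Type := Lp ℝ 2 (volume.restrict D)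

open Classical in
/-- The class in `L²(D)` of a square integrable function (`0` if `g` is not square integrable). -/
def toL2 (g : ℝ → ℝ) : L2D :=
  if h : MemLp g 2 (volume.restrict D) then h.toLp g else 0

/-- The Dirichlet eigenfunctions `ψ_k(x) = sin (kπ(x+1)/2)`, `k ≥ 1`, of `-Δ` on `D`. -/
def psi (k : ℕ) (x : ℝ) : ℝ := Real.sin (k * Real.pi / 2 * (x + 1))

/-- The Dirichlet eigenvalues `(kπ/2)²` of `-Δ` on `D`. -/
def muBar (k : ℕ) : ℝ := (k * Real.pi / 2) ^ 2

/-- The eigenvalues of `(-Δ)^{α/2} + (-Δ)^{γ/2}`. -/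
def mu (α γ : ℝ) (k : ℕ) : ℝ := muBar k ^ (α / 2) + muBar k ^ (γ / 2)

/-- The sine coefficient `⟨g, ψ_k⟩` in `L²(D)`. -/
def coeff (g : ℝ → ℝ) (k : ℕ) : ℝ := ∫ x in D, g x * psi k x

/-- The space `Ḣ^{α,γ}`, the domain of `-(-Δ)^{α/2} - (-Δ)^{γ/2}` in `L²(D)`. -/
def MemHdot (α γ : ℝ) (g : ℝ → ℝ) : Prop :=
  MemLp g 2 (volume.restrict D) ∧
    Summable fun n : ℕ => coeff g (n + 1) ^ 2 * mu α γ (n + 1) ^ 2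

/-- The operator `L_D^{α,γ} = -(-Δ)^{α/2} - (-Δ)^{γ/2}`, defined spectrally on `Ḣ^{α,γ}`
(the series converges in `L²(D)` there). -/
def opL (α γ : ℝ) (g : ℝ → ℝ) : L2D :=
  -∑' n : ℕ, (coeff g (n + 1) * mu α γ (n + 1)) • toL2 (psi (n + 1))

/-- `w` is the Caputo derivative of order `β` of `q` at `t > 0`:
`w = Γ(1-β)⁻¹ ∫₀ᵗ (t-s)^{-β} q'(s) ds`. The integral is a Bochner integral on `(ε, t)`, and it may be
improper at `s = 0` (it is the usual one when the integrand is integrable on `(0, t)`). -/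
def HasCaputoDerivAt {E : Type*} [NormedAddCommGroup E] [NormedSpace ℝ E]
    (β : ℝ) (q : ℝ → E) (w : E) (t : ℝ) : Prop :=
  (∀ s ∈ Ioo 0 t, DifferentiableAt ℝ q s) ∧
  (∀ ε ∈ Ioo 0 t, IntervalIntegrable (fun s => (t - s) ^ (-β) • deriv q s) volume ε t) ∧
  Tendsto (fun ε => (Real.Gamma (1 - β))⁻¹ • ∫ s in ε..t, (t - s) ^ (-β) • deriv q s)
    (𝓝[>] 0) (𝓝 w)

/-- `u` (with `u t x` the value at time `t` and position `x`) is the weak solution on `[0, T]` of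
`∂_t^β u = -(-Δ)^{α/2} u - (-Δ)^{γ/2} u`, `u(t, ±1) = 0`, `u(0, ·) = f`, in the class
`C([0,T]; L²(D)) ∩ C((0,T]; Ḣ^{α,γ})`. For positive times `u t` is the continuous
representative of its class, so that its values at the points `-1`, `1` and `0` have a meaning. -/
structure IsWeakSolution (β α γ T : ℝ) (f : ℝ → ℝ) (u : ℝ → ℝ → ℝ) : Prop where
  continuous_space : ∀ t ∈ Ioc 0 T, ContinuousOn (u t) (Icc (-1) 1)
  mem_Hdot : ∀ t ∈ Ioc 0 T, MemHdot α γ (u t)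
  boundary : ∀ t ∈ Ioc 0 T, u t (-1) = 0 ∧ u t 1 = 0
  initial : u 0 =ᵐ[volume.restrict D] f
  initial_limit : ∀ᵐ x ∂(volume.restrict D), Tendsto (fun t => u t x) (𝓝[>] 0) (𝓝 (f x))
  continuous_L2 : ContinuousOn (fun t => toL2 (u t)) (Icc 0 T)
  continuous_Hdot : ContinuousOn (fun t => opL α γ (u t)) (Ioc 0 T)
  equation : ∀ t ∈ Ioo 0 T, HasCaputoDerivAt β (fun s => toL2 (u s)) (opL α γ (u t)) t

end DoubleScale

end

noncomputable section

namespace DoubleScale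

/-! ### The Gamma and Beta functions -/

/-! Testing the equation against `psi n` turns it into a scalar fractional relaxation equation,
whose only solution is `coeff f n * E_β(-μ_n t^β)` (`coeff_weakSolution`; uniqueness comes from the
comparison principle `norm_le_of_hasCaputoDerivAt`). At the midpoint the even modes vanish and `psi
(2j+1) 0 = (-1)^j`. By the sign hypothesis and positivity of `E_β` on the negative axis, the odd
coefficients of `u t` all have one sign. For a continuous function vanishing at the end points this
forces the sine series to converge at the midpoint (`tendsto_sum_coeff`), so `u t 0 = ∑ c_j E_β(-μ_j
t^β)` with `c_j = (-1)^j coeff f (2j+1)`.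

The series may converge only conditionally. It is handled by Abel summation: `w E_β(-w)` has bounded
variation along rays near the positive axis and is bounded below along the positive axis away from
zero. Hence convergence at one time gives convergence of `∑ c_j / μ_j` (`cauchySeq_sum_div`), which
in turn gives an analytic extension of the observation to all `t > 0` and termwise Laplace
transforms (`exists_analytic_series`). The two observations agree on `(0, T)`, hence on `(0, ∞)`,
and so `s^β ∑ c_j / (s^β + μ_j)` is the same function of `s > 0` for both parameter sets.

With `s = exp η`, both sides continue holomorphically to the strip `|Im η| < π / max(β, β')`. On the
boundary of the strip the side with the larger order has poles, because every `c_j` is nonzero, and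
the other side must have them too (`pole_of_rpow_mul_eq`). This forces equal orders and, by
symmetry, equal sets of eigenvalues `μ_j`. Both eigenvalue sequences are strictly increasing, so
they coincide term by term. Their growth determines `γ`, and the first eigenvalue then determines
`α` (`exponents_eq_of_mu_eq`). -/

lemma rpow_mul_exp_le_Gamma {Q x : ℝ} (hQ : 0 < Q) (hx : 0 ≤ x) :
    Q ^ x * Real.exp (-Q) ≤ Real.Gamma (x + 1) := by
  rw [Real.Gamma_eq_integral (by linarith), add_sub_cancel_right]
  have hint : IntegrableOn (fun u : ℝ => Real.exp (-u) * u ^ x) (Ioi 0) := by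
    simpa using Real.GammaIntegral_convergent (s := x + 1) (by linarith)
  calc Q ^ x * Real.exp (-Q) = ∫ u in Ioi Q, Q ^ x * Real.exp (-u) := by
        rw [integral_const_mul, integral_exp_neg_Ioi]
    _ ≤ ∫ u in Ioi Q, Real.exp (-u) * u ^ x := by
        refine setIntegral_mono_on ((integrableOn_exp_neg_Ioi Q).const_mul _)
          (hint.mono_set (Ioi_subset_Ioi hQ.le)) measurableSet_Ioi fun u hu => ?_
        rw [mul_comm]
        gcongr
        exact le_of_lt hu
    _ ≤ ∫ u in Ioi 0, Real.exp (-u) * u ^ x := by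
        refine setIntegral_mono_set hint ?_ (Ioi_subset_Ioi hQ.le).eventuallyLE
        filter_upwards [ae_restrict_mem measurableSet_Ioi] with u hu
        have : (0 : ℝ) < u := hu
        positivity

/-- The reciprocal Gamma factors beat every geometric sequence; this gives convergence of all
Mittag-Leffler series and, later, termwise integration. -/
lemma summable_pow_div_Gamma {β c R : ℝ} (hβ : 0 < β) (hc : 0 < c) (hR : 0 ≤ R) :
    Summable fun k : ℕ => R ^ k / Real.Gamma (β * k + c) := by
  -- With `Q ^ β = 2 (R + 1)` the lower bound for Gamma carries `(2 (R + 1)) ^ k`, which leaves a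
  -- factor `2 ^ (-k)` to absorb the linear factor of `Γ(x + 1) = x Γ(x)`.
  set Q : ℝ := (2 * (R + 1)) ^ (β⁻¹)
  have hQ : 0 < Q := by positivity
  have hQβ : Q ^ β = 2 * (R + 1) := by
    rw [← Real.rpow_mul (by positivity), inv_mul_cancel₀ hβ.ne', Real.rpow_one]
  have hs : Summable fun k : ℕ => (Real.exp Q / Q ^ c) * (β * ((k : ℝ) ^ 1 * (1 / 2) ^ k) +
      c * ((k : ℝ) ^ 0 * (1 / 2) ^ k)) := by
    refine Summable.mul_left _ (Summable.add (Summable.mul_left _ ?_) (Summable.mul_left _ ?_)) <;>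
    exact summable_pow_mul_geometric_of_norm_lt_one _ (by norm_num)
  refine Summable.of_nonneg_of_le (fun k => ?_) (fun k => ?_) hs
  · have : 0 < Real.Gamma (β * k + c) := Real.Gamma_pos_of_pos (by positivity)
    positivity
  · have hp : 0 < β * k + c := by positivity
    have h1 := rpow_mul_exp_le_Gamma hQ hp.le
    rw [Real.Gamma_add_one hp.ne', Real.rpow_add hQ, Real.rpow_mul hQ.le, hQβ, Real.rpow_natCast,
      mul_pow, Real.exp_neg] at h1
    have h2 : R ^ k ≤ (R + 1) ^ k := by gcongr; linarith
    have hG : 0 < Real.Gamma (β * k + c) := Real.Gamma_pos_of_pos hp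
    rw [div_le_iff₀ hG]
    have h3 : (R + 1) ^ k = (2 ^ k * (R + 1) ^ k * Q ^ c * (Real.exp Q)⁻¹) *
        (Real.exp Q / Q ^ c * (1 / 2) ^ k) := by
      have := (Real.exp_pos Q).ne'
      have : Q ^ c ≠ 0 := by positivity
      field_simp
      rw [← mul_pow]; norm_num
    calc R ^ k ≤ (R + 1) ^ k := h2
      _ ≤ ((β * k + c) * Real.Gamma (β * k + c)) * (Real.exp Q / Q ^ c * (1 / 2) ^ k) := by
          rw [h3]; gcongr
      _ = _ := by ring

lemma integral_beta {c d t : ℝ} (hc : 0 < c) (hd : 0 < d) (ht : 0 < t) :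
    ∫ s in (0 : ℝ)..t, (t - s) ^ (d - 1) * s ^ (c - 1) =
      Real.Gamma c * Real.Gamma d / Real.Gamma (c + d) * t ^ (c + d - 1) := by
  have h := Complex.betaIntegral_scaled c d ht
  have h2 := Complex.Gamma_mul_Gamma_eq_betaIntegral (s := c) (t := d) (by simpa) (by simpa)
  have hG : Real.Gamma (c + d) ≠ 0 := (Real.Gamma_pos_of_pos (by linarith)).ne'
  have hb : Complex.betaIntegral c d =
      ((Real.Gamma c * Real.Gamma d / Real.Gamma (c + d) : ℝ) : ℂ) := by
    rw [← Complex.ofReal_add, Complex.Gamma_ofReal, Complex.Gamma_ofReal, Complex.Gamma_ofReal]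
      at h2
    push_cast
    rw [h2, mul_div_cancel_left₀]
    exact_mod_cast hG
  rw [hb] at h
  have h3 : ∫ x in (0 : ℝ)..t, (x : ℂ) ^ ((c : ℂ) - 1) * ((t : ℂ) - x) ^ ((d : ℂ) - 1) =
      ((∫ s in (0 : ℝ)..t, (t - s) ^ (d - 1) * s ^ (c - 1) : ℝ) : ℂ) := by
    rw [← intervalIntegral.integral_ofReal]
    refine intervalIntegral.integral_congr fun x hx => ?_
    rw [uIcc_of_le ht.le] at hx
    rw [Complex.ofReal_mul, Complex.ofReal_cpow (by linarith [hx.2]), Complex.ofReal_cpow hx.1]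
    push_cast
    ring
  rw [h3] at h
  apply Complex.ofReal_injective
  rw [h, Complex.ofReal_mul, Complex.ofReal_cpow ht.le]
  push_cast
  ring

lemma intervalIntegrable_beta {c d t : ℝ} (hc : 0 < c) (hd : 0 < d) (ht : 0 < t) :
    IntervalIntegrable (fun s => (t - s) ^ (d - 1) * s ^ (c - 1)) volume 0 t := by
  -- A function that is not integrable has integral `0` by convention, so the nonzero Beta value
  -- already proves integrability.
  refine intervalIntegral.intervalIntegrable_of_integral_ne_zero ?_
  rw [integral_beta hc hd ht]
  have := Real.Gamma_pos_of_pos hc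
  have := Real.Gamma_pos_of_pos hd
  have := Real.Gamma_pos_of_pos (add_pos hc hd)
  positivity

/-! ### Mittag-Leffler functions -/

/-- The two-parameter Mittag-Leffler function `E_{β,c}(-w)`. -/
def mlc (β c : ℝ) (w : ℂ) : ℂ := ∑' k : ℕ, (-w) ^ k / (Real.Gamma (β * k + c) : ℂ)

section MittagLeffler

variable {β c d : ℝ}

lemma norm_mlc_term (hβ : 0 < β) (hc : 0 < c) (w : ℂ) (k : ℕ) :
    ‖(-w) ^ k / (Real.Gamma (β * k + c) : ℂ)‖ = ‖w‖ ^ k / Real.Gamma (β * k + c) := by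
  have : 0 < Real.Gamma (β * k + c) := Real.Gamma_pos_of_pos (by positivity)
  simp [abs_of_pos this]

lemma summable_mlc (hβ : 0 < β) (hc : 0 < c) (w : ℂ) :
    Summable fun k : ℕ => (-w) ^ k / (Real.Gamma (β * k + c) : ℂ) := by
  refine Summable.of_norm ?_
  simp_rw [norm_mlc_term hβ hc]
  exact summable_pow_div_Gamma hβ hc (norm_nonneg w)

lemma differentiable_mlc (hβ : 0 < β) (hc : 0 < c) : Differentiable ℂ (mlc β c) := by
  intro w
  have h := Complex.differentiableOn_tsum_of_summable_norm (U := Metric.ball (0 : ℂ) (‖w‖ + 1))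
    (F := fun (k : ℕ) w => (-w) ^ k / (Real.Gamma (β * k + c) : ℂ))
    (summable_pow_div_Gamma hβ hc (R := ‖w‖ + 1) (by positivity))
    (fun k => by fun_prop) Metric.isOpen_ball (fun k z hz => ?_)
  · exact h.differentiableAt (Metric.isOpen_ball.mem_nhds (by simp))
  · rw [norm_mlc_term hβ hc]
    have : 0 < Real.Gamma (β * k + c) := Real.Gamma_pos_of_pos (by positivity)
    have hz' : ‖z‖ ≤ ‖w‖ + 1 := by simpa using (mem_ball_zero_iff.1 hz).le
    gcongr

/-- Termwise differentiation, with `Γ(β(k+1) + 1) = β (k+1) Γ(βk + β)` cancelling the factor `k +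
1`. -/
lemma hasDerivAt_mlc_one (hβ : 0 < β) (w : ℂ) :
    HasDerivAt (mlc β 1) (-(β : ℂ)⁻¹ * mlc β β w) w := by
  have h := Complex.hasSum_deriv_of_summable_norm (U := Metric.ball (0 : ℂ) (‖w‖ + 1)) (z := w)
    (F := fun (k : ℕ) w => (-w) ^ k / (Real.Gamma (β * k + 1) : ℂ))
    (summable_pow_div_Gamma hβ one_pos (R := ‖w‖ + 1) (by positivity))
    (fun k => by fun_prop) Metric.isOpen_ball (fun k z hz => ?_) (by simp)
  · have hd := (differentiable_mlc hβ one_pos w).hasDerivAt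
    refine hd.congr_deriv ?_
    have hterm : ∀ k : ℕ, deriv (fun w : ℂ => (-w) ^ k / (Real.Gamma (β * k + 1) : ℂ)) w =
        (k * (-w) ^ (k - 1) * (-1)) / (Real.Gamma (β * k + 1) : ℂ) := fun k => by
      simpa using ((((hasDerivAt_id w).neg).pow k).div_const _).deriv
    simp_rw [hterm] at h
    have h0 : HasSum (fun k : ℕ => -(β : ℂ)⁻¹ * ((-w) ^ k / (Real.Gamma (β * k + β) : ℂ)))
        (-(β : ℂ)⁻¹ * mlc β β w) := ((summable_mlc hβ hβ w).hasSum).mul_left _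
    refine (h0.unique ?_).symm
    rw [← hasSum_nat_add_iff' 1] at h
    simp only [Finset.range_one, Finset.sum_singleton, Nat.cast_zero, zero_mul, zero_div,
      sub_zero] at h
    convert! h using 2 with k
    have hp : β * (k + 1 : ℝ) ≠ 0 := by positivity
    have hG : (Real.Gamma (β * k + β) : ℂ) ≠ 0 := by
      exact_mod_cast (Real.Gamma_pos_of_pos (by positivity)).ne'
    have hβ' : (β : ℂ) ≠ 0 := by exact_mod_cast hβ.ne'
    have hk : ((k : ℂ) + 1) ≠ 0 := by exact_mod_cast Nat.succ_ne_zero k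
    have hGk : Real.Gamma (β * ((k + 1 : ℕ) : ℝ) + 1) = β * (k + 1) * Real.Gamma (β * k + β) := by
      push_cast
      rw [Real.Gamma_add_one hp]
      ring_nf
    rw [hGk]
    push_cast
    field_simp
  · rw [norm_mlc_term hβ one_pos]
    have : 0 < Real.Gamma (β * k + 1) := Real.Gamma_pos_of_pos (by positivity)
    have hz' : ‖z‖ ≤ ‖w‖ + 1 := by simpa using (mem_ball_zero_iff.1 hz).le
    gcongr

lemma mlc_one_zero : mlc β 1 0 = 1 := by
  unfold mlc
  rw [tsum_eq_single 0 (fun k hk => by simp [hk])]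
  simp

lemma hasSum_mlc_kernel (hβ : 0 < β) (hc : 0 < c) (t : ℝ) (lam : ℂ) :
    HasSum (fun k : ℕ => (-lam) ^ k / (Real.Gamma (β * k + c) : ℂ) *
      (((t ^ β) ^ k : ℝ) : ℂ)) (mlc β c (lam * (t ^ β : ℝ))) := by
  convert! (summable_mlc hβ hc (lam * (t ^ β : ℝ))).hasSum using 2 with k
  rw [← neg_mul, mul_pow]
  push_cast
  ring

/-- The Riemann-Liouville integral of order `d` of `s ^ (c - 1) E_{β,c}(-λ s ^ β)`. -/
lemma integral_kernel_mlc (hβ : 0 < β) (hc : 0 < c) (hd : 0 < d) {t : ℝ} (ht : 0 < t) (lam : ℂ) :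
    IntervalIntegrable (fun s : ℝ => (((t - s) ^ (d - 1) * s ^ (c - 1) : ℝ) : ℂ) *
      mlc β c (lam * (s ^ β : ℝ))) volume 0 t ∧
    ∫ s in (0 : ℝ)..t, (((t - s) ^ (d - 1) * s ^ (c - 1) : ℝ) : ℂ) * mlc β c (lam * (s ^ β : ℝ)) =
      Real.Gamma d * (t ^ (c + d - 1) : ℝ) * mlc β (c + d) (lam * (t ^ β : ℝ)) := by
  have hib := intervalIntegrable_beta hc hd ht
  refine ⟨?_, ?_⟩
  · have hcont : Continuous fun s : ℝ => mlc β c (lam * (s ^ β : ℝ)) :=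
      (differentiable_mlc hβ hc).continuous.comp (continuous_const.mul
        (Complex.continuous_ofReal.comp (Real.continuous_rpow_const hβ.le)))
    have hib' : IntervalIntegrable (fun s => (((t - s) ^ (d - 1) * s ^ (c - 1) : ℝ) : ℂ)) volume 0 t :=
      ⟨Integrable.ofReal hib.1, Integrable.ofReal hib.2⟩
    exact hib'.mul_continuousOn hcont.continuousOn
  set F : ℕ → ℝ → ℂ := fun k s => (-lam) ^ k / (Real.Gamma (β * k + c) : ℂ) *
    (((t - s) ^ (d - 1) * s ^ (β * k + c - 1) : ℝ) : ℂ)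
  have hpos : ∀ k : ℕ, 0 < β * k + c := fun k => by positivity
  have hreal : ∀ k : ℕ, ∫ s in Ioc 0 t, (t - s) ^ (d - 1) * s ^ (β * k + c - 1) =
      Real.Gamma (β * k + c) * Real.Gamma d / Real.Gamma (β * k + c + d) *
        t ^ (β * k + c + d - 1) := fun k => by
    rw [← intervalIntegral.integral_of_le ht.le]
    exact integral_beta (hpos k) hd ht
  have hFint : ∀ k, IntegrableOn (F k) (Ioc 0 t) := fun k => by
    have := (intervalIntegrable_beta (hpos k) hd ht).1
    exact (Integrable.ofReal this).const_mul _
  have hnorm : ∀ k, ∫ s in Ioc 0 t, ‖F k s‖ =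
      ‖lam‖ ^ k / Real.Gamma (β * k + c) * (Real.Gamma (β * k + c) * Real.Gamma d /
        Real.Gamma (β * k + c + d) * t ^ (β * k + c + d - 1)) := fun k => by
    rw [← hreal, ← integral_const_mul]
    refine setIntegral_congr_fun measurableSet_Ioc fun s hs => ?_
    simp only [F]
    rw [norm_mul, norm_mlc_term hβ hc, Complex.norm_real, Real.norm_of_nonneg]
    have : 0 ≤ t - s := by linarith [hs.2]
    have : 0 < s := hs.1
    positivity
  have htk : ∀ k : ℕ, t ^ (β * k + c + d - 1) = t ^ (c + d - 1) * (t ^ β) ^ k := fun k => by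
    rw [← Real.rpow_natCast, ← Real.rpow_mul ht.le, ← Real.rpow_add ht]; ring_nf
  -- The Beta integral replaces `Γ(βk + c)` by `Γ(βk + c + d)`, so the integrals of the norms are
  -- again the terms of a Mittag-Leffler series.
  have hsum : Summable fun k => ∫ s in Ioc 0 t, ‖F k s‖ := by
    have h1 := (summable_pow_div_Gamma hβ (add_pos hc hd)
      (R := ‖lam‖ * t ^ β) (by positivity)).mul_left (Real.Gamma d * t ^ (c + d - 1))
    refine h1.congr fun k => ?_
    rw [hnorm, htk, mul_pow, ← add_assoc]
    have : Real.Gamma (β * k + c) ≠ 0 := (Real.Gamma_pos_of_pos (hpos k)).ne'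
    field_simp
  have hmain := hasSum_integral_of_summable_integral_norm hFint hsum
  have hint : ∀ k, ∫ s in Ioc 0 t, F k s = Real.Gamma d * (t ^ (c + d - 1) : ℝ) *
      ((-lam) ^ k / (Real.Gamma (β * k + (c + d)) : ℂ) * (((t ^ β) ^ k : ℝ) : ℂ)) := fun k => by
    simp only [F]
    rw [integral_const_mul, integral_complex_ofReal, hreal, htk, ← add_assoc]
    have : (Real.Gamma (β * k + c) : ℂ) ≠ 0 := by
      exact_mod_cast (Real.Gamma_pos_of_pos (hpos k)).ne'
    push_cast
    field_simp
  simp_rw [hint] at hmain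
  rw [← ((hasSum_mlc_kernel hβ (add_pos hc hd) t lam).mul_left
    (Real.Gamma d * (t ^ (c + d - 1) : ℝ) : ℂ)).unique hmain |>.symm]
  rw [intervalIntegral.integral_of_le ht.le]
  refine setIntegral_congr_fun measurableSet_Ioc fun s hs => ?_
  have h2 := (hasSum_mlc_kernel hβ hc s lam).mul_left (((t - s) ^ (d - 1) * s ^ (c - 1) : ℝ) : ℂ)
  rw [← h2.tsum_eq]
  refine tsum_congr fun k => ?_
  simp only [F]
  have : s ^ (β * k + c - 1) = s ^ (c - 1) * (s ^ β) ^ k := by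
    rw [← Real.rpow_natCast, ← Real.rpow_mul hs.1.le, ← Real.rpow_add hs.1]; ring_nf
  rw [this]
  push_cast
  ring

end MittagLeffler

section Relaxation

variable {β : ℝ}

/-! ### The fractional relaxation equation -/

lemma hasDerivAt_mlc_rpow (hβ : 0 < β) (lam : ℂ) {s : ℝ} (hs : 0 < s) :
    HasDerivAt (fun s : ℝ => mlc β 1 (lam * (s ^ β : ℝ)))
      (-lam * ((s ^ (β - 1) : ℝ) * mlc β β (lam * (s ^ β : ℝ)))) s := by
  have h1 : HasDerivAt (fun s : ℝ => lam * ((s ^ β : ℝ) : ℂ))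
      (lam * ((β * s ^ (β - 1) : ℝ) : ℂ)) s :=
    ((Real.hasDerivAt_rpow_const (Or.inl hs.ne')).ofReal_comp).const_mul lam
  have h2 := (hasDerivAt_mlc_one hβ (lam * (s ^ β : ℝ))).comp s h1
  refine h2.congr_deriv ?_
  have : (β : ℂ) ≠ 0 := by exact_mod_cast hβ.ne'
  push_cast
  field_simp

lemma continuous_mlc_rpow (hβ : 0 < β) (lam : ℂ) :
    Continuous fun s : ℝ => mlc β 1 (lam * (s ^ β : ℝ)) :=
  (differentiable_mlc hβ one_pos).continuous.comp (continuous_const.mul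
    (Complex.continuous_ofReal.comp (Real.continuous_rpow_const hβ.le)))

lemma kernel_smul_deriv_mlc (hβ : 0 < β) (lam : ℂ) {t s : ℝ} (hs : 0 < s) :
    (t - s) ^ (-β) • deriv (fun s : ℝ => mlc β 1 (lam * (s ^ β : ℝ))) s =
      -lam * ((((t - s) ^ ((1 - β) - 1) * s ^ (β - 1) : ℝ) : ℂ) *
        mlc β β (lam * (s ^ β : ℝ))) := by
  rw [(hasDerivAt_mlc_rpow hβ lam hs).deriv, show (1 - β) - 1 = -β by ring, Complex.real_smul]
  push_cast
  ring

lemma intervalIntegrable_kernel_smul_deriv_mlc (hβ : 0 < β) (hβ1 : β < 1) (lam : ℂ) {t : ℝ}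
    (ht : 0 < t) : IntervalIntegrable (fun s => (t - s) ^ (-β) •
      deriv (fun s : ℝ => mlc β 1 (lam * (s ^ β : ℝ))) s) volume 0 t := by
  refine ((integral_kernel_mlc hβ hβ (sub_pos.2 hβ1) ht lam).1.const_mul (-lam)).congr ?_
  rw [uIoc_of_le ht.le]
  exact fun s hs => (kernel_smul_deriv_mlc hβ lam hs.1).symm

lemma integral_kernel_smul_deriv_mlc (hβ : 0 < β) (hβ1 : β < 1) (lam : ℂ) {t : ℝ}
    (ht : 0 < t) : ∫ s in (0 : ℝ)..t, (t - s) ^ (-β) •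
      deriv (fun s : ℝ => mlc β 1 (lam * (s ^ β : ℝ))) s =
      -lam * (Real.Gamma (1 - β) * mlc β 1 (lam * (t ^ β : ℝ))) := by
  have h := (integral_kernel_mlc hβ hβ (sub_pos.2 hβ1) ht lam).2
  rw [show β + (1 - β) = 1 by ring, sub_self, Real.rpow_zero, Complex.ofReal_one, mul_one] at h
  rw [← h, ← intervalIntegral.integral_const_mul, intervalIntegral.integral_of_le ht.le,
    intervalIntegral.integral_of_le ht.le]
  exact setIntegral_congr_fun measurableSet_Ioc fun s hs => kernel_smul_deriv_mlc hβ lam hs.1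

/-- The derivative is `-λ s^(β-1) E_{β,β}(-λ s^β)`, and its fractional integral of order `1 - β`
raises the second parameter from `β` to `1`, giving the function back. The integrand is integrable
up to `0`, so the improper limit is continuity of a primitive. -/
lemma hasCaputoDerivAt_mlc (hβ : 0 < β) (hβ1 : β < 1) (lam : ℂ) {t : ℝ} (ht : 0 < t) :
    HasCaputoDerivAt β (fun s : ℝ => mlc β 1 (lam * (s ^ β : ℝ)))
      (-lam * mlc β 1 (lam * (t ^ β : ℝ))) t := by
  have hint := intervalIntegrable_kernel_smul_deriv_mlc hβ hβ1 lam ht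
  refine ⟨fun s hs => (hasDerivAt_mlc_rpow hβ lam hs.1).differentiableAt, fun ε hε => ?_, ?_⟩
  · refine hint.mono_set ?_
    rw [uIcc_of_le hε.2.le, uIcc_of_le ht.le]
    exact Icc_subset_Icc_left hε.1.le
  · have hG : (Real.Gamma (1 - β) : ℂ) ≠ 0 := by
      exact_mod_cast (Real.Gamma_pos_of_pos (by linarith)).ne'
    have hc := intervalIntegral.continuousOn_primitive_interval' hint.symm left_mem_uIcc
    have h0 : Tendsto (fun ε => ∫ s in ε..t, (t - s) ^ (-β) •
        deriv (fun s : ℝ => mlc β 1 (lam * (s ^ β : ℝ))) s) (𝓝[>] 0)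
        (𝓝 (-lam * (Real.Gamma (1 - β) * mlc β 1 (lam * (t ^ β : ℝ))))) := by
      rw [← integral_kernel_smul_deriv_mlc hβ hβ1 lam ht]
      have h1 := (hc 0 right_mem_uIcc).tendsto.neg
      simp_rw [← intervalIntegral.integral_symm] at h1
      refine h1.mono_left ?_
      rw [uIcc_of_ge ht.le]
      exact nhdsWithin_le_of_mem (mem_of_superset (Ioc_mem_nhdsGT ht) Ioc_subset_Icc_self)
    convert! h0.const_smul (Real.Gamma (1 - β))⁻¹ using 2
    rw [Complex.real_smul]
    push_cast
    field_simp

/-- Passes from the equation in `L²(D)` to its scalar coefficients. Integrands are compared on open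
intervals, as differentiability is not given at the end time itself. -/
lemma HasCaputoDerivAt.clm_comp {E F : Type*} [NormedAddCommGroup E] [NormedSpace ℝ E]
    [NormedAddCommGroup F] [NormedSpace ℝ F] [CompleteSpace E] [CompleteSpace F] {q : ℝ → E} {w : E}
    {t : ℝ} (ht : 0 < t) (L : E →L[ℝ] F) (h : HasCaputoDerivAt β q w t) :
    HasCaputoDerivAt β (fun s => L (q s)) (L w) t := by
  obtain ⟨h1, h2, h3⟩ := h
  have hd : ∀ ε ∈ Ioo 0 t, EqOn (fun s => L ((t - s) ^ (-β) • deriv q s))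
      (fun s => (t - s) ^ (-β) • deriv (fun s => L (q s)) s) (Ioo ε t) := fun ε hε s hs => by
    have : deriv (fun s => L (q s)) s = L (deriv q s) :=
      (L.hasFDerivAt.comp_hasDerivAt s (h1 s ⟨hε.1.trans hs.1, hs.2⟩).hasDerivAt).deriv
    simp only
    rw [this, map_smul]
  have hii : ∀ ε ∈ Ioo 0 t, IntervalIntegrable (fun s => L ((t - s) ^ (-β) • deriv q s))
      volume ε t := fun ε hε =>
    ⟨L.integrable_comp (h2 ε hε).1, L.integrable_comp (h2 ε hε).2⟩
  refine ⟨fun s hs => L.differentiableAt.comp s (h1 s hs), fun ε hε => ?_, ?_⟩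
  · have := hii ε hε
    rw [intervalIntegrable_iff_integrableOn_Ioo_of_le hε.2.le] at this ⊢
    exact this.congr_fun (hd ε hε) measurableSet_Ioo
  · have := (L.continuous.tendsto _).comp h3
    refine this.congr' ?_
    filter_upwards [Ioo_mem_nhdsGT ht] with ε hε
    simp only [Function.comp, map_smul]
    rw [← L.intervalIntegral_comp_comm (h2 ε hε), intervalIntegral.integral_of_le hε.2.le,
      intervalIntegral.integral_of_le hε.2.le, integral_Ioc_eq_integral_Ioo,
      integral_Ioc_eq_integral_Ioo, setIntegral_congr_fun measurableSet_Ioo (hd ε hε)]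

lemma HasCaputoDerivAt.sub {E : Type*} [NormedAddCommGroup E] [NormedSpace ℝ E]
    {q r : ℝ → E} {w v : E} {t : ℝ} (ht : 0 < t) (h : HasCaputoDerivAt β q w t)
    (h' : HasCaputoDerivAt β r v t) :
    HasCaputoDerivAt β (fun s => q s - r s) (w - v) t := by
  obtain ⟨h1, h2, h3⟩ := h
  obtain ⟨k1, k2, k3⟩ := h'
  have hd : ∀ ε ∈ Ioo 0 t, EqOn (fun s => (t - s) ^ (-β) • deriv q s - (t - s) ^ (-β) • deriv r s)
      (fun s => (t - s) ^ (-β) • deriv (fun s => q s - r s) s) (Ioo ε t) := fun ε hε s hs => by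
    have hs' : s ∈ Ioo 0 t := ⟨hε.1.trans hs.1, hs.2⟩
    simp only
    rw [deriv_fun_sub (h1 s hs') (k1 s hs'), smul_sub]
  refine ⟨fun s hs => (h1 s hs).sub (k1 s hs), fun ε hε => ?_, ?_⟩
  · have := (h2 ε hε).sub (k2 ε hε)
    rw [intervalIntegrable_iff_integrableOn_Ioo_of_le hε.2.le] at this ⊢
    exact this.congr_fun (hd ε hε) measurableSet_Ioo
  · refine (h3.sub k3).congr' ?_
    filter_upwards [Ioo_mem_nhdsGT ht] with ε hε
    rw [← smul_sub, ← intervalIntegral.integral_sub (h2 ε hε) (k2 ε hε),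
      intervalIntegral.integral_of_le hε.2.le,
      intervalIntegral.integral_of_le hε.2.le, integral_Ioc_eq_integral_Ioo,
      integral_Ioc_eq_integral_Ioo, setIntegral_congr_fun measurableSet_Ioo (hd ε hε)]

/-- The extremum principle for the Caputo derivative. -/
lemma HasCaputoDerivAt.le_of_isMax {w : ℝ → ℝ} {L t : ℝ} (hβ : 0 < β) (hβ1 : β < 1) (ht : 0 < t)
    (hw0 : ContinuousWithinAt w (Ioi 0) 0) (hdiff : DifferentiableAt ℝ w t)
    (hmax : ∀ s ∈ Ioc 0 t, w s ≤ w t) (h : HasCaputoDerivAt β w L t) :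
    (Real.Gamma (1 - β))⁻¹ * (t ^ (-β) * (w t - w 0)) ≤ L := by
  obtain ⟨h1, h2, h3⟩ := h
  have hG : 0 < Real.Gamma (1 - β) := Real.Gamma_pos_of_pos (by linarith)
  have hkey : ∀ ε ∈ Ioo 0 t, (t - ε) ^ (-β) * (w t - w ε) ≤
      ∫ s in ε..t, (t - s) ^ (-β) • deriv w s := fun ε hε => by
    have hda : ∀ s ∈ Ioo 0 t, HasDerivAt (fun s => (t - s) ^ (-β) * (w s - w t))
        (β * (t - s) ^ (-β - 1) * (w s - w t) + (t - s) ^ (-β) * deriv w s) s := fun s hs => by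
      have hts : t - s ≠ 0 := (sub_pos.2 hs.2).ne'
      have ha : HasDerivAt (fun s => (t - s) ^ (-β)) (β * (t - s) ^ (-β - 1)) s := by
        have := ((hasDerivAt_id s).const_sub t).rpow_const (p := -β) (Or.inl hts)
        refine this.congr_deriv ?_
        simp
      exact ha.mul ((h1 s hs).hasDerivAt.sub_const (w t))
    -- Integration by parts as an inequality: the term `β (t-s)^(-β-1) (w s - w t)` is nonpositive
    -- and is dropped, so it need not be integrable. The boundary term at `s = t` vanishes because
    -- `w s - w t = O(t - s)` and `β < 1`.
    have := intervalIntegral.sub_le_integral_of_hasDeriv_right_of_le (a := ε) (b := t)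
      (g := fun s => (t - s) ^ (-β) * (w s - w t))
      (g' := fun s => β * (t - s) ^ (-β - 1) * (w s - w t) + (t - s) ^ (-β) * deriv w s)
      (φ := fun s => (t - s) ^ (-β) • deriv w s) hε.2.le ?_
      (fun s hs => (hda s ⟨hε.1.trans hs.1, hs.2⟩).hasDerivWithinAt) ?_ ?_
    · simp only [sub_self, mul_zero, zero_sub] at this
      linarith
    · intro s hs
      rcases hs.2.lt_or_eq with hlt | rfl
      · exact (hda s ⟨hε.1.trans_le hs.1, hlt⟩).continuousAt.continuousWithinAt
      · have hO : (fun r => w r - w s) =O[𝓝[Icc ε s] s] fun r => r - s :=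
          hdiff.hasDerivAt.isBigO_sub.mono nhdsWithin_le_nhds
        rw [ContinuousWithinAt, sub_self (w s), mul_zero]
        have hO2 := (Asymptotics.isBigO_refl (fun r => (s - r) ^ (-β)) (𝓝[Icc ε s] s)).mul hO
        refine hO2.trans_tendsto ?_
        have hc : Tendsto (fun r => -(s - r) ^ (1 - β)) (𝓝[Icc ε s] s) (𝓝 0) := by
          have : ContinuousAt (fun r => -(s - r) ^ (1 - β)) s := by
            refine ContinuousAt.neg (ContinuousAt.rpow_const (by fun_prop) (Or.inr (by linarith)))
          have h0 := this.tendsto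
          simp only [sub_self, Real.zero_rpow (by linarith : 1 - β ≠ 0), neg_zero] at h0
          exact h0.mono_left nhdsWithin_le_nhds
        refine hc.congr' ?_
        filter_upwards [self_mem_nhdsWithin] with r hr
        rcases hr.2.lt_or_eq with hlt | rfl
        · rw [show 1 - β = -β + 1 by ring, Real.rpow_add_one (sub_pos.2 hlt).ne']
          ring
        · simp [Real.zero_rpow (by linarith : 1 - β ≠ 0)]
    · have := h2 ε hε
      rwa [intervalIntegrable_iff_integrableOn_Icc_of_le hε.2.le] at this
    · intro s hs
      have hws := hmax s ⟨hε.1.trans hs.1, hs.2.le⟩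
      have : 0 ≤ β * (t - s) ^ (-β - 1) := by
        have := sub_pos.2 hs.2
        positivity
      simp only [smul_eq_mul]
      nlinarith
  refine le_of_tendsto_of_tendsto (f := fun ε => (Real.Gamma (1 - β))⁻¹ *
    ((t - ε) ^ (-β) * (w t - w ε))) ?_ h3 ?_
  · have hc : ContinuousWithinAt (fun ε => (Real.Gamma (1 - β))⁻¹ *
        ((t - ε) ^ (-β) * (w t - w ε))) (Ioi 0) 0 := by
      refine continuousWithinAt_const.mul (ContinuousWithinAt.mul ?_ (continuousWithinAt_const.sub hw0))
      exact (ContinuousAt.rpow_const (by fun_prop) (Or.inl (by simpa using ht.ne'))).continuousWithinAt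
    simpa using hc.tendsto
  · filter_upwards [Ioo_mem_nhdsGT ht] with ε hε
    rw [smul_eq_mul]
    gcongr
    exact hkey ε hε

/-- Comparison principle: solutions of `∂^β e = -λ e` are dominated by real supersolutions of
`∂^β p = -a p` with `a ≤ Re λ`. -/
lemma norm_le_of_hasCaputoDerivAt {e : ℝ → ℂ} {p P : ℝ → ℝ} {lam : ℂ} {a T : ℝ} (hβ : 0 < β)
    (hβ1 : β < 1) (he : ContinuousOn e (Ico 0 T)) (hp : ContinuousOn p (Ico 0 T))
    (hce : ∀ t ∈ Ioo 0 T, HasCaputoDerivAt β e (-lam * e t) t)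
    (hcp : ∀ t ∈ Ioo 0 T, HasCaputoDerivAt β p (P t) t)
    (hP : ∀ t ∈ Ioo 0 T, -a * p t ≤ P t) (ha : 0 ≤ a) (hal : a ≤ lam.re) (h0 : ‖e 0‖ ≤ p 0) :
    ∀ t ∈ Ico 0 T, ‖e t‖ ≤ p t := by
  intro t ht
  by_contra! hlt
  have hsub : Icc 0 t ⊆ Ico 0 T := Icc_subset_Ico_right ht.2
  obtain ⟨r, hr, hrmax⟩ := isCompact_Icc.exists_isMaxOn (nonempty_Icc.2 ht.1)
    ((he.norm.sub hp).mono hsub)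
  have hrpos : 0 < ‖e r‖ - p r := by
    have := hrmax (right_mem_Icc.2 ht.1)
    change ‖e t‖ - p t ≤ ‖e r‖ - p r at this
    linarith
  have hr0 : 0 < r := by
    rcases hr.1.eq_or_lt with h | h
    · rw [← h] at hrpos; linarith
    · exact h
  have hrT : r ∈ Ioo 0 T := ⟨hr0, hr.2.trans_lt ht.2⟩
  -- A unimodular rotation makes `Re (sg * e)` touch `‖e‖` from below at the maximum point `r` of
  -- `‖e‖ - p`. Then `Re (sg * e) - p` is a real function that is also maximal at `r`. There its
  -- Caputo derivative is at most `0` by the equation and positive by the extremum principle.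
  obtain ⟨sg, hsg, hsge⟩ : ∃ sg : ℂ, ‖sg‖ = 1 ∧ sg * e r = ‖e r‖ := by
    rcases eq_or_ne (e r) 0 with h | h
    · exact ⟨1, by simp [h]⟩
    · refine ⟨(starRingEnd ℂ) (e r) / ‖e r‖, ?_, ?_⟩
      · have : ‖e r‖ ≠ 0 := norm_ne_zero_iff.2 h
        simp [this]
      · have : (‖e r‖ : ℂ) ≠ 0 := by exact_mod_cast norm_ne_zero_iff.2 h
        rw [div_mul_eq_mul_div, Complex.conj_mul', div_eq_iff this]
        ring
  set Lc : ℂ →L[ℝ] ℝ := Complex.reCLM.comp (ContinuousLinearMap.mul ℝ ℂ sg) with hLc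
  have hLcv : ∀ z, Lc z = (sg * z).re := fun z => rfl
  have hcw := ((hce r hrT).clm_comp hr0 Lc).sub hr0 (hcp r hrT)
  have hle : ∀ s, Lc (e s) ≤ ‖e s‖ := fun s => by
    rw [hLcv]
    calc (sg * e s).re ≤ ‖sg * e s‖ := Complex.re_le_norm _
      _ = ‖e s‖ := by rw [norm_mul, hsg, one_mul]
  have hLr : Lc (e r) = ‖e r‖ := by rw [hLcv, hsge, Complex.ofReal_re]
  have hsubr : Ioi 0 ∩ Iio T ⊆ Ico 0 T := fun x hx => ⟨le_of_lt hx.1, hx.2⟩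
  have hT : 0 < T := ht.1.trans_lt ht.2
  have hmax := hcw.le_of_isMax hβ hβ1 hr0 ?_ ?_ ?_
  · have hval : Lc (-lam * e r) = -lam.re * ‖e r‖ := by
      rw [hLcv, show sg * (-lam * e r) = -lam * (sg * e r) by ring, hsge]
      simp
    rw [hval, hLr] at hmax
    have hw0 : Lc (e 0) - p 0 ≤ 0 := by linarith [hle 0]
    have h4 : -lam.re * ‖e r‖ - P r ≤ 0 := by
      have := hP r hrT
      nlinarith [norm_nonneg (e r)]
    have h5 : 0 < (Real.Gamma (1 - β))⁻¹ * (r ^ (-β) * (‖e r‖ - p r - (Lc (e 0) - p 0))) := by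
      have : 0 < ‖e r‖ - p r - (Lc (e 0) - p 0) := by linarith
      have hG : 0 < Real.Gamma (1 - β) := Real.Gamma_pos_of_pos (by linarith)
      positivity
    linarith
  · have hc : ContinuousOn (fun s => Lc (e s) - p s) (Ico 0 T) :=
      (Lc.continuous.comp_continuousOn he).sub hp
    refine (hc 0 ⟨le_rfl, hT⟩).mono_of_mem_nhdsWithin ?_
    exact mem_of_superset (Ioo_mem_nhdsGT hT) Ioo_subset_Ico_self
  · obtain ⟨r', hr'⟩ := exists_between hrT.2
    have hr'T : r' ∈ Ioo 0 T := ⟨hr0.trans hr'.1, hr'.2⟩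
    exact (Lc.differentiableAt.comp r ((hce r' hr'T).1 r ⟨hr0, hr'.1⟩)).sub
      ((hcp r' hr'T).1 r ⟨hr0, hr'.1⟩)
  · intro s hs
    have := hrmax (show s ∈ Icc 0 t from ⟨hs.1.le, hs.2.trans hr.2⟩)
    change ‖e s‖ - p s ≤ ‖e r‖ - p r at this
    rw [hLr]
    linarith [hle s]

end Relaxation

section Bounds

variable {β : ℝ}

/-! ### Bounds for the Mittag-Leffler function in the right half plane -/

/-- The function `E_β(-x)` of a real variable. -/
def ml (β x : ℝ) : ℝ := (mlc β 1 x).re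

lemma mlc_ofReal (x : ℝ) : mlc β 1 x = (ml β x : ℂ) := by
  have h : mlc β 1 x = ((∑' k : ℕ, (-x) ^ k / Real.Gamma (β * k + 1) : ℝ) : ℂ) := by
    rw [Complex.ofReal_tsum]
    unfold mlc
    push_cast
    rfl
  rw [ml, h, Complex.ofReal_re]

lemma ml_zero : ml β 0 = 1 := by simp [ml, mlc_one_zero]

lemma continuous_ml (hβ : 0 < β) : Continuous (ml β) :=
  Complex.continuous_re.comp ((differentiable_mlc hβ one_pos).continuous.comp
    Complex.continuous_ofReal)

lemma hasCaputoDerivAt_ml (hβ : 0 < β) (hβ1 : β < 1) (a : ℝ) {t : ℝ} (ht : 0 < t) :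
    HasCaputoDerivAt β (fun s : ℝ => ml β (a * s ^ β)) (-a * ml β (a * t ^ β)) t := by
  have h := (hasCaputoDerivAt_mlc hβ hβ1 (a : ℂ) ht).clm_comp ht Complex.reCLM
  simp only [← Complex.ofReal_mul, mlc_ofReal, ← Complex.ofReal_neg, Complex.reCLM_apply,
    Complex.ofReal_re] at h
  exact h

/-- The comparison principle for `s ↦ E_β(-w s^β)` against `s ↦ E_β(-a s^β)`, read off at time `1`.
Positivity and monotonicity of `E_β` on the negative axis are special cases. -/
lemma norm_mlc_le (hβ : 0 < β) (hβ1 : β < 1) {a : ℝ} {w : ℂ} (ha : 0 ≤ a) (haw : a ≤ w.re) :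
    ‖mlc β 1 w‖ ≤ ml β a := by
  have h := norm_le_of_hasCaputoDerivAt (e := fun s : ℝ => mlc β 1 (w * (s ^ β : ℝ)))
    (p := fun s => ml β (a * s ^ β)) (P := fun t => -a * ml β (a * t ^ β)) (T := 2) hβ hβ1
    (continuous_mlc_rpow hβ w).continuousOn
    ((continuous_ml hβ).comp (continuous_const.mul
      (Real.continuous_rpow_const hβ.le))).continuousOn
    (fun t ht => hasCaputoDerivAt_mlc hβ hβ1 w ht.1)
    (fun t ht => hasCaputoDerivAt_ml hβ hβ1 a ht.1) (fun t _ => le_rfl) ha haw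
    (by simp [Real.zero_rpow hβ.ne', mlc_one_zero, ml_zero]) 1 (by norm_num)
  simpa using h

lemma ml_nonneg (hβ : 0 < β) (hβ1 : β < 1) {x : ℝ} (hx : 0 ≤ x) : 0 ≤ ml β x :=
  (norm_nonneg _).trans (norm_mlc_le hβ hβ1 (w := x) hx (by simp))

lemma ml_anti (hβ : 0 < β) (hβ1 : β < 1) {x y : ℝ} (hx : 0 ≤ x) (hxy : x ≤ y) :
    ml β y ≤ ml β x := by
  have h := norm_mlc_le hβ hβ1 (w := y) hx (by simpa)
  rw [mlc_ofReal, Complex.norm_real] at h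
  exact (le_abs_self _).trans h

/-- The recurrence relation between `E_{β,1+β}` and `E_β`. -/
lemma mul_mlc_one_add (hβ : 0 < β) (w : ℂ) : w * mlc β (1 + β) w = 1 - mlc β 1 w := by
  have h1 := (summable_mlc hβ one_pos w).hasSum
  rw [← hasSum_nat_add_iff' 1] at h1
  have h2 := ((summable_mlc hβ (c := 1 + β) (by linarith) w).hasSum).mul_left (-w)
  have h3 := h2.unique (by
    convert! h1 using 2 with k
    rw [pow_succ]
    push_cast
    rw [show β * ((k : ℝ) + 1) + 1 = β * k + (1 + β) by ring]
    ring)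
  simp only [Finset.range_one, Finset.sum_singleton, pow_zero, Nat.cast_zero, mul_zero, zero_add,
    Real.Gamma_one, Complex.ofReal_one, div_one] at h3
  unfold mlc
  linear_combination -h3

/-- In integrated form the relaxation equation reads `x ∫₀¹ (1-s)^(β-1) E_β(-x s^β) ds = Γ(β) (1 -
E_β(-x))`. By monotonicity the integral is at least `E_β(-x) / β`. -/
lemma ml_mul_le (hβ : 0 < β) (hβ1 : β < 1) {x : ℝ} (hx : 0 ≤ x) :
    ml β x * (1 + x / Real.Gamma (β + 1)) ≤ 1 := by
  have hG : 0 < Real.Gamma β := Real.Gamma_pos_of_pos hβ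
  obtain ⟨hint, h⟩ := integral_kernel_mlc hβ one_pos hβ one_pos (x : ℂ)
  have hre : ∀ s : ℝ, (((1 - s) ^ (β - 1) * s ^ ((1 : ℝ) - 1) : ℝ) : ℂ) *
      mlc β 1 (x * (s ^ β : ℝ)) = (((1 - s) ^ (β - 1) * ml β (x * s ^ β) : ℝ) : ℂ) := fun s => by
    rw [sub_self, Real.rpow_zero, mul_one, ← Complex.ofReal_mul, mlc_ofReal, Complex.ofReal_mul]
  simp_rw [hre] at hint h
  have hint' : IntervalIntegrable (fun s => (1 - s) ^ (β - 1) * ml β (x * s ^ β)) volume 0 1 :=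
    ⟨by have := Integrable.re hint.1; change Integrable _ _; simpa using this, by simp⟩
  rw [intervalIntegral.integral_ofReal, Real.one_rpow, Real.one_rpow, Complex.ofReal_one, mul_one,
    mul_one] at h
  have hrec := mul_mlc_one_add hβ (x : ℂ)
  have hI : x * ∫ s in (0 : ℝ)..1, (1 - s) ^ (β - 1) * ml β (x * s ^ β) =
      Real.Gamma β * (1 - ml β x) := by
    apply Complex.ofReal_injective
    rw [Complex.ofReal_mul]
    erw [h]
    rw [mlc_ofReal] at hrec
    push_cast
    rw [← hrec]
    ring
  have hlow : ml β x / β ≤ ∫ s in (0 : ℝ)..1, (1 - s) ^ (β - 1) * ml β (x * s ^ β) := by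
    have hb := integral_beta one_pos hβ one_pos
    have hbi := intervalIntegrable_beta one_pos hβ one_pos
    simp only [sub_self, Real.rpow_zero, mul_one, Real.Gamma_one, Real.one_rpow, one_mul] at hb hbi
    rw [add_comm 1 β, Real.Gamma_add_one hβ.ne', div_mul_cancel_right₀ hG.ne'] at hb
    rw [div_eq_inv_mul, ← hb, ← intervalIntegral.integral_mul_const]
    refine intervalIntegral.integral_mono_on zero_le_one (hbi.mul_const _) hint' fun s hs => ?_
    have h1s : 0 ≤ 1 - s := by linarith [hs.2]
    have : s ^ β ≤ 1 := Real.rpow_le_one hs.1 hs.2 hβ.le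
    have : 0 ≤ s ^ β := Real.rpow_nonneg hs.1 _
    refine mul_le_mul_of_nonneg_left (ml_anti hβ hβ1 (by positivity) ?_) (by positivity)
    nlinarith
  rw [Real.Gamma_add_one hβ.ne']
  have h5 : x * (ml β x / β) ≤ Real.Gamma β * (1 - ml β x) := by rw [← hI]; gcongr
  have h6 : Real.Gamma β * (ml β x * (1 + x / (β * Real.Gamma β))) ≤ Real.Gamma β * 1 := by
    have : Real.Gamma β * (ml β x * (1 + x / (β * Real.Gamma β))) =
      Real.Gamma β * ml β x + x * (ml β x / β) := by field_simp
    linarith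
  exact le_of_mul_le_mul_left h6 hG

lemma norm_mlc_le_div (hβ : 0 < β) (hβ1 : β < 1) {a : ℝ} {w : ℂ} (ha : 0 < a) (haw : a ≤ w.re) :
    ‖mlc β 1 w‖ ≤ Real.Gamma (β + 1) / a := by
  refine (norm_mlc_le hβ hβ1 ha.le haw).trans ?_
  have h := ml_mul_le hβ hβ1 ha.le
  have hG : 0 < Real.Gamma (β + 1) := Real.Gamma_pos_of_pos (by linarith)
  have h0 := ml_nonneg hβ hβ1 ha.le
  rw [le_div_iff₀ ha]
  rw [mul_add, mul_one, mul_div_assoc', ] at h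
  have : ml β a * a / Real.Gamma (β + 1) ≤ 1 := by linarith
  rwa [div_le_one hG] at this

/-- The extremum principle for `s ↦ -E_β(-x s^β)`, which is largest on `(0, 1]` at `s = 1`. -/
lemma one_sub_ml_le (hβ : 0 < β) (hβ1 : β < 1) {x : ℝ} (hx : 0 ≤ x) :
    (Real.Gamma (1 - β))⁻¹ * (1 - ml β x) ≤ x * ml β x := by
  have h := (hasCaputoDerivAt_ml hβ hβ1 x one_pos).clm_comp one_pos (-ContinuousLinearMap.id ℝ ℝ)
  have hc : Continuous fun s => -(ml β (x * s ^ β)) := ((continuous_ml hβ).comp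
    (continuous_const.mul (Real.continuous_rpow_const hβ.le))).neg
  have h2 := h.le_of_isMax hβ hβ1 one_pos hc.continuousAt.continuousWithinAt ?_ ?_
  · simp only [Real.one_rpow, Real.zero_rpow hβ.ne', mul_one, mul_zero, ml_zero, one_mul,
      _root_.neg_apply, ContinuousLinearMap.id_apply] at h2
    linarith
  · exact (((hasCaputoDerivAt_ml hβ hβ1 x two_pos).clm_comp two_pos
      (-ContinuousLinearMap.id ℝ ℝ)).1 1 (by norm_num))
  · intro s hs
    have h1 : s ^ β ≤ 1 := Real.rpow_le_one hs.1.le hs.2 hβ.le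
    have h3 : 0 ≤ s ^ β := Real.rpow_nonneg hs.1.le _
    have := ml_anti hβ hβ1 (x := x * s ^ β) (y := x) (by positivity) (by nlinarith)
    simpa using this

/-- A lower bound uniform in `x ≥ x₀`; it permits division by the multipliers `μ_j x E_β(-μ_j x)`.
-/
lemma mul_ml_pos (hβ : 0 < β) (hβ1 : β < 1) {x₀ x : ℝ} (hx₀ : 0 < x₀) (hx : x₀ ≤ x) :
    (Real.Gamma (1 - β))⁻¹ * (1 - ml β x₀) ≤ x * ml β x ∧
      0 < (Real.Gamma (1 - β))⁻¹ * (1 - ml β x₀) := by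
  have hG : 0 < Real.Gamma (1 - β) := Real.Gamma_pos_of_pos (by linarith)
  have hG' : 0 < Real.Gamma (β + 1) := Real.Gamma_pos_of_pos (by linarith)
  refine ⟨le_trans ?_ (one_sub_ml_le hβ hβ1 (hx₀.le.trans hx)), ?_⟩
  · have := ml_anti hβ hβ1 hx₀.le hx
    gcongr
  · have h1 := ml_mul_le hβ hβ1 hx₀.le
    have h0 := ml_nonneg hβ hβ1 hx₀.le
    have h2 : 0 < x₀ / Real.Gamma (β + 1) := by positivity
    have : ml β x₀ < 1 := by
      by_contra! h
      nlinarith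
    have : 0 < 1 - ml β x₀ := by linarith
    positivity

lemma sub_le_re_of_norm_sub_le {w : ℂ} {x r : ℝ} (h : ‖w - x‖ ≤ r) : x - r ≤ w.re := by
  have := (Complex.abs_re_le_norm (w - x)).trans h
  simp only [Complex.sub_re, Complex.ofReal_re] at this
  linarith [(abs_le.1 this).1]

/-- Cauchy's estimate on the circle of radius `x / 4` about `w`, which stays in the disc enlarged by
`x / 4`. -/
lemma norm_deriv_le_of_sector {f : ℂ → ℂ} (hf : Differentiable ℂ f) {w : ℂ} {x a M : ℝ}
    (hx : 0 < x) (hw : ‖w - x‖ ≤ a * x)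
    (hM : ∀ z : ℂ, ‖z - x‖ ≤ (a + 1 / 4) * x → ‖f z‖ ≤ M) : ‖deriv f w‖ ≤ M / (x / 4) := by
  refine Complex.norm_deriv_le_of_forall_mem_sphere_norm_le (by positivity)
    hf.diffContOnCl fun z hz => hM z ?_
  rw [mem_sphere_iff_norm] at hz
  calc ‖z - x‖ ≤ ‖z - w‖ + ‖w - x‖ := norm_sub_le_norm_sub_add_norm_sub _ _ _
    _ ≤ _ := by rw [hz]; linarith

lemma norm_deriv_mlc_le (hβ : 0 < β) (hβ1 : β < 1) {w : ℂ} {x : ℝ} (hx : 0 < x)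
    (hw : ‖w - x‖ ≤ 1 / 2 * x) : ‖deriv (mlc β 1) w‖ ≤ 16 * Real.Gamma (β + 1) / x ^ 2 := by
  refine (norm_deriv_le_of_sector (differentiable_mlc hβ one_pos) hx hw (fun z hz => ?_)).trans_eq
    (b := Real.Gamma (β + 1) / (x / 4) / (x / 4)) (by field_simp; norm_num)
  refine norm_mlc_le_div hβ hβ1 (by positivity) ?_
  have := sub_le_re_of_norm_sub_le hz
  linarith

end Bounds

section Asymptotics

variable {β : ℝ}

/-! ### Asymptotics of `w E_β(-w)` in a sector -/

lemma norm_rpow_mul_sub_le {w : ℂ} {x a s : ℝ} (hs : 0 < s) (hw : ‖w - x‖ ≤ a * x) :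
    ‖w * (s ^ β : ℝ) - ((x * s ^ β : ℝ) : ℂ)‖ ≤ a * (x * s ^ β) := by
  have : 0 < s ^ β := Real.rpow_pos_of_pos hs β
  rw [Complex.ofReal_mul, ← sub_mul, norm_mul, Complex.norm_real, Real.norm_of_nonneg this.le]
  nlinarith

lemma norm_le_of_norm_sub_le {w : ℂ} {x a : ℝ} (hx : 0 ≤ x) (hw : ‖w - x‖ ≤ a * x) :
    ‖w‖ ≤ (a + 1) * x := by
  calc ‖w‖ = ‖(w - x) + x‖ := by rw [sub_add_cancel]
    _ ≤ ‖w - x‖ + ‖(x : ℂ)‖ := norm_add_le _ _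
    _ ≤ _ := by rw [Complex.norm_real, Real.norm_of_nonneg hx]; linarith

/-- With `e(s) = E_β(-w s^β)`, the equation at time `1` says `∫₀¹ (1-s)^(-β) e'(s) ds = -Γ(1-β) w
E_β(-w)`. On `(0, 1/2)` integration by parts leaves the boundary value `-e(0) = -1`, which is the
source of the limit `1 / Γ(1-β)`, and terms bounded through `‖e(s)‖ ≤ (2G/x) s^(-β)`. On `(1/2, 1)`
the derivative itself is `O(1/x)`. The three summands of the constant come from the boundary term at
`1/2` and the two remaining integrals. -/
lemma norm_mul_mlc_sub_le (hβ : 0 < β) (hβ1 : β < 1) : ∃ C : ℝ, 0 < C ∧ ∀ (x : ℝ) (w : ℂ), 0 < x →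
    ‖w - x‖ ≤ 1 / 2 * x → ‖w * mlc β 1 w - ((Real.Gamma (1 - β))⁻¹ : ℝ)‖ ≤ C / x := by
  set G := Real.Gamma (β + 1) with hG
  have hG0 : 0 < G := Real.Gamma_pos_of_pos (by linarith)
  have hG1 : 0 < Real.Gamma (1 - β) := Real.Gamma_pos_of_pos (by linarith)
  have h1β : 0 < 1 - β := by linarith
  refine ⟨(Real.Gamma (1 - β))⁻¹ * (8 * G + 8 * G / (1 - β) + 96 * G / (1 - β)), by positivity,
    fun x w hx hw => ?_⟩
  set e : ℝ → ℂ := fun s : ℝ => mlc β 1 (w * (s ^ β : ℝ)) with he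
  have hec : Continuous e := continuous_mlc_rpow hβ w
  have hint := intervalIntegrable_kernel_smul_deriv_mlc hβ hβ1 w one_pos
  have hval := integral_kernel_smul_deriv_mlc hβ hβ1 w one_pos
  rw [Real.one_rpow, Complex.ofReal_one, mul_one] at hval
  change IntervalIntegrable (fun s => (1 - s) ^ (-β) • deriv e s) volume 0 1 at hint
  change ∫ s in (0 : ℝ)..1, (1 - s) ^ (-β) • deriv e s = _ at hval
  have hi1 : IntervalIntegrable (fun s => (1 - s) ^ (-β) • deriv e s) volume 0 (1 / 2) :=
    hint.mono_set (by rw [uIcc_of_le (by norm_num), uIcc_of_le (by norm_num)]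
                      exact Icc_subset_Icc_right (by norm_num))
  have hi2 : IntervalIntegrable (fun s => (1 - s) ^ (-β) • deriv e s) volume (1 / 2) 1 :=
    hint.mono_set (by rw [uIcc_of_le (by norm_num), uIcc_of_le (by norm_num)]
                      exact Icc_subset_Icc_left (by norm_num))
  have hsplit := intervalIntegral.integral_add_adjacent_intervals hi1 hi2
  have hre : ∀ s : ℝ, 0 < s → x / 2 * s ^ β ≤ (w * (s ^ β : ℝ)).re := fun s hs => by
    have := sub_le_re_of_norm_sub_le (norm_rpow_mul_sub_le (β := β) hs hw)
    linarith
  have heb : ∀ s : ℝ, 0 < s → ‖e s‖ ≤ 2 * G / x * s ^ (-β) := fun s hs => by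
    have hsβ : 0 < s ^ β := Real.rpow_pos_of_pos hs β
    refine (norm_mlc_le_div hβ hβ1 (a := x / 2 * s ^ β) (by positivity) (hre s hs)).trans_eq ?_
    rw [Real.rpow_neg hs.le, ← hG]
    field_simp
  -- the part near the origin
  have hder : ∀ s ∈ Ioo (min 0 (1 / 2 : ℝ)) (max 0 (1 / 2)),
      HasDerivAt (fun s : ℝ => (((1 - s) ^ (-β) : ℝ) : ℂ))
        ((β * (1 - s) ^ (-β - 1) : ℝ) : ℂ) s := fun s hs => by
    norm_num at hs
    have h := ((hasDerivAt_id s).const_sub 1).rpow_const (p := -β)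
      (Or.inl (by simp only [id]; linarith))
    refine (h.congr_deriv ?_).ofReal_comp
    simp
  have hcu : ∀ p : ℝ, ContinuousOn (fun s : ℝ => (((1 - s) ^ p : ℝ) : ℂ)) (uIcc 0 (1 / 2)) :=
    fun p => by
      refine Complex.continuous_ofReal.comp_continuousOn (ContinuousOn.rpow_const (by fun_prop) ?_)
      intro s hs
      rw [uIcc_of_le (by norm_num)] at hs
      left
      linarith [hs.2]
  have hcu' : ContinuousOn (fun s : ℝ => ((β * (1 - s) ^ (-β - 1) : ℝ) : ℂ)) (uIcc 0 (1 / 2)) := by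
    simp_rw [Complex.ofReal_mul]
    exact continuousOn_const.mul (hcu _)
  have hie : IntervalIntegrable (deriv e) volume 0 (1 / 2) := by
    have h1 := hi1.continuousOn_smul (f := fun s : ℝ => (1 - s) ^ β) ?_
    · refine h1.congr ?_
      rw [uIoc_of_le (by norm_num)]
      intro s hs
      have : 0 < 1 - s := by linarith [hs.2]
      simp only
      rw [smul_smul, ← Real.rpow_add this, add_neg_cancel, Real.rpow_zero, one_smul]
    · exact (ContinuousOn.rpow_const (by fun_prop) fun s _ => Or.inr hβ.le)
  have hparts := intervalIntegral.integral_mul_deriv_eq_deriv_mul_of_hasDerivAt (a := 0) (b := 1 / 2)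
    (u := fun s : ℝ => (((1 - s) ^ (-β) : ℝ) : ℂ)) (v := e)
    (u' := fun s => ((β * (1 - s) ^ (-β - 1) : ℝ) : ℂ)) (v' := deriv e) (hcu _)
    hec.continuousOn hder (fun s hs => by
      norm_num at hs
      exact (hasDerivAt_mlc_rpow hβ w hs.1).differentiableAt.hasDerivAt) hcu'.intervalIntegrable hie
  have he0 : e 0 = 1 := by simp [he, Real.zero_rpow hβ.ne', mlc_one_zero]
  rw [he0, sub_zero, Real.one_rpow, Complex.ofReal_one, mul_one] at hparts
  have hB1 : ‖(((1 - 1 / 2 : ℝ) ^ (-β) : ℝ) : ℂ) * e (1 / 2)‖ ≤ 8 * G / x := by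
    have h2 : ((1 : ℝ) / 2) ^ (-β) ≤ 2 := by
      rw [one_div, Real.inv_rpow zero_le_two, Real.rpow_neg zero_le_two, inv_inv]
      calc (2 : ℝ) ^ β ≤ 2 ^ (1 : ℝ) := Real.rpow_le_rpow_of_exponent_le (by norm_num) hβ1.le
        _ = 2 := Real.rpow_one 2
    have h3 : 0 < ((1 : ℝ) / 2) ^ (-β) := by positivity
    have h4 := heb (1 / 2) (by norm_num)
    rw [norm_mul, Complex.norm_real, show (1 : ℝ) - 1 / 2 = 1 / 2 by norm_num,
      Real.norm_of_nonneg h3.le]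
    calc ((1 : ℝ) / 2) ^ (-β) * ‖e (1 / 2)‖
        ≤ 2 * (2 * G / x * 2) := by gcongr; exact h4.trans (by gcongr)
      _ = 8 * G / x := by ring
  have hpow : ∀ s : ℝ, 1 / 2 ≤ s → ∀ p : ℝ, -2 ≤ p → p ≤ 0 → s ^ p ≤ 4 := fun s hs p hp hp0 => by
    calc s ^ p ≤ (1 / 2 : ℝ) ^ p := Real.rpow_le_rpow_of_nonpos (by norm_num) hs hp0
      _ ≤ (1 / 2 : ℝ) ^ (-2 : ℝ) :=
        Real.rpow_le_rpow_of_exponent_ge (by norm_num) (by norm_num) hp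
      _ = 4 := by rw [Real.rpow_neg (by norm_num)]; norm_num
  have hintβ : ∫ s in (0 : ℝ)..1, s ^ (-β) = 1 / (1 - β) := by
    rw [integral_rpow (Or.inl (by linarith)), Real.one_rpow, Real.zero_rpow (by linarith)]
    congr 1 <;> ring
  have hiβ : IntervalIntegrable (fun s : ℝ => s ^ (-β)) volume 0 1 :=
    intervalIntegral.intervalIntegrable_rpow' (by linarith)
  have hB2 : ‖∫ s in (0 : ℝ)..(1 / 2), ((β * (1 - s) ^ (-β - 1) : ℝ) : ℂ) * e s‖ ≤
      8 * G / (1 - β) / x := by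
    calc ‖∫ s in (0 : ℝ)..(1 / 2), ((β * (1 - s) ^ (-β - 1) : ℝ) : ℂ) * e s‖
        ≤ ∫ s in (0 : ℝ)..(1 / 2), 8 * G / x * s ^ (-β) := by
          refine intervalIntegral.norm_integral_le_of_norm_le (by norm_num) ?_ ?_
          · refine ae_of_all _ fun s hs => ?_
            have h1 := hpow (1 - s) (by linarith [hs.2]) (-β - 1) (by linarith) (by linarith)
            have h1s : 0 ≤ 1 - s := by linarith [hs.2]
            have h2 : 0 ≤ (1 - s) ^ (-β - 1) := by positivity
            rw [norm_mul, Complex.norm_real, Real.norm_of_nonneg (by positivity)]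
            calc β * (1 - s) ^ (-β - 1) * ‖e s‖ ≤ 1 * 4 * (2 * G / x * s ^ (-β)) := by
                  gcongr
                  exact heb s hs.1
              _ = _ := by ring
          · exact (hiβ.mono_set (by
              rw [uIcc_of_le (by norm_num), uIcc_of_le (by norm_num)]
              exact Icc_subset_Icc_right (by norm_num))).const_mul _
      _ = 8 * G / x * ∫ s in (0 : ℝ)..(1 / 2), s ^ (-β) := by
          rw [intervalIntegral.integral_const_mul]
      _ ≤ 8 * G / x * ∫ s in (0 : ℝ)..1, s ^ (-β) := by
          gcongr
          refine intervalIntegral.integral_mono_interval le_rfl (by norm_num) (by norm_num) ?_ hiβ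
          filter_upwards [ae_restrict_mem measurableSet_Ioc] with s hs
          exact Real.rpow_nonneg hs.1.le _
      _ = _ := by rw [hintβ]; field_simp
  have hB3 : ‖∫ s in (1 / 2 : ℝ)..1, (1 - s) ^ (-β) • deriv e s‖ ≤ 96 * G / (1 - β) / x := by
    have hiβ' : IntervalIntegrable (fun s : ℝ => (1 - s) ^ (-β)) volume 0 1 := by
      have := hiβ.comp_sub_left 1
      simpa using this.symm
    calc ‖∫ s in (1 / 2 : ℝ)..1, (1 - s) ^ (-β) • deriv e s‖
        ≤ ∫ s in (1 / 2 : ℝ)..1, 96 * G / x * (1 - s) ^ (-β) := by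
          refine intervalIntegral.norm_integral_le_of_norm_le (by norm_num) ?_ ?_
          · refine ae_of_all _ fun s hs => ?_
            have hs0 : 0 < s := by linarith [hs.1]
            have hsβ : 0 < s ^ β := Real.rpow_pos_of_pos hs0 β
            have h1s : 0 ≤ 1 - s := by linarith [hs.2]
            have hd : deriv e s = deriv (mlc β 1) (w * (s ^ β : ℝ)) *
                (w * ((β * s ^ (β - 1) : ℝ) : ℂ)) := by
              have h1 : HasDerivAt (fun s : ℝ => w * ((s ^ β : ℝ) : ℂ))
                  (w * ((β * s ^ (β - 1) : ℝ) : ℂ)) s :=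
                ((Real.hasDerivAt_rpow_const (Or.inl hs0.ne')).ofReal_comp).const_mul w
              exact ((differentiable_mlc hβ one_pos _).hasDerivAt.comp s h1).deriv
            have hdb := norm_deriv_mlc_le hβ hβ1 (x := x * s ^ β) (by positivity)
              (norm_rpow_mul_sub_le (β := β) hs0 hw)
            have hwb := norm_le_of_norm_sub_le hx.le hw
            have hs1 : 0 ≤ s ^ (β - 1) := by positivity
            rw [norm_smul, Real.norm_of_nonneg (by positivity), mul_comm]
            gcongr
            rw [hd, norm_mul, norm_mul, Complex.norm_real, Real.norm_of_nonneg (by positivity)]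
            calc ‖deriv (mlc β 1) (w * (s ^ β : ℝ))‖ * (‖w‖ * (β * s ^ (β - 1)))
                ≤ 16 * G / (x * s ^ β) ^ 2 * ((1 / 2 + 1) * x * (1 * s ^ (β - 1))) := by gcongr
              _ = 24 * G / x * (s ^ (β - 1) * (s ^ β)⁻¹ * (s ^ β)⁻¹) := by
                  field_simp
                  ring
              _ = 24 * G / x * s ^ (-β - 1) := by
                  rw [← Real.rpow_neg hs0.le, ← Real.rpow_add hs0, ← Real.rpow_add hs0]
                  ring_nf
              _ ≤ 24 * G / x * 4 := by
                  gcongr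
                  exact hpow s hs.1.le _ (by linarith) (by linarith)
              _ = _ := by ring
          · exact (hiβ'.mono_set (by
              rw [uIcc_of_le (by norm_num), uIcc_of_le (by norm_num)]
              exact Icc_subset_Icc_left (by norm_num))).const_mul _
      _ = 96 * G / x * ∫ s in (1 / 2 : ℝ)..1, (1 - s) ^ (-β) := by
          rw [intervalIntegral.integral_const_mul]
      _ ≤ 96 * G / x * ∫ s in (0 : ℝ)..1, (1 - s) ^ (-β) := by
          gcongr
          refine intervalIntegral.integral_mono_interval (by norm_num) (by norm_num) le_rfl ?_ hiβ'
          filter_upwards [ae_restrict_mem measurableSet_Ioc] with s hs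
          exact Real.rpow_nonneg (by linarith [hs.2]) _
      _ = _ := by
          have := intervalIntegral.integral_comp_sub_left (fun s : ℝ => s ^ (-β)) (1 : ℝ)
            (a := 0) (b := 1)
          rw [sub_self, sub_zero] at this
          rw [this, hintβ]
          field_simp
  have hfirst : ∫ s in (0 : ℝ)..(1 / 2), (1 - s) ^ (-β) • deriv e s =
      (((1 - 1 / 2 : ℝ) ^ (-β) : ℝ) : ℂ) * e (1 / 2) - 1 -
        ∫ s in (0 : ℝ)..(1 / 2), ((β * (1 - s) ^ (-β - 1) : ℝ) : ℂ) * e s := by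
    rw [← hparts]
    simp_rw [Complex.real_smul]
  have hfin : w * mlc β 1 w - ((Real.Gamma (1 - β))⁻¹ : ℝ) =
      -((Real.Gamma (1 - β))⁻¹ : ℝ) * ((((1 - 1 / 2 : ℝ) ^ (-β) : ℝ) : ℂ) * e (1 / 2) -
        (∫ s in (0 : ℝ)..(1 / 2), ((β * (1 - s) ^ (-β - 1) : ℝ) : ℂ) * e s) +
        ∫ s in (1 / 2 : ℝ)..1, (1 - s) ^ (-β) • deriv e s) := by
    have hGc : (Real.Gamma (1 - β) : ℂ) ≠ 0 := by exact_mod_cast hG1.ne'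
    have h1 : w * mlc β 1 w = -((Real.Gamma (1 - β))⁻¹ : ℝ) *
        (-w * (Real.Gamma (1 - β) * mlc β 1 w)) := by
      push_cast
      field_simp
    rw [h1, ← hval, ← hsplit, hfirst]
    ring
  rw [hfin, norm_mul, norm_neg, Complex.norm_real, Real.norm_of_nonneg (by positivity)]
  calc (Real.Gamma (1 - β))⁻¹ * ‖_‖
      ≤ (Real.Gamma (1 - β))⁻¹ * (8 * G / x + 8 * G / (1 - β) / x + 96 * G / (1 - β) / x) := by
        gcongr
        exact (norm_add_le _ _).trans (add_le_add ((norm_sub_le _ _).trans (add_le_add hB1 hB2)) hB3)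
    _ = _ := by ring

/-- The function `w E_β(-w)`. -/
def wml (β : ℝ) (w : ℂ) : ℂ := w * mlc β 1 w

lemma differentiable_wml (hβ : 0 < β) : Differentiable ℂ (wml β) :=
  differentiable_id.mul (differentiable_mlc hβ one_pos)

/-- For `x > 1`, Cauchy's estimate is applied after subtracting the limit at infinity, which gains a
second power of `1/x`; for `x ≤ 1` compactness suffices. The bound is integrable in `x`, hence the
bounded variation of `wml β` along rays. -/
lemma norm_deriv_wml_le (hβ : 0 < β) (hβ1 : β < 1) : ∃ C : ℝ, 0 < C ∧ ∀ (x : ℝ) (w : ℂ), 0 < x →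
    ‖w - x‖ ≤ 1 / 4 * x → ‖deriv (wml β) w‖ ≤ C / (1 + x) ^ 2 := by
  obtain ⟨C, hC, hb⟩ := norm_mul_mlc_sub_le hβ hβ1
  obtain ⟨M, hM⟩ := (isCompact_closedBall (0 : ℂ) 2).exists_bound_of_continuousOn
    (f := deriv (wml β)) ((differentiable_wml hβ).contDiff (n := 1) |>.continuous_deriv
      le_rfl).continuousOn
  have hM0 : 0 ≤ M := (norm_nonneg _).trans (hM 0 (by simp))
  refine ⟨16 * C + 4 * M, by positivity, fun x w hx hw => ?_⟩
  rw [le_div_iff₀ (by positivity)]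
  rcases le_or_gt x 1 with h1 | h1
  · have := norm_le_of_norm_sub_le hx.le hw
    have h2 := hM w (by simp; linarith)
    calc ‖deriv (wml β) w‖ * (1 + x) ^ 2 ≤ M * (1 + 1) ^ 2 := by gcongr
      _ ≤ _ := by linarith
  · have h2 := norm_deriv_le_of_sector (f := fun w => wml β w - ((Real.Gamma (1 - β))⁻¹ : ℝ))
      (a := 1 / 4) (M := C / x) ((differentiable_wml hβ).sub_const _) hx hw
      (fun z hz => hb x z hx (by linarith))
    rw [deriv_sub_const] at h2
    calc ‖deriv (wml β) w‖ * (1 + x) ^ 2 ≤ C / x / (x / 4) * (2 * x) ^ 2 := by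
          gcongr
          linarith
      _ = 16 * C := by field_simp; norm_num
      _ ≤ _ := by linarith

/-- The derivative bound integrated along the ray through `w`, using `‖w‖ ≤ 5x/4 ≤ 2x`. The right
side is a difference, so it telescopes along an increasing sequence. -/
lemma norm_wml_sub_le {C : ℝ} (hβ : 0 < β) (hC : ∀ (x : ℝ) (w : ℂ), 0 < x →
    ‖w - x‖ ≤ 1 / 4 * x → ‖deriv (wml β) w‖ ≤ C / (1 + x) ^ 2) {x : ℝ} {w : ℂ} (hx : 0 < x)
    (hw : ‖w - x‖ ≤ 1 / 4 * x) {m n : ℝ} (hm : 0 ≤ m) (hmn : m ≤ n) :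
    ‖wml β (n * w) - wml β (m * w)‖ ≤ 2 * C * (1 / (1 + m * x) - 1 / (1 + n * x)) := by
  have hC0 : 0 ≤ C := by
    have := (norm_nonneg _).trans (hC x w hx hw)
    by_contra! h
    have h2 : C / (1 + x) ^ 2 < 0 := div_neg_of_neg_of_pos h (by positivity)
    linarith
  have hder : ∀ r : ℝ, HasDerivAt (fun r : ℝ => wml β (r * w) - wml β (m * w))
      (deriv (wml β) (r * w) * (1 * w)) r := fun r =>
    ((((differentiable_wml hβ) (r * w)).hasDerivAt).comp r
      ((Complex.ofRealCLM.hasDerivAt (x := r)).mul_const w)).sub_const _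
  have hB : ∀ r : ℝ, 0 ≤ r → HasDerivAt (fun r : ℝ => 2 * C * (1 / (1 + m * x) - 1 / (1 + r * x)))
      (2 * C * (x / (1 + r * x) ^ 2)) r := fun r hr => by
    have hne : 1 + r * x ≠ 0 := by positivity
    have := ((((hasDerivAt_id r).mul_const x).const_add 1).inv hne).const_sub (1 / (1 + m * x))
    have h2 := this.const_mul (2 * C)
    simp only [one_div]
    simp only [one_div, id, one_mul] at h2
    refine h2.congr_deriv ?_
    ring
  have key := image_norm_le_of_norm_deriv_right_le_deriv_boundary' (a := m) (b := n)
    (f := fun r : ℝ => wml β (r * w) - wml β (m * w)) (f' := fun r => deriv (wml β) (r * w) * (1 * w))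
    (fun r _ => (hder r).continuousAt.continuousWithinAt) (fun r _ => (hder r).hasDerivWithinAt)
    (B := fun r : ℝ => 2 * C * (1 / (1 + m * x) - 1 / (1 + r * x)))
    (B' := fun r => 2 * C * (x / (1 + r * x) ^ 2)) (by simp)
    (fun r hr => (hB r (hm.trans hr.1)).continuousAt.continuousWithinAt)
    (fun r hr => (hB r (hm.trans hr.1)).hasDerivWithinAt) ?_ (right_mem_Icc.2 hmn)
  · exact key
  · intro r hr
    have hr0 : 0 ≤ r := hm.trans hr.1
    have hwb := norm_le_of_norm_sub_le hx.le hw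
    rw [one_mul, norm_mul]
    rcases hr0.eq_or_lt with h0 | h0
    · rw [← h0]
      -- The hypothesis covers only discs with positive centre; the value at the origin follows by
      -- continuity.
      have hlim : ‖deriv (wml β) ((0 : ℝ) * w)‖ ≤ C := by
        have hcont : Continuous fun r : ℝ => ‖deriv (wml β) (r * w)‖ :=
          (((differentiable_wml hβ).contDiff (n := 1)).continuous_deriv le_rfl).norm.comp
            (Complex.continuous_ofReal.mul continuous_const)
        refine le_of_tendsto (hcont.continuousAt.tendsto.mono_left
          (nhdsWithin_le_nhds (s := Ioi 0))) ?_
        filter_upwards [self_mem_nhdsWithin] with r hr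
        have hr' : (0 : ℝ) < r := hr
        refine (hC (r * x) (r * w) (by positivity) ?_).trans
          (div_le_self hC0 (one_le_pow₀ (by nlinarith [mul_pos hr' hx])))
        rw [Complex.ofReal_mul, ← mul_sub, norm_mul, Complex.norm_real, Real.norm_of_nonneg hr'.le]
        nlinarith
      calc ‖deriv (wml β) ((0 : ℝ) * w)‖ * ‖w‖ ≤ C * ((1 / 4 + 1) * x) := by gcongr
        _ ≤ 2 * C * (x / (1 + 0 * x) ^ 2) := by
          have : 0 ≤ C * x := by positivity
          norm_num
          linarith
    · calc ‖deriv (wml β) (r * w)‖ * ‖w‖ ≤ C / (1 + r * x) ^ 2 * ((1 / 4 + 1) * x) := by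
            gcongr
            refine hC (r * x) (r * w) (by positivity) ?_
            rw [Complex.ofReal_mul, ← mul_sub, norm_mul, Complex.norm_real,
              Real.norm_of_nonneg hr0]
            nlinarith
        _ = C * (x / (1 + r * x) ^ 2) * (5 / 4) := by ring
        _ ≤ C * (x / (1 + r * x) ^ 2) * 2 := by gcongr; norm_num
        _ = _ := by ring

lemma norm_wml_le {C : ℝ} (hβ : 0 < β) (hC : ∀ (x : ℝ) (w : ℂ), 0 < x →
    ‖w - x‖ ≤ 1 / 4 * x → ‖deriv (wml β) w‖ ≤ C / (1 + x) ^ 2) {x : ℝ} {w : ℂ} (hx : 0 < x)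
    (hw : ‖w - x‖ ≤ 1 / 4 * x) {n : ℝ} (hn : 0 ≤ n) : ‖wml β (n * w)‖ ≤ 2 * C := by
  have h := norm_wml_sub_le hβ hC hx hw le_rfl hn
  have hC0 : 0 ≤ C := by
    have := (norm_nonneg _).trans (hC x w hx hw)
    by_contra! h
    have h2 : C / (1 + x) ^ 2 < 0 := div_neg_of_neg_of_pos h (by positivity)
    linarith
  simp only [Complex.ofReal_zero, zero_mul, wml, sub_zero, add_zero, div_one] at h
  refine h.trans ?_
  have : 0 ≤ 1 / (1 + n * x) := by positivity
  nlinarith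

end Asymptotics

/-! ### Dirichlet's test with multipliers of bounded variation -/

/-- Abel summation: only the partial sums of `b` enter, never the sums of `‖b i‖`. -/
lemma norm_sum_mul_le {b ρ : ℕ → ℂ} {ε C V : ℝ} (hS : ∀ j, ‖∑ i ∈ Finset.range j, b i‖ ≤ ε)
    (hρ : ∀ n, ‖ρ n‖ ≤ C) (hV : ∀ N, ∑ n ∈ Finset.range N, ‖ρ n - ρ (n + 1)‖ ≤ V) (L : ℕ) :
    ‖∑ i ∈ Finset.range L, b i * ρ i‖ ≤ ε * (C + V) := by
  have hε : 0 ≤ ε := (norm_nonneg _).trans (hS 0)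
  have hparts : ∀ L, ∑ i ∈ Finset.range L, b i * ρ i = (∑ i ∈ Finset.range L, b i) * ρ L +
      ∑ n ∈ Finset.range L, (∑ i ∈ Finset.range (n + 1), b i) * (ρ n - ρ (n + 1)) := by
    intro L
    induction L with
    | zero => simp
    | succ L ih =>
      rw [Finset.sum_range_succ (fun i => b i * ρ i), ih, Finset.sum_range_succ
        (fun n => (∑ i ∈ Finset.range (n + 1), b i) * (ρ n - ρ (n + 1))),
        Finset.sum_range_succ b L]
      ring
  rw [hparts, mul_add]
  refine (norm_add_le _ _).trans (add_le_add ?_ ?_)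
  · rw [norm_mul]
    exact mul_le_mul (hS L) (hρ L) (norm_nonneg _) hε
  · calc ‖∑ n ∈ Finset.range L, (∑ i ∈ Finset.range (n + 1), b i) * (ρ n - ρ (n + 1))‖
        ≤ ∑ n ∈ Finset.range L, ε * ‖ρ n - ρ (n + 1)‖ := by
          refine norm_sum_le_of_le _ fun n _ => ?_
          rw [norm_mul]
          gcongr
          exact hS _
      _ ≤ ε * V := by
          rw [← Finset.mul_sum]
          gcongr
          exact hV L

lemma uniformCauchySeqOn_sum_mul {X : Type*} {b : ℕ → ℂ} {ρ : ℕ → X → ℂ} {K : Set X} {C V : ℝ}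
    (hb : CauchySeq fun N => ∑ i ∈ Finset.range N, b i) (hρ : ∀ x ∈ K, ∀ n, ‖ρ n x‖ ≤ C)
    (hV : ∀ x ∈ K, ∀ N, ∑ n ∈ Finset.range N, ‖ρ n x - ρ (n + 1) x‖ ≤ V) :
    UniformCauchySeqOn (fun N x => ∑ i ∈ Finset.range N, b i * ρ i x) atTop K := by
  rw [Metric.uniformCauchySeqOn_iff]
  intro ε hε
  rcases K.eq_empty_or_nonempty with rfl | ⟨x₀, hx₀⟩
  · exact ⟨0, fun m _ n _ x hx => absurd hx (notMem_empty x)⟩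
  have hC : 0 ≤ C := (norm_nonneg _).trans (hρ x₀ hx₀ 0)
  have hV0 : 0 ≤ V := by simpa using hV x₀ hx₀ 0
  obtain ⟨N, hN⟩ := Metric.cauchySeq_iff'.1 hb (ε / (4 * (C + V + 1))) (by positivity)
  have key : ∀ n ≥ N, ∀ x ∈ K, dist (∑ i ∈ Finset.range n, b i * ρ i x)
      (∑ i ∈ Finset.range N, b i * ρ i x) ≤ ε / 4 := by
    intro n hn x hx
    obtain ⟨k, rfl⟩ := Nat.exists_eq_add_of_le hn
    rw [dist_eq_norm, Finset.sum_range_add, add_sub_cancel_left]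
    refine (norm_sum_mul_le (b := fun i => b (N + i)) (ρ := fun i => ρ (N + i) x)
      (ε := ε / (4 * (C + V + 1))) (fun j => ?_) (fun n => hρ x hx _) (fun M => ?_) k).trans
      (b := ε / (4 * (C + V + 1)) * (C + V)) ?_
    · have := (hN (N + j) (by omega)).le
      rwa [dist_eq_norm, Finset.sum_range_add, add_sub_cancel_left] at this
    · refine le_trans ?_ (hV x hx (N + M))
      rw [Finset.sum_range_add]
      exact le_add_of_nonneg_left (Finset.sum_nonneg fun _ _ => norm_nonneg _)
    · have h1 : ε / (4 * (C + V + 1)) * (C + V) ≤ ε / (4 * (C + V + 1)) * (C + V + 1) :=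
        mul_le_mul_of_nonneg_left (by linarith) (by positivity)
      refine h1.trans_eq ?_
      field_simp
  refine ⟨N, fun m hm n hn x hx => ?_⟩
  calc dist _ _ ≤ _ := dist_triangle_right _ _ (∑ i ∈ Finset.range N, b i * ρ i x)
    _ ≤ ε / 4 + ε / 4 := add_le_add (key m hm x hx) (key n hn x hx)
    _ < ε := by linarith

lemma tendsto_differentiableOn_limUnder {S : ℕ → ℂ → ℂ} {K : Set ℂ} (hK : IsOpen K)
    (h : UniformCauchySeqOn S atTop K) (hd : ∀ N, DifferentiableOn ℂ (S N) K) :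
    (∀ z ∈ K, Tendsto (fun N => S N z) atTop (𝓝 (limUnder atTop fun N => S N z))) ∧
      DifferentiableOn ℂ (fun z => limUnder atTop fun N => S N z) K := by
  have ht : ∀ z ∈ K, Tendsto (fun N => S N z) atTop (𝓝 (limUnder atTop fun N => S N z)) :=
    fun z hz => (h.cauchySeq hz).tendsto_limUnder
  exact ⟨ht, (h.tendstoUniformlyOn_of_tendsto ht).tendstoLocallyUniformlyOn.differentiableOn
    (Eventually.of_forall hd) hK⟩

section Series

variable {β : ℝ} {μ c : ℕ → ℝ}

/-! ### Series of Mittag-Leffler functions -/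

/-- Let `I` be the integral. Convolving `E_β(-m t^β)` with `t^(β-1)` gives `Γ(β) (1 - E_β(-m t^β)) /
m`, and `exp(-st)` is multiplicative under convolution. Hence `I Γ(β) / s^β = (Γ(β)/m) (1/s - I)`,
which is solved for `I`. -/
lemma integral_exp_mul_ml (hβ : 0 < β) (hβ1 : β < 1) {m s : ℝ} (hm : 0 < m) (hs : 0 < s) :
    IntegrableOn (fun t => Real.exp (-(s * t)) * ml β (m * t ^ β)) (Ioi 0) ∧
    ∫ t in Ioi (0 : ℝ), Real.exp (-(s * t)) * ml β (m * t ^ β) = s ^ (β - 1) / (s ^ β + m) := by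
  have hcont : Continuous fun t : ℝ => ml β (m * t ^ β) :=
    (continuous_ml hβ).comp (continuous_const.mul (Real.continuous_rpow_const hβ.le))
  have hexp : IntegrableOn (fun t => Real.exp (-(s * t))) (Ioi 0) := by
    simpa using exp_neg_integrableOn_Ioi 0 hs
  have hf : IntegrableOn (fun t => Real.exp (-(s * t)) * ml β (m * t ^ β)) (Ioi 0) := by
    refine Integrable.mono' hexp
      (Continuous.aestronglyMeasurable (by fun_prop)) ?_
    filter_upwards [ae_restrict_mem measurableSet_Ioi] with t ht
    have ht0 : (0 : ℝ) < t := ht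
    have h1 := ml_nonneg hβ hβ1 (x := m * t ^ β) (by positivity)
    have h2 := ml_anti hβ hβ1 le_rfl (show 0 ≤ m * t ^ β by positivity)
    rw [ml_zero] at h2
    rw [Real.norm_of_nonneg (by positivity)]
    exact mul_le_of_le_one_right (Real.exp_pos _).le h2
  refine ⟨hf, ?_⟩
  have hG : 0 < Real.Gamma β := Real.Gamma_pos_of_pos hβ
  have hg : IntegrableOn (fun t : ℝ => t ^ (β - 1) * Real.exp (-(s * t))) (Ioi 0) := by
    simpa using integrableOn_rpow_mul_exp_neg_mul_rpow (p := 1) (s := β - 1) (b := s)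
      (by linarith) one_pos hs
  have hgI := Real.integral_rpow_mul_exp_neg_mul_Ioi hβ hs
  have hconv := integral_posConvolution hf hg (ContinuousLinearMap.mul ℝ ℝ)
  simp only [ContinuousLinearMap.mul_apply'] at hconv
  rw [hgI] at hconv
  set I := ∫ t in Ioi (0 : ℝ), Real.exp (-(s * t)) * ml β (m * t ^ β) with hI
  have hinner : ∀ x : ℝ, 0 < x → ∫ t in (0 : ℝ)..x, Real.exp (-(s * t)) * ml β (m * t ^ β) *
      ((x - t) ^ (β - 1) * Real.exp (-(s * (x - t)))) =
      Real.Gamma β / m * (Real.exp (-(s * x)) - Real.exp (-(s * x)) * ml β (m * x ^ β)) := by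
    intro x hx
    have hk := (integral_kernel_mlc hβ one_pos hβ hx (m : ℂ)).2
    have hrec := mul_mlc_one_add hβ ((m : ℂ) * (x ^ β : ℝ))
    have hre : ∀ s : ℝ, (((x - s) ^ (β - 1) * s ^ ((1 : ℝ) - 1) : ℝ) : ℂ) *
        mlc β 1 (m * (s ^ β : ℝ)) = (((x - s) ^ (β - 1) * ml β (m * s ^ β) : ℝ) : ℂ) := fun s => by
      rw [sub_self, Real.rpow_zero, mul_one, ← Complex.ofReal_mul, mlc_ofReal, Complex.ofReal_mul]
    simp_rw [hre] at hk
    rw [add_sub_cancel_left, intervalIntegral.integral_ofReal] at hk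
    have hk2 : ∫ r in (0 : ℝ)..x, (x - r) ^ (β - 1) * ml β (m * r ^ β) =
        Real.Gamma β / m * (1 - ml β (m * x ^ β)) := by
      apply Complex.ofReal_injective
      erw [hk]
      rw [← Complex.ofReal_mul, mlc_ofReal] at hrec
      have hmc : (m : ℂ) ≠ 0 := by exact_mod_cast hm.ne'
      push_cast at hrec ⊢
      rw [← hrec]
      field_simp
    calc _ = ∫ t in (0 : ℝ)..x, Real.exp (-(s * x)) * ((x - t) ^ (β - 1) * ml β (m * t ^ β)) := by
          refine intervalIntegral.integral_congr fun t _ => ?_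
          rw [show -(s * x) = -(s * t) + -(s * (x - t)) by ring, Real.exp_add]
          ring
      _ = _ := by
          rw [intervalIntegral.integral_const_mul, hk2]
          ring
  rw [setIntegral_congr_fun measurableSet_Ioi fun x hx => hinner x hx, integral_const_mul,
    integral_sub hexp hf, ← hI] at hconv
  have he : ∫ t in Ioi (0 : ℝ), Real.exp (-(s * t)) = 1 / s := by
    have := Real.integral_rpow_mul_exp_neg_mul_Ioi one_pos hs
    simpa using this
  rw [he, one_div, Real.inv_rpow hs.le] at hconv
  have hsβ : 0 < s ^ β := Real.rpow_pos_of_pos hs β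
  rw [Real.rpow_sub_one hs.ne', eq_div_iff (by positivity)]
  field_simp at hconv ⊢
  linarith

lemma norm_sub_le_of_mem_ball {x : ℝ} {w : ℂ} (hw : w ∈ Metric.ball (x : ℂ) (1 / 4 * x)) :
    ‖w - x‖ ≤ 1 / 4 * x := by
  rw [mem_ball_iff_norm] at hw
  exact hw.le

lemma wml_multiplier_bounds (hβ : 0 < β) {C : ℝ} (hC : ∀ (x : ℝ) (w : ℂ), 0 < x →
    ‖w - x‖ ≤ 1 / 4 * x → ‖deriv (wml β) w‖ ≤ C / (1 + x) ^ 2) (hμ0 : 0 < μ 0) (hμ : Monotone μ)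
    {x : ℝ} {w : ℂ} (hx : 0 < x) (hw : ‖w - x‖ ≤ 1 / 4 * x) :
    (∀ n, ‖wml β (μ n * w)‖ ≤ 2 * C) ∧
      ∀ N, ∑ n ∈ Finset.range N, ‖wml β (μ n * w) - wml β (μ (n + 1) * w)‖ ≤ 2 * C := by
  have hμn : ∀ n, 0 < μ n := fun n => hμ0.trans_le (hμ (Nat.zero_le n))
  have h1 : ∀ n, ‖wml β (μ n * w)‖ ≤ 2 * C := fun n => norm_wml_le hβ hC hx hw (hμn n).le
  have hC0 : 0 ≤ 2 * C := (norm_nonneg _).trans (h1 0)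
  refine ⟨h1, fun N => ?_⟩
  calc ∑ n ∈ Finset.range N, ‖wml β (μ n * w) - wml β (μ (n + 1) * w)‖
      ≤ ∑ n ∈ Finset.range N, (2 * C) * (1 / (1 + μ n * x) - 1 / (1 + μ (n + 1) * x)) := by
        refine Finset.sum_le_sum fun n _ => ?_
        rw [norm_sub_rev]
        exact norm_wml_sub_le hβ hC hx hw (hμn n).le (hμ n.le_succ)
    _ = 2 * C * (1 / (1 + μ 0 * x) - 1 / (1 + μ N * x)) := by
        rw [← Finset.mul_sum, Finset.sum_range_sub' (fun n => 1 / (1 + μ n * x))]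
    _ ≤ 2 * C * 1 := by
        gcongr
        have hN := hμn N
        have h2 : 1 / (1 + μ 0 * x) ≤ 1 := by
          rw [div_le_one (by positivity)]
          have : 0 < μ 0 * x := by positivity
          linarith
        have h3 : 0 ≤ 1 / (1 + μ N * x) := by positivity
        linarith
    _ = _ := mul_one _

lemma wml_ofReal (m x : ℝ) : wml β (m * x) = ((m * x * ml β (m * x) : ℝ) : ℂ) := by
  rw [wml, ← Complex.ofReal_mul, mlc_ofReal, ← Complex.ofReal_mul]

/-- The multiplier `x / wml β (μ_j x) = 1 / (μ_j E_β(-μ_j x))` turns `c_j E_β(-μ_j x)` into `c_j /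
μ_j`. It is bounded and of bounded variation because `wml` has bounded variation and stays above `m
> 0`. -/
lemma cauchySeq_sum_div (hβ : 0 < β) (hβ1 : β < 1) (hμ0 : 0 < μ 0) (hμ : Monotone μ) {x : ℝ}
    (hx : 0 < x) (hc : CauchySeq fun N => ∑ j ∈ Finset.range N, ((c j * ml β (μ j * x) : ℝ) : ℂ)) :
    CauchySeq fun N => ∑ j ∈ Finset.range N, ((c j / μ j : ℝ) : ℂ) := by
  obtain ⟨C, hC0, hC⟩ := norm_deriv_wml_le hβ hβ1
  have hμn : ∀ n, 0 < μ n := fun n => hμ0.trans_le (hμ (Nat.zero_le n))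
  have hb := (wml_multiplier_bounds hβ hC hμ0 hμ hx (w := x) (by simp; positivity))
  set m := (Real.Gamma (1 - β))⁻¹ * (1 - ml β (μ 0 * x)) with hm
  have hmx : ∀ n, m ≤ μ n * x * ml β (μ n * x) := fun n =>
    (mul_ml_pos hβ hβ1 (by positivity) (by gcongr; exact hμ n.zero_le)).1
  have hm0 : 0 < m := (mul_ml_pos hβ hβ1 (x₀ := μ 0 * x) (by positivity) le_rfl).2
  have hmn : ∀ n, m ≤ ‖wml β (μ n * x)‖ := fun n => by
    rw [wml_ofReal, Complex.norm_real]
    exact (hmx n).trans (le_abs_self _)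
  have hne : ∀ n, wml β (μ n * x) ≠ 0 := fun n => by
    rw [← norm_pos_iff]
    exact hm0.trans_le (hmn n)
  have key := uniformCauchySeqOn_sum_mul (K := {()}) (ρ := fun n _ => (x : ℂ) / wml β (μ n * x))
    (C := x / m) (V := x / m ^ 2 * (2 * C)) hc (fun _ _ n => ?_) (fun _ _ N => ?_)
  · have h2 := key.cauchySeq (mem_singleton ())
    refine (congrArg CauchySeq (funext fun N => ?_)).mp h2
    refine Finset.sum_congr rfl fun j _ => ?_
    have h3 := hmx j
    rw [wml_ofReal, ← Complex.ofReal_div, ← Complex.ofReal_mul]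
    congr 1
    have : ml β (μ j * x) ≠ 0 := fun h => by
      rw [h, mul_zero] at h3
      linarith
    have := (hμn j).ne'
    field_simp
  · rw [norm_div, Complex.norm_real, Real.norm_of_nonneg hx.le]
    gcongr
    exact hmn n
  · calc ∑ n ∈ Finset.range N, ‖(x : ℂ) / wml β (μ n * x) - x / wml β (μ (n + 1) * x)‖
        ≤ ∑ n ∈ Finset.range N, x / m ^ 2 * ‖wml β (μ n * x) - wml β (μ (n + 1) * x)‖ := by
          refine Finset.sum_le_sum fun n _ => ?_
          have h1 := hne n
          have h2 := hne (n + 1)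
          have e1 : (x : ℂ) / wml β (μ n * x) - x / wml β (μ (n + 1) * x) =
              x * (wml β (μ (n + 1) * x) - wml β (μ n * x)) /
                (wml β (μ n * x) * wml β (μ (n + 1) * x)) := by
            rw [div_sub_div _ _ h1 h2]
            ring
          rw [e1, norm_div, norm_mul, norm_mul, Complex.norm_real, Real.norm_of_nonneg hx.le,
            norm_sub_rev, pow_two, div_mul_eq_mul_div]
          have := hmn n
          have := hmn (n + 1)
          gcongr
      _ ≤ x / m ^ 2 * (2 * C) := by
          rw [← Finset.mul_sum]
          gcongr
          exact hb.2 N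

/-- A conditionally convergent series `∑ c_j E_β(-μ_j t ^ β)` defines a real analytic function on
`(0, ∞)`, whose Laplace transform may be computed term by term. -/
lemma exists_analytic_series (hβ : 0 < β) (hβ1 : β < 1) (hμ0 : 0 < μ 0) (hμ : Monotone μ)
    (hb : CauchySeq fun N => ∑ j ∈ Finset.range N, ((c j / μ j : ℝ) : ℂ)) :
    ∃ y : ℝ → ℂ, AnalyticOnNhd ℝ y (Ioi 0) ∧
      (∀ t, 0 < t → Tendsto (fun N => ∑ j ∈ Finset.range N, ((c j * ml β (μ j * t ^ β) : ℝ) : ℂ))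
        atTop (𝓝 (y t))) ∧
      ∀ s, 0 < s → Tendsto
        (fun N => ∑ j ∈ Finset.range N, ((c j * (s ^ (β - 1) / (s ^ β + μ j)) : ℝ) : ℂ)) atTop
        (𝓝 (∫ t in Ioi (0 : ℝ), (Real.exp (-(s * t)) : ℂ) * y t)) := by
  obtain ⟨C, hC0, hC⟩ := norm_deriv_wml_le hβ hβ1
  have hμn : ∀ n, 0 < μ n := fun n => hμ0.trans_le (hμ (Nat.zero_le n))
  set S : ℕ → ℂ → ℂ := fun N z => ∑ j ∈ Finset.range N, (c j : ℂ) * mlc β 1 (μ j * z) with hS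
  -- The same factorization backwards: `c_j / μ_j` is the fixed convergent series and `wml β (μ_j z)
  -- / z` the multiplier, with bounds uniform on a disc about each `x > 0`.
  have hSeq : ∀ N z, z ≠ 0 → S N z = ∑ j ∈ Finset.range N, ((c j / μ j : ℝ) : ℂ) *
      (wml β (μ j * z) / z) := fun N z hz => by
    refine Finset.sum_congr rfl fun j _ => ?_
    have : (μ j : ℂ) ≠ 0 := by exact_mod_cast (hμn j).ne'
    rw [wml]
    push_cast
    field_simp
  have hlow : ∀ x : ℝ, ∀ w : ℂ, ‖w - x‖ ≤ 1 / 4 * x → 3 / 4 * x ≤ ‖w‖ := fun x w hw => by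
    have := (sub_le_re_of_norm_sub_le hw).trans (Complex.re_le_norm w)
    linarith
  have hρ : ∀ x : ℝ, 0 < x → ∀ w : ℂ, ‖w - x‖ ≤ 1 / 4 * x →
      (∀ n, ‖wml β (μ n * w) / w‖ ≤ 2 * C / (3 / 4 * x)) ∧
      ∀ N, ∑ n ∈ Finset.range N, ‖wml β (μ n * w) / w - wml β (μ (n + 1) * w) / w‖ ≤
        2 * C / (3 / 4 * x) := fun x hx w hw => by
    obtain ⟨h1, h2⟩ := wml_multiplier_bounds hβ hC hμ0 hμ hx hw
    have hl := hlow x w hw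
    refine ⟨fun n => ?_, fun N => ?_⟩
    · rw [norm_div]
      exact div_le_div₀ (by positivity) (h1 n) (by positivity) hl
    · simp_rw [← sub_div, norm_div]
      rw [← Finset.sum_div]
      exact div_le_div₀ (by positivity) (h2 N) (by positivity) hl
  have hloc : ∀ x : ℝ, 0 < x → (∀ z ∈ Metric.ball (x : ℂ) (1 / 4 * x),
      Tendsto (fun N => S N z) atTop (𝓝 (limUnder atTop fun N => S N z))) ∧
      DifferentiableOn ℂ (fun z => limUnder atTop fun N => S N z)
        (Metric.ball (x : ℂ) (1 / 4 * x)) := fun x hx => by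
    refine tendsto_differentiableOn_limUnder Metric.isOpen_ball ?_ fun N => ?_
    · have hu := uniformCauchySeqOn_sum_mul (K := Metric.ball (x : ℂ) (1 / 4 * x)) hb
        (ρ := fun n w => wml β (μ n * w) / w)
        (fun w hw => (hρ x hx w (norm_sub_le_of_mem_ball hw)).1)
        (fun w hw => (hρ x hx w (norm_sub_le_of_mem_ball hw)).2)
      intro u hu'
      filter_upwards [hu u hu'] with p hp w hw
      have hw0 : w ≠ 0 := by
        rw [← norm_pos_iff]
        linarith [hlow x w (norm_sub_le_of_mem_ball hw)]
      rw [hSeq _ _ hw0, hSeq _ _ hw0]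
      exact hp w hw
    · refine Differentiable.differentiableOn (Differentiable.fun_sum fun j _ => ?_)
      exact ((differentiable_mlc hβ one_pos).comp (differentiable_id.const_mul _)).const_mul _
  set Y : ℂ → ℂ := fun z => limUnder atTop fun N => S N z with hY
  have hSreal : ∀ N (x : ℝ), S N x = ∑ j ∈ Finset.range N, ((c j * ml β (μ j * x) : ℝ) : ℂ) :=
    fun N x => Finset.sum_congr rfl fun j _ => by
      rw [← Complex.ofReal_mul, mlc_ofReal, ← Complex.ofReal_mul]
  have hlim : ∀ t : ℝ, 0 < t → Tendsto (fun N => ∑ j ∈ Finset.range N,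
      ((c j * ml β (μ j * t ^ β) : ℝ) : ℂ)) atTop (𝓝 (Y ((t ^ β : ℝ) : ℂ))) := fun t ht => by
    have hx : 0 < t ^ β := Real.rpow_pos_of_pos ht β
    have := (hloc _ hx).1 ((t ^ β : ℝ) : ℂ) (Metric.mem_ball_self (by positivity))
    exact this.congr fun N => hSreal N _
  refine ⟨fun t => Y ((t ^ β : ℝ) : ℂ), fun t ht => ?_, hlim, fun s hs => ?_⟩
  · have ht0 : (0 : ℝ) < t := ht
    have hx : 0 < t ^ β := Real.rpow_pos_of_pos ht β
    have h1 : AnalyticAt ℂ Y ((t ^ β : ℝ) : ℂ) := (hloc _ hx).2.analyticAt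
      (Metric.ball_mem_nhds _ (by positivity))
    have h2 : AnalyticAt ℝ (fun t : ℝ => t ^ β) t :=
      (Real.contDiffAt_rpow_const_of_ne ht0.ne').analyticAt
    have h3 : AnalyticAt ℝ (fun t : ℝ => ((t ^ β : ℝ) : ℂ)) t :=
      AnalyticAt.comp (g := Complex.ofRealCLM) (f := fun t : ℝ => t ^ β)
        (Complex.ofRealCLM.analyticAt (t ^ β)) h2
    exact AnalyticAt.comp (f := fun t : ℝ => ((t ^ β : ℝ) : ℂ)) (h1.restrictScalars (𝕜 := ℝ)) h3
  · obtain ⟨M, hM⟩ := hb.norm_bddAbove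
    have hM' : ∀ N, ‖∑ j ∈ Finset.range N, ((c j / μ j : ℝ) : ℂ)‖ ≤ M := fun N =>
      hM (mem_range_self N)
    have hM0 : 0 ≤ M := (norm_nonneg _).trans (hM' 0)
    have hint : ∀ N, ∫ t in Ioi (0 : ℝ), (Real.exp (-(s * t)) : ℂ) *
        ∑ j ∈ Finset.range N, ((c j * ml β (μ j * t ^ β) : ℝ) : ℂ) =
        ∑ j ∈ Finset.range N, ((c j * (s ^ (β - 1) / (s ^ β + μ j)) : ℝ) : ℂ) := fun N => by
      have e1 : ∀ t : ℝ, (Real.exp (-(s * t)) : ℂ) *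
          ∑ j ∈ Finset.range N, ((c j * ml β (μ j * t ^ β) : ℝ) : ℂ) =
          ((∑ j ∈ Finset.range N, c j * (Real.exp (-(s * t)) * ml β (μ j * t ^ β)) : ℝ) : ℂ) :=
        fun t => by
          rw [Finset.mul_sum, Complex.ofReal_sum]
          refine Finset.sum_congr rfl fun j _ => ?_
          push_cast
          ring
      simp_rw [e1]
      rw [integral_complex_ofReal, integral_finsetSum _ fun j _ =>
        ((integral_exp_mul_ml hβ hβ1 (hμn j) hs).1).const_mul _, Complex.ofReal_sum]
      refine Finset.sum_congr rfl fun j _ => ?_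
      rw [integral_const_mul, (integral_exp_mul_ml hβ hβ1 (hμn j) hs).2]
    simp_rw [← hint]
    -- Abel summation bounds all partial sums by a multiple of `t^(-β)`, integrable at `0` because
    -- `β < 1`.
    refine tendsto_integral_of_dominated_convergence
      (fun t => M * (2 * (2 * C / (3 / 4))) * (t ^ (-β) * Real.exp (-(s * t)))) (fun N => ?_) ?_
      (fun N => ?_) ?_
    · refine Continuous.aestronglyMeasurable ?_
      refine Continuous.mul (by fun_prop) (continuous_finsetSum _ fun j _ => ?_)
      exact Complex.continuous_ofReal.comp (continuous_const.mul ((continuous_ml hβ).comp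
        (continuous_const.mul (Real.continuous_rpow_const hβ.le))))
    · refine Integrable.const_mul ?_ _
      change IntegrableOn _ _ _
      simpa using integrableOn_rpow_mul_exp_neg_mul_rpow (p := 1) (s := -β) (b := s)
        (by linarith) one_pos hs
    · filter_upwards [ae_restrict_mem measurableSet_Ioi] with t ht
      have ht0 : (0 : ℝ) < t := ht
      have hx : 0 < t ^ β := Real.rpow_pos_of_pos ht0 β
      have hb1 := hρ (t ^ β) hx ((t ^ β : ℝ) : ℂ) (by simp; positivity)
      have hb2 := norm_sum_mul_le hM' hb1.1 hb1.2 N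
      rw [← hSeq N _ (by exact_mod_cast hx.ne'), hSreal] at hb2
      rw [norm_mul, Complex.norm_real, Real.norm_of_nonneg (Real.exp_pos _).le, mul_comm]
      calc _ ≤ M * (2 * C / (3 / 4 * t ^ β) + 2 * C / (3 / 4 * t ^ β)) *
            Real.exp (-(s * t)) := by gcongr
        _ = _ := by
          rw [Real.rpow_neg ht0.le]
          field_simp
          norm_num
    · filter_upwards [ae_restrict_mem measurableSet_Ioi] with t ht
      exact (hlim t ht).const_mul _

end Series

/-! ### Conditionally convergent partial fractions -/

section PartialFractions

/-- The sum of the partial fractions `c_j / (z + μ_j)`. -/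
def partialFrac (c μ : ℕ → ℝ) (z : ℂ) : ℂ :=
  limUnder atTop fun N => ∑ j ∈ Finset.range N, (c j : ℂ) / (z + μ j)

variable {c μ : ℕ → ℝ}

/-- Once `μ_j ≥ 2‖z‖` the factor `1/2` works; the finitely many other `j` are handled by a minimum.
-/
lemma exists_mul_le_norm_add (hμ0 : 0 < μ 0) (hμ : Monotone μ) (hlim : Tendsto μ atTop atTop)
    {z : ℂ} (hz : ∀ j, z ≠ -(μ j : ℂ)) : ∃ δ : ℝ, 0 < δ ∧ ∀ j, δ * μ j ≤ ‖z + μ j‖ := by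
  have hμn : ∀ n, 0 < μ n := fun n => hμ0.trans_le (hμ (Nat.zero_le n))
  obtain ⟨J, hJ⟩ := eventually_atTop.1 (hlim.eventually_ge_atTop (2 * ‖z‖))
  have hfin : ∀ J : ℕ, ∃ δ : ℝ, 0 < δ ∧ ∀ j < J, δ * μ j ≤ ‖z + μ j‖ := by
    intro J
    induction J with
    | zero => exact ⟨1, one_pos, fun j hj => absurd hj (Nat.not_lt_zero j)⟩
    | succ J ih =>
      obtain ⟨δ, hδ, h⟩ := ih
      have hpos : 0 < ‖z + μ J‖ := norm_pos_iff.2 fun h0 => hz J (eq_neg_of_add_eq_zero_left h0)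
      refine ⟨min δ (‖z + μ J‖ / μ J), lt_min hδ (div_pos hpos (hμn J)), fun j hj => ?_⟩
      rcases Nat.lt_succ_iff_lt_or_eq.1 hj with h1 | rfl
      · exact (mul_le_mul_of_nonneg_right (min_le_left _ _) (hμn j).le).trans (h j h1)
      · exact (mul_le_mul_of_nonneg_right (min_le_right _ _) (hμn j).le).trans_eq
          (div_mul_cancel₀ _ (hμn j).ne')
  obtain ⟨δ, hδ, h⟩ := hfin J
  refine ⟨min δ (1 / 2), lt_min hδ (by norm_num), fun j => ?_⟩
  rcases lt_or_ge j J with hj | hj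
  · exact (mul_le_mul_of_nonneg_right (min_le_left _ _) (hμn j).le).trans (h j hj)
  · have h1 := hJ j hj
    have h2 : ‖(μ j : ℂ)‖ ≤ ‖z + μ j‖ + ‖z‖ := by
      calc ‖(μ j : ℂ)‖ = ‖z + μ j - z‖ := by rw [add_sub_cancel_left]
        _ ≤ _ := norm_sub_le _ _
    rw [Complex.norm_real, Real.norm_of_nonneg (hμn j).le] at h2
    have := mul_le_mul_of_nonneg_right (min_le_right δ (1 / 2)) (hμn j).le
    linarith

/-- Abel summation with multipliers `μ_j / (w + μ_j)`, whose variation is controlled by the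
telescoping differences `1/μ_n - 1/μ_(n+1)`. The radius `δ μ_0 / 2` costs only half of the lower
bound `δ μ_j`. -/
lemma partialFrac_local (hμ0 : 0 < μ 0) (hμ : Monotone μ) (hlim : Tendsto μ atTop atTop)
    (hb : CauchySeq fun N => ∑ j ∈ Finset.range N, ((c j / μ j : ℝ) : ℂ)) {z : ℂ}
    (hz : ∀ j, z ≠ -(μ j : ℂ)) : ∃ r : ℝ, 0 < r ∧
      (∀ w ∈ Metric.ball z r, Tendsto (fun N => ∑ j ∈ Finset.range N, (c j : ℂ) / (w + μ j)) atTop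
        (𝓝 (partialFrac c μ w))) ∧ DifferentiableOn ℂ (partialFrac c μ) (Metric.ball z r) := by
  have hμn : ∀ n, 0 < μ n := fun n => hμ0.trans_le (hμ (Nat.zero_le n))
  obtain ⟨δ, hδ, h⟩ := exists_mul_le_norm_add hμ0 hμ hlim hz
  set r := δ * μ 0 / 2 with hr
  have hr0 : 0 < r := by positivity
  have hlow : ∀ w ∈ Metric.ball z r, ∀ j, δ / 2 * μ j ≤ ‖w + μ j‖ := fun w hw j => by
    rw [mem_ball_iff_norm, norm_sub_rev] at hw
    have h1 : ‖z + μ j‖ ≤ ‖z - w‖ + ‖w + μ j‖ := by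
      calc ‖z + μ j‖ = ‖(z - w) + (w + μ j)‖ := by congr 1; ring
        _ ≤ _ := norm_add_le _ _
    have h2 := h j
    have h3 : δ * μ 0 ≤ δ * μ j := by
      gcongr
      exact hμ (Nat.zero_le j)
    linarith
  have hne : ∀ w ∈ Metric.ball z r, ∀ j, w + μ j ≠ 0 := fun w hw j => by
    rw [← norm_pos_iff]
    have := hμn j
    exact lt_of_lt_of_le (by positivity) (hlow w hw j)
  refine ⟨r, hr0, ?_⟩
  refine tendsto_differentiableOn_limUnder Metric.isOpen_ball ?_ fun N => ?_
  · have hu := uniformCauchySeqOn_sum_mul (K := Metric.ball z r) hb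
      (ρ := fun n w => (μ n : ℂ) / (w + μ n)) (C := 2 / δ) (V := (‖z‖ + r) * (4 / δ ^ 2) * (1 / μ 0))
      (fun w hw n => ?_) (fun w hw N => ?_)
    · have heq : ∀ (N : ℕ) (w : ℂ), ∑ j ∈ Finset.range N, (c j : ℂ) / (w + μ j) =
          ∑ j ∈ Finset.range N, ((c j / μ j : ℝ) : ℂ) * ((μ j : ℂ) / (w + μ j)) := fun N w => by
        refine Finset.sum_congr rfl fun j _ => ?_
        have : (μ j : ℂ) ≠ 0 := by exact_mod_cast (hμn j).ne'
        push_cast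
        field_simp
      simp_rw [heq]
      exact hu
    · rw [norm_div, Complex.norm_real, Real.norm_of_nonneg (hμn n).le, div_le_div_iff₀
        (norm_pos_iff.2 (hne w hw n)) hδ]
      linarith [hlow w hw n]
    · calc ∑ n ∈ Finset.range N, ‖(μ n : ℂ) / (w + μ n) - (μ (n + 1) : ℂ) / (w + μ (n + 1))‖
          ≤ ∑ n ∈ Finset.range N, (‖z‖ + r) * (4 / δ ^ 2) * (1 / μ n - 1 / μ (n + 1)) := by
            refine Finset.sum_le_sum fun n _ => ?_
            have h1 := hne w hw n
            have h2 := hne w hw (n + 1)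
            have h3 := hlow w hw n
            have h4 := hlow w hw (n + 1)
            have p1 := hμn n
            have p2 := hμn (n + 1)
            have hmono : 0 ≤ μ (n + 1) - μ n := sub_nonneg.2 (hμ n.le_succ)
            have hwn : ‖w‖ ≤ ‖z‖ + r := by
              rw [mem_ball_iff_norm] at hw
              calc ‖w‖ = ‖z + (w - z)‖ := by rw [add_sub_cancel]
                _ ≤ ‖z‖ + ‖w - z‖ := norm_add_le _ _
                _ ≤ _ := by linarith
            have e1 : (μ n : ℂ) / (w + μ n) - (μ (n + 1) : ℂ) / (w + μ (n + 1)) =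
                -(w * ((μ (n + 1) - μ n : ℝ) : ℂ)) / ((w + μ n) * (w + μ (n + 1))) := by
              rw [div_sub_div _ _ h1 h2]
              push_cast
              ring
            rw [e1, norm_div, norm_neg, norm_mul, norm_mul, Complex.norm_real,
              Real.norm_of_nonneg hmono]
            calc ‖w‖ * (μ (n + 1) - μ n) / (‖w + μ n‖ * ‖w + μ (n + 1)‖)
                ≤ (‖z‖ + r) * (μ (n + 1) - μ n) / ((δ / 2 * μ n) * (δ / 2 * μ (n + 1))) := by
                  gcongr
              _ = _ := by
                  field_simp
                  ring
        _ = (‖z‖ + r) * (4 / δ ^ 2) * (1 / μ 0 - 1 / μ N) := by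
            rw [← Finset.mul_sum, Finset.sum_range_sub' (fun n => 1 / μ n)]
        _ ≤ _ := by
            have := hμn N
            gcongr
            have : 0 ≤ 1 / μ N := by positivity
            linarith
  · refine DifferentiableOn.fun_sum fun j _ => ?_
    exact (differentiableOn_const _).div (by fun_prop) fun w hw => hne w hw j

/-- The residue at a pole. After removing the first `m + 1` terms the tail is again a partial
fraction series, all of whose poles differ from `-μ_m`. -/
lemma tendsto_mul_partialFrac (hμ0 : 0 < μ 0) (hμ : StrictMono μ) (hlim : Tendsto μ atTop atTop)
    (hb : CauchySeq fun N => ∑ j ∈ Finset.range N, ((c j / μ j : ℝ) : ℂ)) (m : ℕ) :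
    Tendsto (fun z => (z + μ m) * partialFrac c μ z) (𝓝[{z | ∀ j, z ≠ -(μ j : ℂ)}] (-(μ m : ℂ)))
      (𝓝 (c m)) := by
  have hμn : ∀ n, 0 < μ n := fun n => hμ0.trans_le (hμ.monotone (Nat.zero_le n))
  set c' : ℕ → ℝ := fun j => c (m + 1 + j) with hc'
  set μ' : ℕ → ℝ := fun j => μ (m + 1 + j) with hμ'
  have hμ'mono : Monotone μ' := fun i j hij => hμ.monotone (by omega)
  have hb' : CauchySeq fun N => ∑ j ∈ Finset.range N, ((c' j / μ' j : ℝ) : ℂ) := by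
    obtain ⟨L, hL⟩ := cauchySeq_tendsto_of_complete hb
    have h1 := ((tendsto_add_atTop_iff_nat (m + 1)).2 hL).sub_const
      (∑ j ∈ Finset.range (m + 1), ((c j / μ j : ℝ) : ℂ))
    refine (h1.congr fun N => ?_).cauchySeq
    rw [add_comm N (m + 1), Finset.sum_range_add, add_sub_cancel_left]
  obtain ⟨r, hr, ht, hd⟩ := partialFrac_local (c := c') (μ := μ') (z := -(μ m : ℂ)) (hμn _) hμ'mono
    (hlim.comp (tendsto_add_atTop_nat (m + 1)) |>.congr fun j => by
      simp only [Function.comp, μ', add_comm]) hb' (fun j h => by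
      rw [neg_inj, Complex.ofReal_inj] at h
      have := hμ.injective h
      omega)
  have hcont : ContinuousAt (fun z : ℂ => (z + μ m) *
      (∑ j ∈ Finset.range m, (c j : ℂ) / (z + μ j) + partialFrac c' μ' z) + c m) (-(μ m : ℂ)) := by
    refine ((continuousAt_id.add continuousAt_const).mul (ContinuousAt.add ?_
      (hd.continuousOn.continuousAt (Metric.ball_mem_nhds _ hr)))).add continuousAt_const
    refine tendsto_finsetSum _ fun j hj => ?_
    refine ContinuousAt.div (f := fun _ : ℂ => (c j : ℂ)) (g := fun z : ℂ => z + μ j)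
      continuousAt_const (by fun_prop) ?_
    rw [neg_add_eq_sub, sub_ne_zero]
    intro h
    have := hμ.injective (Complex.ofReal_injective h)
    exact absurd this (Finset.mem_range.1 hj).ne
  have h0 := hcont.tendsto
  rw [neg_add_cancel, zero_mul, zero_add] at h0
  refine (h0.mono_left nhdsWithin_le_nhds).congr' ?_
  filter_upwards [self_mem_nhdsWithin, nhdsWithin_le_nhds (Metric.ball_mem_nhds _ hr)] with z hz hzr
  obtain ⟨r', hr', ht', -⟩ := partialFrac_local hμ0 hμ.monotone hlim hb hz
  have h1 := (tendsto_add_atTop_iff_nat (m + 1)).2 (ht' z (Metric.mem_ball_self hr'))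
  have h2 := (ht z hzr).const_add (∑ j ∈ Finset.range (m + 1), (c j : ℂ) / (z + μ j))
  have h3 := tendsto_nhds_unique h1 (h2.congr fun N => by
    rw [add_comm N (m + 1), Finset.sum_range_add _ (m + 1) N])
  have hzm : z + μ m ≠ 0 := fun h => hz m (eq_neg_of_add_eq_zero_left h)
  rw [h3, Finset.sum_range_succ]
  field_simp
  ring

lemma exp_mul_ne_neg {β : ℝ} (hβ : 0 < β) {η : ℂ} (hη : |η.im| < Real.pi / β) {x : ℝ}
    (hx : 0 < x) : Complex.exp (β * η) ≠ -(x : ℂ) := by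
  intro h
  rw [lt_div_iff₀ hβ, mul_comm] at hη
  have him : ((β : ℂ) * η).im = β * η.im := by simp
  have h1 : |((β : ℂ) * η).im| < Real.pi := by rwa [him, abs_mul, abs_of_pos hβ]
  have h2 := congrArg Complex.im
    (Complex.log_exp (x := (β : ℂ) * η) (abs_lt.1 h1).1 (abs_lt.1 h1).2.le)
  rw [h, Complex.log_im, ← Complex.ofReal_neg, Complex.arg_ofReal_of_neg (neg_neg_of_pos hx)] at h2
  rw [← h2, abs_of_pos Real.pi_pos] at h1
  exact lt_irrefl _ h1

/-- If two families of partial fractions are related by `s^β F₁(s^β) = s^β' F₂(s^β')`, then all the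
poles of `F₂` are poles of `F₁`, and the exponents agree. -/
lemma pole_of_rpow_mul_eq {β₁ β₂ : ℝ} {c₁ c₂ μ₁ μ₂ : ℕ → ℝ} (hβ₁ : 0 < β₁) (hβ : β₁ ≤ β₂)
    (hμ₁0 : 0 < μ₁ 0) (hμ₁ : StrictMono μ₁) (hlim₁ : Tendsto μ₁ atTop atTop)
    (hb₁ : CauchySeq fun N => ∑ j ∈ Finset.range N, ((c₁ j / μ₁ j : ℝ) : ℂ))
    (hμ₂0 : 0 < μ₂ 0) (hμ₂ : StrictMono μ₂) (hlim₂ : Tendsto μ₂ atTop atTop)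
    (hb₂ : CauchySeq fun N => ∑ j ∈ Finset.range N, ((c₂ j / μ₂ j : ℝ) : ℂ))
    (heq : ∀ s : ℝ, 0 < s → ((s ^ β₁ : ℝ) : ℂ) * partialFrac c₁ μ₁ (s ^ β₁ : ℝ) =
      ((s ^ β₂ : ℝ) : ℂ) * partialFrac c₂ μ₂ (s ^ β₂ : ℝ)) {m : ℕ} (hm : c₂ m ≠ 0) :
    β₁ = β₂ ∧ ∃ j, μ₁ j = μ₂ m := by
  have hβ₂ : 0 < β₂ := hβ₁.trans_le hβ
  have hμ₁n : ∀ n, 0 < μ₁ n := fun n => hμ₁0.trans_le (hμ₁.monotone (Nat.zero_le n))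
  have hμ₂n : ∀ n, 0 < μ₂ n := fun n => hμ₂0.trans_le (hμ₂.monotone (Nat.zero_le n))
  -- The strip is dictated by the larger order `β₂`; inside it neither `exp (β₁ η)` nor `exp (β₂ η)`
  -- meets the negative real axis.
  set U : Set ℂ := {η | |η.im| < Real.pi / β₂} with hU
  have hUo : IsOpen U := isOpen_lt (by fun_prop) continuous_const
  have hUc : Convex ℝ U := by
    have : U = Complex.imLm ⁻¹' (Ioo (-(Real.pi / β₂)) (Real.pi / β₂)) := by
      ext η
      simp [hU, abs_lt]
    rw [this]
    exact (convex_Ioo _ _).linear_preimage _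
  have hUle : ∀ η ∈ U, |η.im| < Real.pi / β₁ := fun η hη =>
    lt_of_lt_of_le hη (div_le_div_of_nonneg_left Real.pi_pos.le hβ₁ hβ)
  set H₁ : ℂ → ℂ := fun η => Complex.exp (β₁ * η) * partialFrac c₁ μ₁ (Complex.exp (β₁ * η))
  set H₂ : ℂ → ℂ := fun η => Complex.exp (β₂ * η) * partialFrac c₂ μ₂ (Complex.exp (β₂ * η))
  have hdiff : ∀ (β : ℝ) (c μ : ℕ → ℝ), 0 < μ 0 → StrictMono μ → Tendsto μ atTop atTop →
      (CauchySeq fun N => ∑ j ∈ Finset.range N, ((c j / μ j : ℝ) : ℂ)) → ∀ η : ℂ,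
      (∀ j, Complex.exp (β * η) ≠ -(μ j : ℂ)) → DifferentiableAt ℂ
        (fun η => Complex.exp (β * η) * partialFrac c μ (Complex.exp (β * η))) η := by
    intro β c μ h0 hμ hlim hb η hη
    obtain ⟨r, hr, -, hd⟩ := partialFrac_local h0 hμ.monotone hlim hb hη
    have h1 : DifferentiableAt ℂ (fun η : ℂ => Complex.exp (β * η)) η := by fun_prop
    exact h1.mul (DifferentiableAt.comp (g := partialFrac c μ) η
      (hd.differentiableAt (Metric.ball_mem_nhds _ hr)) h1)
  have hH₁ : DifferentiableOn ℂ H₁ U := fun η hη =>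
    (hdiff β₁ c₁ μ₁ hμ₁0 hμ₁ hlim₁ hb₁ η fun j =>
      exp_mul_ne_neg hβ₁ (hUle η hη) (hμ₁n j)).differentiableWithinAt
  have hH₂ : DifferentiableOn ℂ H₂ U := fun η hη =>
    (hdiff β₂ c₂ μ₂ hμ₂0 hμ₂ hlim₂ hb₂ η fun j =>
      exp_mul_ne_neg hβ₂ hη (hμ₂n j)).differentiableWithinAt
  have hreal : ∀ x : ℝ, H₁ x = H₂ x := fun x => by
    have h := heq (Real.exp x) (Real.exp_pos x)
    rw [← Real.exp_mul, ← Real.exp_mul, mul_comm x, mul_comm x] at h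
    simpa [H₁, H₂] using h
  have hEq : EqOn H₁ H₂ U := by
    refine (hH₁.analyticOnNhd hUo).eqOn_of_preconnected_of_frequently_eq (hH₂.analyticOnNhd hUo)
      hUc.isPreconnected (z₀ := 0) ?_ ?_
    · simp only [hU, mem_ofPred_eq, Complex.zero_im, abs_zero]
      have := Real.pi_pos
      positivity
    · have ht : Tendsto (fun x : ℝ => (x : ℂ)) (𝓝[≠] 0) (𝓝[≠] 0) := by
        refine tendsto_nhdsWithin_of_tendsto_nhds_of_eventually_within _ ?_ ?_
        · exact (Complex.continuous_ofReal.tendsto' 0 0 rfl).mono_left nhdsWithin_le_nhds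
        · filter_upwards [self_mem_nhdsWithin] with x hx
          simpa using hx
      exact ht.frequently (Eventually.of_forall hreal).frequently
  -- approach the pole from inside the strip
  set η₁ : ℂ := ((Real.log (μ₂ m) / β₂ : ℝ) : ℂ) + ((Real.pi / β₂ : ℝ) : ℂ) * Complex.I with hη₁
  have hη₁re : η₁.re = Real.log (μ₂ m) / β₂ := by simp [hη₁]
  have hη₁im : η₁.im = Real.pi / β₂ := by simp [hη₁]
  have hβ₂c : (β₂ : ℂ) ≠ 0 := by exact_mod_cast hβ₂.ne'
  have hpole : Complex.exp (β₂ * η₁) = -(μ₂ m : ℂ) := by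
    have : (β₂ : ℂ) * η₁ = (Real.log (μ₂ m) : ℂ) + Real.pi * Complex.I := by
      rw [hη₁]
      push_cast
      field_simp
    rw [this, Complex.exp_add, Complex.exp_pi_mul_I, ← Complex.ofReal_exp, Real.exp_log (hμ₂n m)]
    ring
  -- If `H₁` were regular at `η₁`, multiplying by `exp (β₂ η) + μ₂ m` and approaching `η₁` would
  -- give the limit `0`, whereas for `H₂` the limit is `-μ₂ m * c₂ m ≠ 0`.
  have hex : ∃ j, Complex.exp (β₁ * η₁) = -(μ₁ j : ℂ) := by
    by_contra! hcon
    have hc₁ : ContinuousAt H₁ η₁ :=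
      (hdiff β₁ c₁ μ₁ hμ₁0 hμ₁ hlim₁ hb₁ η₁ hcon).continuousAt
    set p : ℝ → ℂ := fun τ => η₁ - (τ : ℂ) * Complex.I with hp
    have hpc : Tendsto p (𝓝[>] 0) (𝓝 η₁) := by
      have : Continuous p := by fun_prop
      exact (this.tendsto' 0 η₁ (by simp [hp])).mono_left nhdsWithin_le_nhds
    have hpU : ∀ᶠ τ in 𝓝[>] (0 : ℝ), p τ ∈ U := by
      have hpos : 0 < Real.pi / β₂ := div_pos Real.pi_pos hβ₂
      filter_upwards [Ioo_mem_nhdsGT hpos] with τ hτ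
      have : (p τ).im = Real.pi / β₂ - τ := by simp [hp, hη₁im]
      rw [hU, mem_ofPred_eq, this, abs_lt]
      constructor <;> linarith [hτ.1, hτ.2]
    have hexpc : Continuous fun η : ℂ => Complex.exp (β₂ * η) := by fun_prop
    have hz : Tendsto (fun τ => Complex.exp (β₂ * p τ)) (𝓝[>] 0)
        (𝓝[{z | ∀ j, z ≠ -(μ₂ j : ℂ)}] (-(μ₂ m : ℂ))) := by
      refine tendsto_nhdsWithin_of_tendsto_nhds_of_eventually_within _ ?_ ?_
      · rw [← hpole]
        exact (hexpc.tendsto η₁).comp hpc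
      · filter_upwards [hpU] with τ hτ j
        exact exp_mul_ne_neg hβ₂ hτ (hμ₂n j)
    have hz' := hz.mono_right nhdsWithin_le_nhds
    have hL := hz'.mul ((tendsto_mul_partialFrac hμ₂0 hμ₂ hlim₂ hb₂ m).comp hz)
    have hR : Tendsto (fun τ => (Complex.exp (β₂ * p τ) + μ₂ m) * H₁ (p τ)) (𝓝[>] 0)
        (𝓝 ((-(μ₂ m : ℂ) + μ₂ m) * H₁ η₁)) :=
      (hz'.add_const _).mul (hc₁.tendsto.comp hpc)
    have h0 := tendsto_nhds_unique hL (hR.congr' ?_)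
    · rw [neg_add_cancel, zero_mul] at h0
      have h1 : (μ₂ m : ℂ) ≠ 0 := by exact_mod_cast (hμ₂n m).ne'
      have h2 : (c₂ m : ℂ) ≠ 0 := by exact_mod_cast hm
      exact mul_ne_zero (neg_ne_zero.2 h1) h2 h0
    · filter_upwards [hpU] with τ hτ
      rw [hEq hτ]
      simp only [H₂, Function.comp]
      ring
  obtain ⟨j, hj⟩ := hex
  -- If `β₁ < β₂`, then `β₁ η₁` has imaginary part `π β₁ / β₂ < π`, and its exponential cannot be a
  -- negative real.
  have hββ : β₁ = β₂ := by
    by_contra hne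
    have hlt : β₁ < β₂ := lt_of_le_of_ne hβ hne
    refine exp_mul_ne_neg hβ₁ ?_ (hμ₁n j) hj
    have hpos : 0 < Real.pi / β₂ := div_pos Real.pi_pos hβ₂
    rw [hη₁im, abs_of_pos hpos]
    exact div_lt_div_of_pos_left Real.pi_pos hβ₁ hlt
  refine ⟨hββ, j, ?_⟩
  rw [hββ, hpole, neg_inj, Complex.ofReal_inj] at hj
  exact hj.symm

end PartialFractions

/-! ### The sine basis -/

lemma continuous_psi (k : ℕ) : Continuous (psi k) := by
  unfold psi
  fun_prop

lemma memLp_of_continuous {g : ℝ → ℝ} (hg : ContinuousOn g (Icc (-1) 1)) :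
    MemLp g 2 (volume.restrict D) := by
  obtain ⟨C, hC⟩ := isCompact_Icc.exists_bound_of_continuousOn hg
  have : IsFiniteMeasure (volume.restrict D) := ⟨by simp [D]⟩
  refine MemLp.of_bound ((hg.mono Ioo_subset_Icc_self).aestronglyMeasurable measurableSet_Ioo) C ?_
  filter_upwards [ae_restrict_mem measurableSet_Ioo] with x hx
  exact hC x (Ioo_subset_Icc_self hx)

lemma memLp_psi (k : ℕ) : MemLp (psi k) 2 (volume.restrict D) :=
  memLp_of_continuous (continuous_psi k).continuousOn

lemma toL2_of_memLp {g : ℝ → ℝ} (hg : MemLp g 2 (volume.restrict D)) : toL2 g = hg.toLp g :=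
  dif_pos hg

lemma inner_toL2 {f g : ℝ → ℝ} (hf : MemLp f 2 (volume.restrict D))
    (hg : MemLp g 2 (volume.restrict D)) :
    inner ℝ (toL2 f) (toL2 g) = ∫ x in D, f x * g x := by
  rw [toL2_of_memLp hf, toL2_of_memLp hg, L2.inner_def]
  refine integral_congr_ae ?_
  filter_upwards [hf.coeFn_toLp, hg.coeFn_toLp] with x h1 h2
  rw [h1, h2]
  simp [mul_comm]

lemma inner_toL2_psi {g : ℝ → ℝ} (hg : MemLp g 2 (volume.restrict D)) (k : ℕ) :
    inner ℝ (toL2 g) (toL2 (psi k)) = coeff g k := inner_toL2 hg (memLp_psi k)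

lemma setIntegral_D (g : ℝ → ℝ) : ∫ x in D, g x = ∫ x in (-1 : ℝ)..1, g x := by
  rw [intervalIntegral.integral_of_le (by norm_num), integral_Ioc_eq_integral_Ioo, D]

lemma integral_cos_eq_zero {k : ℤ} (hk : k ≠ 0) :
    ∫ x in (-1 : ℝ)..1, Real.cos (k * Real.pi / 2 * (x + 1)) = 0 := by
  have hk' : (k * Real.pi / 2 : ℝ) ≠ 0 := by
    have : (k : ℝ) ≠ 0 := by exact_mod_cast hk
    have := Real.pi_ne_zero
    positivity
  have hd : ∀ x : ℝ, HasDerivAt (fun x : ℝ => Real.sin (k * Real.pi / 2 * (x + 1)) /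
      (k * Real.pi / 2)) (Real.cos (k * Real.pi / 2 * (x + 1))) x := fun x => by
    have h := ((((hasDerivAt_id x).add_const 1).const_mul (k * Real.pi / 2 : ℝ)).sin).div_const
      (k * Real.pi / 2 : ℝ)
    refine h.congr_deriv ?_
    simp only [id]
    field_simp
  rw [intervalIntegral.integral_eq_sub_of_hasDerivAt (fun x _ => hd x)
    (Continuous.intervalIntegrable (by fun_prop) _ _)]
  rw [show (k * Real.pi / 2 * (1 + 1) : ℝ) = k * Real.pi by ring, Real.sin_int_mul_pi]
  simp

lemma inner_psi (m n : ℕ) :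
    ∫ x in D, psi (m + 1) x * psi (n + 1) x = if m = n then 1 else 0 := by
  have hprod : ∀ x : ℝ, psi (m + 1) x * psi (n + 1) x =
      (Real.cos (((m - n : ℤ) : ℝ) * Real.pi / 2 * (x + 1)) -
        Real.cos (((m + n + 2 : ℤ) : ℝ) * Real.pi / 2 * (x + 1))) / 2 := fun x => by
    have h1 : ((m - n : ℤ) : ℝ) * Real.pi / 2 * (x + 1) =
      ((m + 1 : ℕ) : ℝ) * Real.pi / 2 * (x + 1) - ((n + 1 : ℕ) : ℝ) * Real.pi / 2 * (x + 1) := by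
      push_cast; ring
    have h2 : ((m + n + 2 : ℤ) : ℝ) * Real.pi / 2 * (x + 1) =
      ((m + 1 : ℕ) : ℝ) * Real.pi / 2 * (x + 1) + ((n + 1 : ℕ) : ℝ) * Real.pi / 2 * (x + 1) := by
      push_cast; ring
    rw [h1, h2, Real.cos_sub, Real.cos_add, psi, psi]
    ring
  rw [setIntegral_D]
  simp_rw [hprod]
  rw [intervalIntegral.integral_div, intervalIntegral.integral_sub
    (Continuous.intervalIntegrable (by fun_prop) _ _)
    (Continuous.intervalIntegrable (by fun_prop) _ _), integral_cos_eq_zero (k := m + n + 2) (by omega)]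
  split_ifs with h
  · subst h
    simp
  · rw [integral_cos_eq_zero (k := m - n) (by omega)]
    simp

lemma orthonormal_psi : Orthonormal ℝ fun n : ℕ => toL2 (psi (n + 1)) := by
  rw [orthonormal_iff_ite]
  intro m n
  rw [inner_toL2 (memLp_psi _) (memLp_psi _), inner_psi]

/-- Equality in Bessel's inequality for a single vector gives its expansion. Applied to indicator
functions, it makes completeness of the sine system unnecessary. -/
lemma hasSum_of_hasSum_sq {E : Type*} [NormedAddCommGroup E] [InnerProductSpace ℝ E] {v : ℕ → E}
    (hv : Orthonormal ℝ v) {X : E} (h : HasSum (fun n => inner ℝ X (v n) ^ 2) (‖X‖ ^ 2)) :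
    HasSum (fun n => inner ℝ X (v n) • v n) X := by
  have hnorm : ∀ s : Finset ℕ, ‖X - ∑ n ∈ s, inner ℝ X (v n) • v n‖ ^ 2 =
      ‖X‖ ^ 2 - ∑ n ∈ s, inner ℝ X (v n) ^ 2 := fun s => by
    rw [norm_sub_sq_real, ← real_inner_self_eq_norm_sq (∑ n ∈ s, inner ℝ X (v n) • v n),
      hv.inner_sum, inner_sum]
    simp_rw [inner_smul_right, ← pow_two]
    simp only [conj_trivial, ← pow_two]
    ring
  rw [HasSum, tendsto_iff_norm_sub_tendsto_zero]
  have h1 := (h.const_sub (‖X‖ ^ 2)).sqrt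
  rw [sub_self, Real.sqrt_zero] at h1
  refine h1.congr fun s => ?_
  rw [← hnorm, Real.sqrt_sq (norm_nonneg _), norm_sub_rev]

/-- The sine coefficients of the indicator function of `(-1, a)`. -/
def indCoeff (a : ℝ) (k : ℕ) : ℝ :=
  (1 - Real.cos (k * Real.pi / 2 * (a + 1))) / (k * Real.pi / 2)

lemma integral_psi (a : ℝ) (k : ℕ) : ∫ x in (-1 : ℝ)..a, psi k x = indCoeff a k := by
  rcases eq_or_ne k 0 with rfl | hk
  · simp [psi, indCoeff]
  have hk' : (k * Real.pi / 2 : ℝ) ≠ 0 := by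
    have : (k : ℝ) ≠ 0 := by exact_mod_cast hk
    have := Real.pi_ne_zero
    positivity
  have hd : ∀ x : ℝ, HasDerivAt (fun x : ℝ => -Real.cos (k * Real.pi / 2 * (x + 1)) /
      (k * Real.pi / 2)) (psi k x) x := fun x => by
    have h := (((((hasDerivAt_id x).add_const 1).const_mul (k * Real.pi / 2 : ℝ)).cos).neg).div_const
      (k * Real.pi / 2 : ℝ)
    refine h.congr_deriv ?_
    simp only [id, psi]
    field_simp
  rw [intervalIntegral.integral_eq_sub_of_hasDerivAt (fun x _ => hd x)
    ((continuous_psi k).intervalIntegrable _ _), indCoeff]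
  simp
  ring

/-- Since `(1 - cos y)² = 3/2 - 2 cos y + (1/2) cos 2y`, the sum is a combination of `∑ cos(2πnx)/n²
= π² B₂(x)` at `x = 0`, `(a+1)/4` and `(a+1)/2`. -/
lemma hasSum_indCoeff_sq {a : ℝ} (ha : a ∈ Icc (-1 : ℝ) 1) :
    HasSum (fun n : ℕ => indCoeff a (n + 1) ^ 2) (a + 1) := by
  have hB : ∀ x : ℝ, Polynomial.eval x (Polynomial.map (algebraMap ℚ ℝ)
      (Polynomial.bernoulli (2 * 1))) = x ^ 2 - x + 1 / 6 := fun x => by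
    rw [show 2 * 1 = 2 from rfl, Polynomial.bernoulli]
    simp [Finset.sum_range_succ, bernoulli_one, bernoulli_two]
    ring
  have h0 := hasSum_one_div_nat_pow_mul_cos one_ne_zero (x := 0) (by norm_num)
  have h1 := hasSum_one_div_nat_pow_mul_cos one_ne_zero (x := (a + 1) / 4)
    ⟨by linarith [ha.1], by linarith [ha.2]⟩
  have h2 := hasSum_one_div_nat_pow_mul_cos one_ne_zero (x := (a + 1) / 2)
    ⟨by linarith [ha.1], by linarith [ha.2]⟩
  rw [hB] at h0 h1 h2
  have h := (((h0.mul_left (3 / 2)).sub (h1.mul_left 2)).add (h2.mul_left (1 / 2))).mul_left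
    (4 / Real.pi ^ 2)
  rw [← hasSum_nat_add_iff' 1] at h
  have hpi := Real.pi_ne_zero
  convert! h using 1
  · funext n
    have hn : ((n + 1 : ℕ) : ℝ) ≠ 0 := by positivity
    set y := ((n + 1 : ℕ) : ℝ) * Real.pi / 2 * (a + 1) with hy
    rw [show 2 * Real.pi * ((n + 1 : ℕ) : ℝ) * ((a + 1) / 2) = 2 * y by rw [hy]; ring,
      show 2 * Real.pi * ((n + 1 : ℕ) : ℝ) * ((a + 1) / 4) = y by rw [hy]; ring,
      Real.cos_two_mul, indCoeff, ← hy, mul_zero, Real.cos_zero]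
    field_simp
    ring
  · simp
    field_simp
    ring

lemma integral_mul_indicator (g : ℝ → ℝ) {a : ℝ} (ha : a ∈ Icc (-1 : ℝ) 1) :
    ∫ x in D, (Iic a).indicator 1 x * g x = ∫ x in (-1 : ℝ)..a, g x := by
  have h1 : ∀ x, (Iic a).indicator (1 : ℝ → ℝ) x * g x = (Iic a).indicator g x := fun x => by
    by_cases hx : x ∈ Iic a <;> simp [hx]
  simp_rw [h1]
  rw [setIntegral_D, intervalIntegral.integral_of_le (by norm_num), integral_indicator
    measurableSet_Iic, Measure.restrict_restrict measurableSet_Iic,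
    intervalIntegral.integral_of_le ha.1]
  congr 2
  ext x
  simp only [mem_inter_iff, mem_Iic, mem_Ioc]
  constructor
  · rintro ⟨h1, h2, h3⟩
    exact ⟨h2, h1⟩
  · rintro ⟨h1, h2⟩
    exact ⟨h2, h1, h2.trans ha.2⟩

lemma memLp_indicator_Iic (a : ℝ) :
    MemLp ((Iic a).indicator (1 : ℝ → ℝ)) 2 (volume.restrict D) :=
  (memLp_of_continuous (g := (1 : ℝ → ℝ)) continuousOn_const).indicator measurableSet_Iic

/-- Parseval's identity for the pairing with the indicator function of `(-1, a)`. -/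
lemma hasSum_coeff_mul_indCoeff {g : ℝ → ℝ} (hg : MemLp g 2 (volume.restrict D)) {a : ℝ}
    (ha : a ∈ Icc (-1 : ℝ) 1) :
    HasSum (fun n : ℕ => coeff g (n + 1) * indCoeff a (n + 1)) (∫ x in (-1 : ℝ)..a, g x) := by
  set X := toL2 ((Iic a).indicator (1 : ℝ → ℝ)) with hX
  have hin : ∀ n : ℕ, inner ℝ X (toL2 (psi (n + 1))) = indCoeff a (n + 1) := fun n => by
    rw [hX, inner_toL2 (memLp_indicator_Iic a) (memLp_psi _), integral_mul_indicator _ ha,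
      integral_psi]
  have hnorm : ‖X‖ ^ 2 = a + 1 := by
    rw [← real_inner_self_eq_norm_sq, hX, inner_toL2 (memLp_indicator_Iic a)
      (memLp_indicator_Iic a), integral_mul_indicator _ ha, intervalIntegral.integral_of_le ha.1,
      setIntegral_congr_fun (g := fun _ => (1 : ℝ)) measurableSet_Ioc fun x hx => by
        simp [hx.2], ← intervalIntegral.integral_of_le ha.1]
    simp
  have h := hasSum_of_hasSum_sq orthonormal_psi (X := X) (by
    simp_rw [hin]
    rw [hnorm]
    exact hasSum_indCoeff_sq ha)
  have h2 := h.mapL (innerSL ℝ (toL2 g))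
  simp only [innerSL_apply_apply, inner_smul_right, hin, inner_toL2_psi hg] at h2
  rw [real_inner_comm, hX, inner_toL2 (memLp_indicator_Iic a) hg, integral_mul_indicator _ ha] at h2
  exact h2.congr_fun fun n => mul_comm _ _

/-! ### Convergence of sine series with nonnegative coefficients -/

lemma HasSum.odd_of_even_eq_zero {F : ℕ → ℝ} {S : ℝ} (h : HasSum (fun n => F (n + 1)) S)
    (h0 : ∀ k, F (2 * k + 2) = 0) : HasSum (fun j => F (2 * j + 1)) S := by
  have hinj : Function.Injective fun j : ℕ => 2 * j := fun a b h => by simpa using h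
  refine (hinj.hasSum_iff (f := fun n => F (n + 1)) fun n hn => ?_).2 h
  rcases Nat.even_or_odd' n with ⟨k, rfl | rfl⟩
  · exact absurd ⟨k, rfl⟩ hn
  · exact h0 k

/-- The difference between a sharp cutoff at `X = 1` and the smooth weight `(sin X / X)²` is at most
`sin² X / X`, the weight appearing in `hasSum_boundary`. -/
lemma sinc_sq_error {X : ℝ} (hX : 0 < X) :
    (X ≤ 1 → |1 - (Real.sin X / X) ^ 2| ≤ Real.sin X ^ 2 / X) ∧
      (1 ≤ X → |(Real.sin X / X) ^ 2| ≤ Real.sin X ^ 2 / X) := by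
  refine ⟨fun h1 => ?_, fun h1 => ?_⟩
  · have hs := Real.sin_gt_sub_cube hX
    have hs1 := Real.sin_lt hX
    set s := Real.sin X
    have hX3 : X * (1 - X ^ 2 / 4) = X - X ^ 3 / 4 := by ring
    have hX3' : 0 < X ^ 3 := by positivity
    have hsX : X * (1 - X ^ 2 / 4) ≤ s := by linarith
    have hX2 : X ^ 2 ≤ 1 := by nlinarith
    have hs0 : 0 < s := lt_of_lt_of_le (by nlinarith) hsX
    have hle : (s / X) ^ 2 ≤ 1 := by
      rw [div_pow, div_le_one (by positivity)]
      gcongr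
    rw [abs_of_nonneg (by linarith), div_pow, ← sub_nonneg]
    have : s ^ 2 / X - (1 - s ^ 2 / X ^ 2) = (s ^ 2 * (X + 1) - X ^ 2) / X ^ 2 := by
      field_simp
      ring
    rw [this]
    refine div_nonneg ?_ (by positivity)
    have h2 : (X * (1 - X ^ 2 / 4)) ^ 2 ≤ s ^ 2 := by
      have : 0 ≤ X * (1 - X ^ 2 / 4) := by nlinarith
      gcongr
    have h3 : 0 ≤ (1 - X ^ 2 / 4) ^ 2 * (X + 1) - 1 := by
      have : (1 - X ^ 2 / 4) ^ 2 * (X + 1) - 1 =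
          X * (1 - X / 2 - X ^ 2 / 2 + X ^ 3 / 16 + X ^ 4 / 16) := by ring
      rw [this]
      have : X ^ 2 ≤ X := by nlinarith
      have : 0 ≤ X ^ 3 := by positivity
      have : 0 ≤ X ^ 4 := by positivity
      refine mul_nonneg hX.le ?_
      linarith
    have h4 : 0 ≤ X ^ 2 * ((1 - X ^ 2 / 4) ^ 2 * (X + 1) - 1) := by positivity
    nlinarith
  · rw [abs_of_nonneg (by positivity), div_pow]
    gcongr
    nlinarith

/-- The value `ψ_n(0) = sin (nπ/2)` at odd `n = 2j + 1`. -/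
lemma sin_odd_mul_pi_div_two (j : ℕ) : Real.sin ((2 * j + 1 : ℕ) * Real.pi / 2) = (-1) ^ j := by
  rw [show ((2 * j + 1 : ℕ) : ℝ) * Real.pi / 2 = Real.pi / 2 + j * Real.pi by push_cast; ring,
    Real.sin_add_nat_mul_pi, Real.sin_pi_div_two, mul_one]

section Tauberian

variable {g : ℝ → ℝ}

lemma coeff_congr {f g : ℝ → ℝ} (h : ∀ x ∈ D, f x = g x) (k : ℕ) : coeff f k = coeff g k :=
  setIntegral_congr_fun measurableSet_Ioo fun x hx => by simp only [h x hx]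

/-- The angle `(2j+1)πδ/2`. -/
def angle (δ : ℝ) (j : ℕ) : ℝ := (2 * j + 1 : ℕ) * Real.pi / 2 * δ

lemma angle_pos {δ : ℝ} (hδ : 0 < δ) (j : ℕ) : 0 < angle δ j := by
  have := Real.pi_pos
  unfold angle
  positivity

/-- Pairing with the indicator of the two boundary layers of width `2δ`, divided by `4δ`. The
symmetry cancels the even modes and leaves nonnegative weights. -/
lemma hasSum_boundary (hg : MemLp g 2 (volume.restrict D)) {δ : ℝ} (hδ : 0 < δ) (hδ1 : δ ≤ 1) :
    HasSum (fun j : ℕ => coeff g (2 * j + 1) * (Real.sin (angle δ j) ^ 2 / angle δ j))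
      (((∫ x in (-1 : ℝ)..(-1 + 2 * δ), g x) + (∫ x in (-1 : ℝ)..1, g x) -
        ∫ x in (-1 : ℝ)..(1 - 2 * δ), g x) / (4 * δ)) := by
  have h := (((hasSum_coeff_mul_indCoeff hg (a := -1 + 2 * δ) ⟨by linarith, by linarith⟩).add
    (hasSum_coeff_mul_indCoeff hg (a := 1) ⟨by linarith, by linarith⟩)).sub
    (hasSum_coeff_mul_indCoeff hg (a := 1 - 2 * δ) ⟨by linarith, by linarith⟩)).div_const (4 * δ)
  have hval : ∀ n : ℕ, 0 < n → (coeff g n * indCoeff (-1 + 2 * δ) n + coeff g n * indCoeff 1 n -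
      coeff g n * indCoeff (1 - 2 * δ) n) / (4 * δ) = coeff g n * ((1 - (-1) ^ n) / 2 *
        (Real.sin (n * Real.pi / 2 * δ) ^ 2 / (n * Real.pi / 2 * δ))) := fun n hn => by
    have hn' : (n : ℝ) ≠ 0 := by exact_mod_cast hn.ne'
    have hpi := Real.pi_ne_zero
    unfold indCoeff
    rw [show (n : ℝ) * Real.pi / 2 * (-1 + 2 * δ + 1) = 2 * (n * Real.pi / 2 * δ) by ring,
      show (n : ℝ) * Real.pi / 2 * (1 + 1) = n * Real.pi by ring,
      show (n : ℝ) * Real.pi / 2 * (1 - 2 * δ + 1) = n * Real.pi - 2 * (n * Real.pi / 2 * δ) by ring,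
      Real.cos_nat_mul_pi_sub, Real.cos_nat_mul_pi, Real.cos_two_mul, Real.cos_sq']
    field_simp
    ring
  have h1 := HasSum.odd_of_even_eq_zero (F := fun n => (coeff g n * indCoeff (-1 + 2 * δ) n +
    coeff g n * indCoeff 1 n - coeff g n * indCoeff (1 - 2 * δ) n) / (4 * δ)) h (fun k => by
      rw [hval _ (by omega)]
      simp [show 2 * k + 2 = 2 * (k + 1) by ring, pow_mul])
  refine h1.congr_fun fun j => ?_
  rw [hval _ (by omega), angle]
  simp [pow_add, pow_mul]

lemma hasSum_centre (hg : MemLp g 2 (volume.restrict D)) {a : ℝ} (ha : a ∈ Icc (0 : ℝ) 1) :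
    HasSum (fun j : ℕ => coeff g (2 * j + 1) * ((-1) ^ j * (2 *
      Real.sin ((2 * j + 1 : ℕ) * Real.pi / 2 * a) / ((2 * j + 1 : ℕ) * Real.pi / 2))))
      ((∫ x in (-1 : ℝ)..a, g x) - ∫ x in (-1 : ℝ)..(-a), g x) := by
  have h := (hasSum_coeff_mul_indCoeff hg (a := a) ⟨by linarith [ha.1], ha.2⟩).sub
    (hasSum_coeff_mul_indCoeff hg (a := -a) ⟨by linarith [ha.2], by linarith [ha.1]⟩)
  have hval : ∀ n : ℕ, 0 < n → coeff g n * indCoeff a n - coeff g n * indCoeff (-a) n =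
      coeff g n * (Real.sin (n * Real.pi / 2) * (2 * Real.sin (n * Real.pi / 2 * a) /
        (n * Real.pi / 2))) := fun n hn => by
    have hn' : (n : ℝ) ≠ 0 := by exact_mod_cast hn.ne'
    have hpi := Real.pi_ne_zero
    unfold indCoeff
    rw [show (n : ℝ) * Real.pi / 2 * (a + 1) = n * Real.pi / 2 * a + n * Real.pi / 2 by ring,
      show (n : ℝ) * Real.pi / 2 * (-a + 1) = n * Real.pi / 2 - n * Real.pi / 2 * a by ring,
      Real.cos_add, Real.cos_sub]
    field_simp
    ring
  have h1 := HasSum.odd_of_even_eq_zero (F := fun n => coeff g n * indCoeff a n -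
    coeff g n * indCoeff (-a) n) h (fun k => by
      rw [hval _ (by omega), show ((2 * k + 2 : ℕ) : ℝ) * Real.pi / 2 = (k + 1 : ℕ) * Real.pi by
        push_cast; ring, Real.sin_nat_mul_pi]
      simp)
  refine h1.congr_fun fun j => ?_
  rw [hval _ (by omega), sin_odd_mul_pi_div_two]

/-- Bessel's inequality with `2ab ≤ a² + b²`; it allows the termwise integration in `hasSum_tent`.
-/
lemma summable_coeff_div (hg : MemLp g 2 (volume.restrict D)) :
    Summable fun j : ℕ => |coeff g (2 * j + 1)| / ((2 * j + 1 : ℕ) : ℝ) := by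
  have h1 := orthonormal_psi.inner_products_summable (toL2 g)
  simp_rw [real_inner_comm, inner_toL2_psi hg, Real.norm_eq_abs, sq_abs] at h1
  have h2 : Summable fun n : ℕ => 1 / ((n + 1 : ℕ) : ℝ) ^ 2 :=
    (summable_nat_add_iff 1).2 (Real.summable_one_div_nat_pow.2 one_lt_two)
  have hinj : Function.Injective fun j : ℕ => 2 * j := fun a b h => by simpa using h
  have h3 := (h1.add h2).comp_injective hinj
  refine Summable.of_nonneg_of_le (fun j => by positivity) (fun j => ?_) h3
  simp only [Function.comp]
  have hpos : (0 : ℝ) < ((2 * j + 1 : ℕ) : ℝ) := by positivity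
  have := two_mul_le_add_sq (|coeff g (2 * j + 1)|) (1 / ((2 * j + 1 : ℕ) : ℝ))
  rw [sq_abs, one_div_pow] at this
  have h4 : 0 ≤ |coeff g (2 * j + 1)| * (1 / ((2 * j + 1 : ℕ) : ℝ)) := by positivity
  rw [div_eq_mul_one_div]
  linarith

/-- Integrating `∫_{-a}^{a} g` over `a ∈ (0, 2δ)` pairs `g` with a tent of half-width `2δ` about the
midpoint. Dividing by `4δ²` gives it mass one, so this is a Fejér-type mean with weights `(sin X /
X)²`. -/
lemma hasSum_tent (hg : MemLp g 2 (volume.restrict D)) {δ : ℝ} (hδ : 0 < δ) (hδ1 : 2 * δ ≤ 1) :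
    HasSum (fun j : ℕ => coeff g (2 * j + 1) * (-1) ^ j * (Real.sin (angle δ j) / angle δ j) ^ 2)
      ((∫ a in (0 : ℝ)..(2 * δ), ((∫ x in (-1 : ℝ)..a, g x) - ∫ x in (-1 : ℝ)..(-a), g x)) /
        (4 * δ ^ 2)) := by
  have hpi := Real.pi_pos
  set F : ℕ → ℝ → ℝ := fun j a => coeff g (2 * j + 1) * ((-1) ^ j * (2 *
      Real.sin ((2 * j + 1 : ℕ) * Real.pi / 2 * a) / ((2 * j + 1 : ℕ) * Real.pi / 2))) with hF
  have hFc : ∀ j, Continuous (F j) := fun j => by simp only [hF]; fun_prop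
  have hFi : ∀ j, IntegrableOn (F j) (Ioc 0 (2 * δ)) := fun j =>
    ((hFc j).intervalIntegrable 0 (2 * δ)).1
  have hFb : ∀ j a, ‖F j a‖ ≤ 4 / Real.pi * (|coeff g (2 * j + 1)| / ((2 * j + 1 : ℕ) : ℝ)) :=
    fun j a => by
      have hj : (0 : ℝ) < ((2 * j + 1 : ℕ) : ℝ) := by positivity
      simp only [hF]
      rw [norm_mul, norm_mul, norm_pow, norm_neg, norm_one, one_pow, one_mul, norm_div, norm_mul,
        Real.norm_eq_abs, Real.norm_eq_abs, Real.norm_eq_abs, Real.norm_eq_abs, abs_two,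
        abs_of_pos (show 0 < ((2 * j + 1 : ℕ) : ℝ) * Real.pi / 2 by positivity)]
      calc |coeff g (2 * j + 1)| * (2 * |Real.sin ((2 * j + 1 : ℕ) * Real.pi / 2 * a)| /
            ((2 * j + 1 : ℕ) * Real.pi / 2))
          ≤ |coeff g (2 * j + 1)| * (2 * 1 / ((2 * j + 1 : ℕ) * Real.pi / 2)) := by
            gcongr
            exact Real.abs_sin_le_one _
        _ = _ := by
            field_simp
            norm_num
  have hsum : Summable fun j => ∫ a in Ioc 0 (2 * δ), ‖F j a‖ := by
    refine Summable.of_nonneg_of_le (fun j => integral_nonneg fun a => norm_nonneg _) (fun j => ?_)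
      (((summable_coeff_div hg).mul_left (4 / Real.pi)).mul_left (2 * δ))
    refine (setIntegral_mono_on (hFi j).norm (integrableOn_const measure_Ioc_lt_top.ne) measurableSet_Ioc
      fun a _ => hFb j a).trans_eq ?_
    rw [setIntegral_const, Measure.real, Real.volume_Ioc, sub_zero,
      ENNReal.toReal_ofReal (by positivity), smul_eq_mul]
  have h := (hasSum_integral_of_summable_integral_norm hFi hsum).div_const (4 * δ ^ 2)
  have hL : ∫ a in Ioc 0 (2 * δ), ∑' j, F j a =
      ∫ a in (0 : ℝ)..(2 * δ), ((∫ x in (-1 : ℝ)..a, g x) - ∫ x in (-1 : ℝ)..(-a), g x) := by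
    rw [intervalIntegral.integral_of_le (by positivity)]
    exact setIntegral_congr_fun measurableSet_Ioc fun a ha =>
      (hasSum_centre hg ⟨ha.1.le, ha.2.trans hδ1⟩).tsum_eq
  rw [hL] at h
  refine h.congr_fun fun j => ?_
  have hj : ((2 * j + 1 : ℕ) : ℝ) * Real.pi / 2 ≠ 0 := by positivity
  have hint : ∫ a in Ioc 0 (2 * δ), F j a = coeff g (2 * j + 1) * (-1) ^ j *
      (2 * (1 - Real.cos (2 * angle δ j)) / ((2 * j + 1 : ℕ) * Real.pi / 2) ^ 2) := by
    rw [← intervalIntegral.integral_of_le (by positivity)]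
    have hd : ∀ a : ℝ, HasDerivAt (fun a : ℝ => coeff g (2 * j + 1) * (-1) ^ j *
        (2 * (1 - Real.cos ((2 * j + 1 : ℕ) * Real.pi / 2 * a)) /
          ((2 * j + 1 : ℕ) * Real.pi / 2) ^ 2)) (F j a) a := fun a => by
      have h := ((((((hasDerivAt_id a).const_mul (((2 * j + 1 : ℕ) : ℝ) * Real.pi / 2)).cos
        ).const_sub 1).const_mul 2).div_const ((((2 * j + 1 : ℕ) : ℝ) * Real.pi / 2) ^ 2)).const_mul
        (coeff g (2 * j + 1) * (-1) ^ j)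
      refine h.congr_deriv ?_
      simp only [id, hF]
      field_simp
    rw [intervalIntegral.integral_eq_sub_of_hasDerivAt (fun a _ => hd a)
      ((hFc j).intervalIntegrable _ _)]
    rw [show ((2 * j + 1 : ℕ) : ℝ) * Real.pi / 2 * (2 * δ) = 2 * angle δ j by rw [angle]; ring]
    simp
  rw [hint, Real.cos_two_mul, Real.cos_sq']
  have hang : angle δ j = (2 * j + 1 : ℕ) * Real.pi / 2 * δ := rfl
  rw [div_pow, show angle δ j ^ 2 = ((2 * j + 1 : ℕ) * Real.pi / 2) ^ 2 * δ ^ 2 by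
    rw [hang, mul_pow]]
  field_simp
  ring

/-- The limit is a derivative at `δ = 0`, namely `(2 g(-1) + 2 g(1)) / 4 = 0`. -/
lemma tendsto_boundary (hg : Continuous g) (h1 : g (-1) = 0) (h2 : g 1 = 0) :
    Tendsto (fun δ : ℝ => ((∫ x in (-1 : ℝ)..(-1 + 2 * δ), g x) + (∫ x in (-1 : ℝ)..1, g x) -
        ∫ x in (-1 : ℝ)..(1 - 2 * δ), g x) / (4 * δ)) (𝓝[>] 0) (𝓝 0) := by
  have hJ : ∀ a : ℝ, HasDerivAt (fun a => ∫ x in (-1 : ℝ)..a, g x) (g a) a := fun a =>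
    (hg.integral_hasStrictDerivAt (-1) a).hasDerivAt
  have ha : HasDerivAt (fun δ : ℝ => ∫ x in (-1 : ℝ)..(-1 + 2 * δ), g x) (g (-1) * 2) 0 := by
    have hi : HasDerivAt (fun δ : ℝ => -1 + 2 * δ) 2 0 := by
      simpa using ((hasDerivAt_id (0 : ℝ)).const_mul 2).const_add (-1)
    have := hJ (-1 + 2 * 0)
    have h := HasDerivAt.comp (h := fun δ : ℝ => -1 + 2 * δ) (0 : ℝ) this hi
    exact h.congr_deriv (by norm_num)
  have hb : HasDerivAt (fun δ : ℝ => ∫ x in (-1 : ℝ)..(1 - 2 * δ), g x) (g 1 * (-2)) 0 := by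
    have hi : HasDerivAt (fun δ : ℝ => 1 - 2 * δ) (-2) 0 := by
      simpa using ((hasDerivAt_id (0 : ℝ)).const_mul 2).const_sub 1
    have := hJ (1 - 2 * 0)
    have h := HasDerivAt.comp (h := fun δ : ℝ => 1 - 2 * δ) (0 : ℝ) this hi
    exact h.congr_deriv (by norm_num)
  have hd := ((ha.add_const (∫ x in (-1 : ℝ)..1, g x)).sub hb).tendsto_slope_zero_right
  simp only [h1, h2, zero_mul, sub_zero] at hd
  have h3 := hd.const_mul (1 / 4)
  rw [mul_zero] at h3
  refine h3.congr fun δ => ?_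
  simp
  ring

lemma tendsto_tent (hg : Continuous g) :
    Tendsto (fun δ : ℝ => (∫ a in (0 : ℝ)..(2 * δ), ((∫ x in (-1 : ℝ)..a, g x) -
      ∫ x in (-1 : ℝ)..(-a), g x)) / (4 * δ ^ 2)) (𝓝[>] 0) (𝓝 (g 0)) := by
  have hJ : ∀ a : ℝ, HasDerivAt (fun a => ∫ x in (-1 : ℝ)..a, g x) (g a) a := fun a =>
    (hg.integral_hasStrictDerivAt (-1) a).hasDerivAt
  have hC : ∀ a : ℝ, HasDerivAt (fun a : ℝ => (∫ x in (-1 : ℝ)..a, g x) -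
      ∫ x in (-1 : ℝ)..(-a), g x) (g a + g (-a)) a := fun a => by
    have := (hJ a).sub ((hJ (-a)).comp a (hasDerivAt_neg a))
    refine this.congr_deriv (by ring)
  set Ce : ℝ → ℝ := fun a => (∫ x in (-1 : ℝ)..a, g x) - ∫ x in (-1 : ℝ)..(-a), g x with hCe
  have hCc : Continuous Ce := continuous_iff_continuousAt.2 fun a => (hC a).continuousAt
  have hC0 : Ce 0 = 0 := by simp [hCe]
  rw [Metric.tendsto_nhdsWithin_nhds]
  intro ε hε
  have hlo := (hC 0).isLittleO.def (half_pos hε)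
  simp only [neg_zero, hC0, sub_zero, smul_eq_mul] at hlo
  obtain ⟨r, hr, hball⟩ := Metric.eventually_nhds_iff.1 hlo
  refine ⟨r / 2, by positivity, fun δ hδ hδr => ?_⟩
  have hδ0 : (0 : ℝ) < δ := hδ
  rw [Real.dist_eq, sub_zero, abs_of_pos hδ0] at hδr
  have hlin : ∫ a in (0 : ℝ)..(2 * δ), a * (g 0 + g 0) = g 0 * (4 * δ ^ 2) := by
    rw [intervalIntegral.integral_mul_const, integral_id]
    ring
  have hbd : |(∫ a in (0 : ℝ)..(2 * δ), Ce a) - g 0 * (4 * δ ^ 2)| ≤ ε / 2 * (4 * δ ^ 2) := by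
    rw [← hlin, ← intervalIntegral.integral_sub (hCc.intervalIntegrable _ _)
      (Continuous.intervalIntegrable (by fun_prop) _ _), ← Real.norm_eq_abs]
    refine (intervalIntegral.norm_integral_le_of_norm_le_const (C := ε / 2 * (2 * δ))
      fun a ha => ?_).trans_eq ?_
    · rw [uIoc_of_le (by positivity)] at ha
      have := hball (y := a) (by rw [Real.dist_eq, sub_zero, abs_of_pos ha.1]; linarith [ha.2])
      refine this.trans ?_
      rw [Real.norm_of_nonneg ha.1.le]
      gcongr
      exact ha.2
    · rw [sub_zero, abs_of_pos (by positivity)]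
      ring
  rw [Real.dist_eq]
  have h4 : 0 < 4 * δ ^ 2 := by positivity
  rw [show (∫ a in (0 : ℝ)..(2 * δ), Ce a) / (4 * δ ^ 2) - g 0 =
    ((∫ a in (0 : ℝ)..(2 * δ), Ce a) - g 0 * (4 * δ ^ 2)) / (4 * δ ^ 2) by field_simp,
    abs_div, abs_of_pos h4, div_lt_iff₀ h4]
  refine hbd.trans_lt ?_
  gcongr
  linarith

/-- The tent means converge to `g 0`. As the coefficients are nonnegative, `sinc_sq_error` bounds
the distance from a mean to a partial sum by the boundary average, which tends to zero. -/
lemma tendsto_sum_coeff_of_continuous (hg : Continuous g) (h1 : g (-1) = 0) (h2 : g 1 = 0)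
    (hpos : ∀ j : ℕ, 0 ≤ coeff g (2 * j + 1)) :
    Tendsto (fun N => ∑ j ∈ Finset.range N, coeff g (2 * j + 1) * (-1) ^ j) atTop (𝓝 (g 0)) := by
  have hpi := Real.pi_pos
  have hm : MemLp g 2 (volume.restrict D) := memLp_of_continuous hg.continuousOn
  -- This width gives `angle (δ N) j = (2j+1)/(2N)`, so the cutoff at angle `1` is exactly `j < N`.
  set δ : ℕ → ℝ := fun N => 1 / (Real.pi * N) with hδ
  have hδpos : ∀ᶠ N : ℕ in atTop, 0 < δ N := by
    filter_upwards [eventually_gt_atTop 0] with N hN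
    have : (0 : ℝ) < N := by exact_mod_cast hN
    simp only [hδ]
    positivity
  have hδ0 : Tendsto δ atTop (𝓝 0) := by
    have h := (tendsto_one_div_atTop_nhds_zero_nat (𝕜 := ℝ)).const_mul (1 / Real.pi)
    rw [mul_zero] at h
    refine h.congr fun N => ?_
    simp only [hδ]
    field_simp
  have hδ1 : ∀ᶠ N : ℕ in atTop, 2 * δ N ≤ 1 := by
    filter_upwards [hδ0.eventually_lt_const (show (0 : ℝ) < 1 / 2 by norm_num)] with N hN
    linarith
  have hδw : Tendsto δ atTop (𝓝[>] 0) :=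
    tendsto_nhdsWithin_of_tendsto_nhds_of_eventually_within _ hδ0 hδpos
  have hA := (tendsto_tent hg).comp hδw
  have hB := (tendsto_boundary hg h1 h2).comp hδw
  refine hA.congr_dist (squeeze_zero' (Eventually.of_forall fun N => dist_nonneg) ?_ hB)
  filter_upwards [hδpos, hδ1, eventually_gt_atTop 0] with N hN0 hN1 hN
  have hNR : (0 : ℝ) < N := by exact_mod_cast hN
  have hang : ∀ j : ℕ, angle (δ N) j = (2 * j + 1) / (2 * N) := fun j => by
    simp only [angle, hδ]
    push_cast
    field_simp
  have hS : HasSum (fun j => if j < N then coeff g (2 * j + 1) * (-1) ^ j else 0)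
      (∑ j ∈ Finset.range N, coeff g (2 * j + 1) * (-1) ^ j) := by
    have := hasSum_sum_of_ne_finset_zero (L := SummationFilter.unconditional ℕ) (s := Finset.range N)
      (f := fun j => if j < N then coeff g (2 * j + 1) * (-1 : ℝ) ^ j else 0) (fun j hj => by
        simpa using fun h => absurd h (by simpa using hj))
    rwa [Finset.sum_congr rfl fun j hj => if_pos (Finset.mem_range.1 hj)] at this
  have hdiff := (hasSum_tent hm hN0 hN1).sub hS
  have hbound := hasSum_boundary hm hN0 (by linarith)
  simp only [Function.comp]
  rw [dist_eq_norm, ← hdiff.tsum_eq]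
  refine tsum_of_norm_bounded hbound fun j => ?_
  have hX := angle_pos hN0 j
  obtain ⟨e1, e2⟩ := sinc_sq_error hX
  set X := angle (δ N) j with hXdef
  rw [hang] at hXdef
  have hn1 : ‖coeff g (2 * j + 1) * (-1 : ℝ) ^ j‖ = coeff g (2 * j + 1) := by
    rw [norm_mul, norm_pow, norm_neg, norm_one, one_pow, mul_one, Real.norm_of_nonneg (hpos j)]
  split_ifs with hj
  · have hX1 : X ≤ 1 := by
      rw [hXdef, div_le_one (by positivity)]
      have : ((j + 1 : ℕ) : ℝ) ≤ N := by exact_mod_cast hj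
      push_cast at this
      linarith
    rw [show coeff g (2 * j + 1) * (-1 : ℝ) ^ j * (Real.sin X / X) ^ 2 -
      coeff g (2 * j + 1) * (-1 : ℝ) ^ j = -(coeff g (2 * j + 1) * (-1 : ℝ) ^ j *
        (1 - (Real.sin X / X) ^ 2)) by ring, norm_neg, norm_mul, hn1, Real.norm_eq_abs]
    exact mul_le_mul_of_nonneg_left (e1 hX1) (hpos j)
  · have hX1 : 1 ≤ X := by
      rw [hXdef, le_div_iff₀ (by positivity)]
      have : (N : ℝ) ≤ j := by exact_mod_cast not_lt.1 hj
      linarith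
    rw [sub_zero, norm_mul, hn1, Real.norm_eq_abs]
    exact mul_le_mul_of_nonneg_left (e2 hX1) (hpos j)

/-- If the odd sine coefficients of a continuous function vanishing at the end points are
nonnegative, then its sine series converges at the midpoint. -/
lemma tendsto_sum_coeff (hg : ContinuousOn g (Icc (-1) 1)) (h1 : g (-1) = 0) (h2 : g 1 = 0)
    (hpos : ∀ j : ℕ, 0 ≤ coeff g (2 * j + 1)) :
    Tendsto (fun N => ∑ j ∈ Finset.range N, coeff g (2 * j + 1) * (-1) ^ j) atTop (𝓝 (g 0)) := by
  have hle : (-1 : ℝ) ≤ 1 := by norm_num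
  set G : ℝ → ℝ := IccExtend hle ((Icc (-1) 1).domRestrict g) with hG
  have hGc : Continuous G := (continuousOn_iff_continuous_domRestrict.1 hg).Icc_extend'
  have heq : ∀ x ∈ Icc (-1 : ℝ) 1, G x = g x := fun x hx => by
    rw [hG, IccExtend_of_mem hle _ hx, domRestrict_apply]
  have hc : ∀ k, coeff G k = coeff g k := coeff_congr fun x hx => heq x (Ioo_subset_Icc_self hx)
  have h := tendsto_sum_coeff_of_continuous hGc (by rw [heq _ (by norm_num), h1])
    (by rw [heq _ (by norm_num), h2]) (fun j => by rw [hc]; exact hpos j)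
  simp_rw [hc] at h
  rwa [heq 0 (by norm_num)] at h

end Tauberian

/-! ### The eigenvalues -/

section Eigenvalues

variable {α γ : ℝ}

lemma one_lt_muBar (j : ℕ) : 1 < muBar (2 * j + 1) := by
  unfold muBar
  have h : 1 < ((2 * j + 1 : ℕ) : ℝ) * Real.pi / 2 := by
    have := Real.pi_gt_three
    have : (1 : ℝ) ≤ ((2 * j + 1 : ℕ) : ℝ) := by exact_mod_cast Nat.succ_le_succ (Nat.zero_le _)
    nlinarith
  exact one_lt_pow₀ h two_ne_zero

lemma strictMono_muBar : StrictMono fun j : ℕ => muBar (2 * j + 1) := by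
  intro i j hij
  have := Real.pi_pos
  have h : ((2 * i + 1 : ℕ) : ℝ) < ((2 * j + 1 : ℕ) : ℝ) := by
    exact_mod_cast (by omega : 2 * i + 1 < 2 * j + 1)
  simp only [muBar]
  gcongr

lemma tendsto_muBar : Tendsto (fun j : ℕ => muBar (2 * j + 1)) atTop atTop := by
  refine tendsto_atTop_mono (fun j => ?_) tendsto_natCast_atTop_atTop
  have h1 : (j : ℝ) ≤ ((2 * j + 1 : ℕ) : ℝ) * Real.pi / 2 := by
    have := Real.pi_gt_three
    push_cast
    nlinarith [Nat.cast_nonneg (α := ℝ) j]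
  have h2 : 1 ≤ ((2 * j + 1 : ℕ) : ℝ) * Real.pi / 2 := by
    have := Real.pi_gt_three
    push_cast
    nlinarith [Nat.cast_nonneg (α := ℝ) j]
  unfold muBar
  nlinarith

lemma mu_pos (j : ℕ) : 0 < mu α γ (2 * j + 1) := by
  have := one_lt_muBar j
  unfold mu
  positivity

lemma strictMono_mu (hα : 0 < α) (hγ : 0 < γ) : StrictMono fun j : ℕ => mu α γ (2 * j + 1) := by
  intro i j hij
  have h0 : 0 ≤ muBar (2 * i + 1) := by linarith [one_lt_muBar i]
  exact add_lt_add (Real.rpow_lt_rpow h0 (strictMono_muBar hij) (by positivity))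
    (Real.rpow_lt_rpow h0 (strictMono_muBar hij) (by positivity))

lemma tendsto_mu (hα : 0 < α) : Tendsto (fun j : ℕ => mu α γ (2 * j + 1)) atTop atTop := by
  refine tendsto_atTop_mono (fun j => ?_)
    ((tendsto_rpow_atTop (half_pos hα)).comp tendsto_muBar)
  have := one_lt_muBar j
  have : 0 ≤ muBar (2 * j + 1) ^ (γ / 2) := by positivity
  simp only [Function.comp, mu]
  linarith

/-- For large `j` the factor `muBar^((γ'-γ)/2)` exceeds `2`, so the single term of exponent `γ'/2`
exceeds both terms of `mu α γ`. -/
lemma not_lt_of_mu_eq {α' γ' : ℝ} (hαγ : α ≤ γ)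
    (h : ∀ j : ℕ, mu α γ (2 * j + 1) = mu α' γ' (2 * j + 1)) : ¬ γ < γ' := by
  intro hlt
  have ht := (tendsto_rpow_atTop (show 0 < γ' / 2 - γ / 2 by linarith)).comp tendsto_muBar
  obtain ⟨j, hj⟩ := (ht.eventually_gt_atTop 2).exists
  simp only [Function.comp] at hj
  have hX := one_lt_muBar j
  have hX0 : 0 < muBar (2 * j + 1) := by linarith
  have h1 := h j
  unfold mu at h1
  have h2 : muBar (2 * j + 1) ^ (γ' / 2) =
      muBar (2 * j + 1) ^ (γ / 2) * muBar (2 * j + 1) ^ (γ' / 2 - γ / 2) := by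
    rw [← Real.rpow_add hX0]; ring_nf
  have h3 : muBar (2 * j + 1) ^ (α / 2) ≤ muBar (2 * j + 1) ^ (γ / 2) :=
    Real.rpow_le_rpow_of_exponent_le hX.le (by linarith)
  have h4 : 0 < muBar (2 * j + 1) ^ (γ / 2) := by positivity
  have h5 : 0 < muBar (2 * j + 1) ^ (α' / 2) := by positivity
  nlinarith

lemma exponents_eq_of_mu_eq {α' γ' : ℝ} (hαγ : α ≤ γ) (hαγ' : α' ≤ γ')
    (h : ∀ j : ℕ, mu α γ (2 * j + 1) = mu α' γ' (2 * j + 1)) : α = α' ∧ γ = γ' := by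
  have hγ : γ = γ' := le_antisymm (not_lt.1 (not_lt_of_mu_eq hαγ' fun j => (h j).symm))
    (not_lt.1 (not_lt_of_mu_eq hαγ h))
  refine ⟨?_, hγ⟩
  have h0 := h 0
  have hX := one_lt_muBar 0
  subst hγ
  simp only [mu, add_left_inj] at h0
  have := (Real.rpow_right_inj (by linarith) hX.ne').1 h0
  linarith

end Eigenvalues

/-! ### The sine coefficients of a weak solution -/

section WeakSolution

variable {β α γ T : ℝ} {f : ℝ → ℝ} {u : ℝ → ℝ → ℝ}

/-- Membership in `Ḣ^{α,γ}` makes the defining series converge, so its `tsum` is not the default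
value `0`. -/
lemma inner_opL {g : ℝ → ℝ} (hg : MemHdot α γ g) (n : ℕ) :
    inner ℝ (toL2 (psi (n + 1))) (opL α γ g) = -mu α γ (n + 1) * coeff g (n + 1) := by
  have hs : Summable fun n : ℕ => (coeff g (n + 1) * mu α γ (n + 1)) • toL2 (psi (n + 1)) := by
    have h := (orthonormal_psi.orthogonalFamily.summable_iff_norm_sq_summable
      fun n => coeff g (n + 1) * mu α γ (n + 1)).2
    simp only [LinearIsometry.toSpanSingleton_apply, Real.norm_eq_abs, sq_abs, mul_pow] at h
    exact h hg.2
  have h := hs.hasSum.mapL (innerSL ℝ (toL2 (psi (n + 1))))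
  simp only [innerSL_apply_apply, inner_smul_right, orthonormal_iff_ite.1 orthonormal_psi n] at h
  have h2 := h.unique (hasSum_ite_eq n (coeff g (n + 1) * mu α γ (n + 1)) |>.congr_fun fun m => by
    by_cases hm : m = n
    · simp [hm]
    · simp [hm, Ne.symm hm])
  rw [opL, inner_neg_right, h2]
  ring

/-- The difference of the two sides solves the homogeneous relaxation equation with zero initial
value; comparison with the constant solution `0` shows that it vanishes. -/
lemma coeff_weakSolution (hβ : 0 < β ∧ β < 1) (hf : MemLp f 2 (volume.restrict D))
    (hu : IsWeakSolution β α γ T f u) {n : ℕ} (hμ : 0 ≤ mu α γ (n + 1)) {t : ℝ}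
    (ht : t ∈ Ioo 0 T) :
    coeff (u t) (n + 1) = coeff f (n + 1) * ml β (mu α γ (n + 1) * t ^ β) := by
  set m := mu α γ (n + 1) with hm
  set q := coeff f (n + 1) with hq
  set ℓ : L2D →L[ℝ] ℝ := innerSL ℝ (toL2 (psi (n + 1))) with hℓ
  have hℓu : ∀ s ∈ Ioc 0 T, ℓ (toL2 (u s)) = coeff (u s) (n + 1) := fun s hs => by
    rw [hℓ, innerSL_apply_apply, real_inner_comm, inner_toL2_psi (hu.mem_Hdot s hs).1]
  have hℓ0 : ℓ (toL2 (u 0)) = q := by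
    have hmem : MemLp (u 0) 2 (volume.restrict D) := hf.ae_eq hu.initial.symm
    rw [hℓ, innerSL_apply_apply, real_inner_comm, inner_toL2_psi hmem, hq]
    refine integral_congr_ae ?_
    filter_upwards [hu.initial] with x hx
    rw [hx]
  have hE : ∀ s ∈ Ioo 0 T, HasCaputoDerivAt β
      (fun s => ((ℓ (toL2 (u s)) - q * ml β (m * s ^ β) : ℝ) : ℂ))
      (-(m : ℂ) * ((ℓ (toL2 (u s)) - q * ml β (m * s ^ β) : ℝ) : ℂ)) s := fun s hs => by
    have h1 := (hu.equation s hs).clm_comp hs.1 ℓ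
    have h2 := (hasCaputoDerivAt_ml hβ.1 hβ.2 m hs.1).clm_comp hs.1
      (q • ContinuousLinearMap.id ℝ ℝ)
    have h3 := (h1.sub hs.1 h2).clm_comp hs.1 Complex.ofRealCLM
    have hval : -(m : ℂ) * ((ℓ (toL2 (u s)) - q * ml β (m * s ^ β) : ℝ) : ℂ) =
        Complex.ofRealCLM (ℓ (opL α γ (u s)) -
          (q • ContinuousLinearMap.id ℝ ℝ) (-m * ml β (m * s ^ β))) := by
      have hs' : s ∈ Ioc 0 T := ⟨hs.1, hs.2.le⟩
      have h4 : ℓ (opL α γ (u s)) = -m * coeff (u s) (n + 1) := by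
        rw [hℓ, innerSL_apply_apply, inner_opL (hu.mem_Hdot s hs')]
      rw [h4, hℓu s hs']
      simp
      ring
    rw [hval]
    exact h3
  have hZ : ∀ s ∈ Ioo 0 T, HasCaputoDerivAt β (fun _ => (0 : ℝ)) 0 s := fun s hs => by
    simpa using (hasCaputoDerivAt_ml hβ.1 hβ.2 0 hs.1).clm_comp hs.1 (0 : ℝ →L[ℝ] ℝ)
  have hml : Continuous fun s : ℝ => ml β (m * s ^ β) := (continuous_ml hβ.1).comp
    (continuous_const.mul (Real.continuous_rpow_const hβ.1.le))
  have hcont : ContinuousOn (fun s => ((ℓ (toL2 (u s)) - q * ml β (m * s ^ β) : ℝ) : ℂ))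
      (Ico 0 T) :=
    Complex.continuous_ofReal.comp_continuousOn ((ℓ.continuous.comp_continuousOn
      (hu.continuous_L2.mono Ico_subset_Icc_self)).sub
      (continuous_const.mul hml).continuousOn)
  have key := norm_le_of_hasCaputoDerivAt (lam := (m : ℂ)) (a := 0) (P := fun _ => 0) hβ.1 hβ.2 hcont
    (continuousOn_const (c := (0 : ℝ))) hE hZ (fun s _ => by simp) le_rfl (by simpa using hμ)
    (by rw [hℓ0]; simp [Real.zero_rpow hβ.1.ne', ml_zero]) t ⟨ht.1.le, ht.2⟩
  have h0 := norm_le_zero_iff.1 key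
  rw [Complex.ofReal_eq_zero, hℓu t ⟨ht.1, ht.2.le⟩] at h0
  linarith

lemma coeff_neg (g : ℝ → ℝ) (k : ℕ) : coeff (fun x => -g x) k = -coeff g k := by
  simp only [coeff, neg_mul]
  exact integral_neg _

lemma tendsto_midpoint (hβ : 0 < β ∧ β < 1) (hf : MemLp f 2 (volume.restrict D))
    (hsign : (∀ n : ℕ, Odd n → 0 < coeff f n) ∨ (∀ n : ℕ, Odd n → coeff f n < 0))
    (hu : IsWeakSolution β α γ T f u) {t : ℝ} (ht : t ∈ Ioo 0 T) :
    Tendsto (fun N => ∑ j ∈ Finset.range N, coeff f (2 * j + 1) * (-1) ^ j *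
      ml β (mu α γ (2 * j + 1) * t ^ β)) atTop (𝓝 (u t 0)) := by
  have ht' : t ∈ Ioc 0 T := ⟨ht.1, ht.2.le⟩
  have hco : ∀ j : ℕ, coeff (u t) (2 * j + 1) =
      coeff f (2 * j + 1) * ml β (mu α γ (2 * j + 1) * t ^ β) := fun j =>
    coeff_weakSolution hβ hf hu (mu_pos j).le ht
  have hml : ∀ j : ℕ, 0 ≤ ml β (mu α γ (2 * j + 1) * t ^ β) := fun j =>
    ml_nonneg hβ.1 hβ.2 (mul_nonneg (mu_pos j).le (Real.rpow_nonneg ht.1.le _))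
  have hodd : ∀ j : ℕ, Odd (2 * j + 1) := fun j => ⟨j, rfl⟩
  have hcu := hu.continuous_space t ht'
  obtain ⟨hb1, hb2⟩ := hu.boundary t ht'
  have hmain : Tendsto (fun N => ∑ j ∈ Finset.range N, coeff (u t) (2 * j + 1) * (-1) ^ j) atTop
      (𝓝 (u t 0)) := by
    rcases hsign with h | h
    · refine tendsto_sum_coeff hcu hb1 hb2 fun j => ?_
      rw [hco]
      exact mul_nonneg (h _ (hodd j)).le (hml j)
    · have h1 := tendsto_sum_coeff (g := fun x => -u t x) hcu.neg (by simp [hb1]) (by simp [hb2])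
        fun j => by
          rw [coeff_neg, hco, ← neg_mul]
          exact mul_nonneg (neg_nonneg.2 (h _ (hodd j)).le) (hml j)
      have h2 := h1.neg
      rw [neg_neg] at h2
      refine h2.congr fun N => ?_
      rw [← Finset.sum_neg_distrib]
      refine Finset.sum_congr rfl fun j _ => ?_
      rw [coeff_neg]
      ring
  refine hmain.congr fun N => Finset.sum_congr rfl fun j _ => ?_
  rw [hco]
  ring

/-- The observation at the midpoint extends to an analytic function on `(0, ∞)`, with an explicit
Laplace transform. -/
lemma exists_analytic_extension (hβ : 0 < β ∧ β < 1) (hαγ : 0 < α ∧ α ≤ γ ∧ γ < 2) (hT : 0 < T)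
    (hf : MemLp f 2 (volume.restrict D))
    (hsign : (∀ n : ℕ, Odd n → 0 < coeff f n) ∨ (∀ n : ℕ, Odd n → coeff f n < 0))
    (hu : IsWeakSolution β α γ T f u) :
    (CauchySeq fun N => ∑ j ∈ Finset.range N,
      ((coeff f (2 * j + 1) * (-1) ^ j / mu α γ (2 * j + 1) : ℝ) : ℂ)) ∧
    ∃ y : ℝ → ℂ, AnalyticOnNhd ℝ y (Ioi 0) ∧ (∀ t ∈ Ioo 0 T, y t = u t 0) ∧
      ∀ s : ℝ, 0 < s → ((s ^ β : ℝ) : ℂ) * partialFrac (fun j => coeff f (2 * j + 1) * (-1) ^ j)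
        (fun j => mu α γ (2 * j + 1)) (s ^ β : ℝ) =
        s * ∫ t in Ioi (0 : ℝ), (Real.exp (-(s * t)) : ℂ) * y t := by
  have hμ := strictMono_mu hαγ.1 (hαγ.1.trans_le hαγ.2.1)
  have hcast : ∀ t ∈ Ioo 0 T, Tendsto (fun N => ∑ j ∈ Finset.range N,
      ((coeff f (2 * j + 1) * (-1) ^ j * ml β (mu α γ (2 * j + 1) * t ^ β) : ℝ) : ℂ)) atTop
      (𝓝 ((u t 0 : ℝ) : ℂ)) := fun t ht => by
    refine ((Complex.continuous_ofReal.tendsto _).comp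
      (tendsto_midpoint hβ hf hsign hu ht)).congr fun N => ?_
    simp only [Function.comp, Complex.ofReal_sum]
  -- Convergence at the single time `T / 2` suffices.
  have hb := cauchySeq_sum_div (c := fun j => coeff f (2 * j + 1) * (-1) ^ j)
    (μ := fun j => mu α γ (2 * j + 1)) hβ.1 hβ.2 (mu_pos 0) hμ.monotone
    (Real.rpow_pos_of_pos (half_pos hT) β) (hcast (T / 2) ⟨by linarith, by linarith⟩).cauchySeq
  refine ⟨hb, ?_⟩
  obtain ⟨y, hy1, hy2, hy3⟩ := exists_analytic_series hβ.1 hβ.2 (mu_pos 0) hμ.monotone hb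
  refine ⟨y, hy1, fun t ht => tendsto_nhds_unique (hy2 t ht.1) (hcast t ht), fun s hs => ?_⟩
  have hsβ : 0 < s ^ β := Real.rpow_pos_of_pos hs β
  obtain ⟨r, hr, hlim, -⟩ := partialFrac_local (c := fun j => coeff f (2 * j + 1) * (-1) ^ j)
    (μ := fun j => mu α γ (2 * j + 1)) (mu_pos 0) hμ.monotone (tendsto_mu hαγ.1) hb
    (z := ((s ^ β : ℝ) : ℂ)) (fun j h => by
      rw [← Complex.ofReal_neg, Complex.ofReal_inj] at h
      linarith [mu_pos (α := α) (γ := γ) j])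
  have h1 := (hlim _ (Metric.mem_ball_self hr)).const_mul ((s ^ β : ℝ) : ℂ)
  refine tendsto_nhds_unique h1 (((hy3 s hs).const_mul (s : ℂ)).congr fun N => ?_)
  rw [Finset.mul_sum, Finset.mul_sum]
  refine Finset.sum_congr rfl fun j _ => ?_
  rw [Real.rpow_sub_one hs.ne']
  have : (s : ℂ) ≠ 0 := by exact_mod_cast hs.ne'
  push_cast
  field_simp

end WeakSolution

end DoubleScale

end

/-! ### Equality of the orders and of the exponents -/

theorem mainTheorem1 (β α γ β' α' γ' T : ℝ) (f : ℝ → ℝ) (u v : ℝ → ℝ → ℝ)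
    (hβ : 0 < β ∧ β < 1) (hαγ : 0 < α ∧ α ≤ γ ∧ γ < 2)
    (hβ' : 0 < β' ∧ β' < 1) (hαγ' : 0 < α' ∧ α' ≤ γ' ∧ γ' < 2)
    (hT : 0 < T)
    (hf : MemLp f 2 (volume.restrict DoubleScale.D))
    (hsign : (∀ n : ℕ, Odd n → 0 < DoubleScale.coeff f n) ∨
      (∀ n : ℕ, Odd n → DoubleScale.coeff f n < 0))
    (hu : DoubleScale.IsWeakSolution β α γ T f u)
    (hv : DoubleScale.IsWeakSolution β' α' γ' T f v)
    (huv : ∀ t ∈ Ioc 0 T, u t 0 = v t 0) :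
    β = β' ∧ α = α' ∧ γ = γ' := by
  obtain ⟨hbu, y, hy, hyu, hly⟩ :=
    DoubleScale.exists_analytic_extension hβ hαγ hT hf hsign hu
  obtain ⟨hbv, z, hz, hzv, hlz⟩ :=
    DoubleScale.exists_analytic_extension hβ' hαγ' hT hf hsign hv
  -- Equality of the observations on `(0, T)` propagates to the half-line by analyticity, as the
  -- Laplace transform requires all positive times.
  have hyz : EqOn y z (Ioi 0) := by
    refine hy.eqOn_of_preconnected_of_eventuallyEq hz isPreconnected_Ioi (z₀ := T / 2)
      (half_pos hT) ?_
    filter_upwards [Ioo_mem_nhds (half_pos hT) (half_lt_self hT)] with t ht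
    rw [hyu t ht, hzv t ht, huv t ⟨ht.1, ht.2.le⟩]
  have heq : ∀ s : ℝ, 0 < s → ((s ^ β : ℝ) : ℂ) * DoubleScale.partialFrac
      (fun j => DoubleScale.coeff f (2 * j + 1) * (-1) ^ j)
      (fun j => DoubleScale.mu α γ (2 * j + 1)) (s ^ β : ℝ) =
      ((s ^ β' : ℝ) : ℂ) * DoubleScale.partialFrac
      (fun j => DoubleScale.coeff f (2 * j + 1) * (-1) ^ j)
      (fun j => DoubleScale.mu α' γ' (2 * j + 1)) (s ^ β' : ℝ) := fun s hs => by
    rw [hly s hs, hlz s hs, setIntegral_congr_fun measurableSet_Ioi fun t ht => by rw [hyz ht]]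
  have hne : ∀ j : ℕ, DoubleScale.coeff f (2 * j + 1) * (-1) ^ j ≠ 0 := fun j => by
    refine mul_ne_zero ?_ (pow_ne_zero _ (by norm_num))
    rcases hsign with h | h
    · exact (h _ ⟨j, rfl⟩).ne'
    · exact (h _ ⟨j, rfl⟩).ne
  have hμ := DoubleScale.strictMono_mu hαγ.1 (hαγ.1.trans_le hαγ.2.1)
  have hμ' := DoubleScale.strictMono_mu hαγ'.1 (hαγ'.1.trans_le hαγ'.2.1)
  -- The pole argument needs the larger order on the second side, so both orderings are prepared;
  -- once the orders agree, each yields one inclusion between the eigenvalue sets.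
  have h12 := fun (h : β ≤ β') m => DoubleScale.pole_of_rpow_mul_eq hβ.1 h (DoubleScale.mu_pos 0) hμ
    (DoubleScale.tendsto_mu hαγ.1) hbu (DoubleScale.mu_pos 0) hμ' (DoubleScale.tendsto_mu hαγ'.1) hbv
    heq (hne m)
  have h21 := fun (h : β' ≤ β) m => DoubleScale.pole_of_rpow_mul_eq hβ'.1 h (DoubleScale.mu_pos 0)
    hμ' (DoubleScale.tendsto_mu hαγ'.1) hbv (DoubleScale.mu_pos 0) hμ (DoubleScale.tendsto_mu hαγ.1)
    hbu (fun s hs => (heq s hs).symm) (hne m)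
  have hββ : β = β' := by
    rcases le_total β β' with h | h
    · exact (h12 h 0).1
    · exact (h21 h 0).1.symm
  refine ⟨hββ, ?_⟩
  have hrange : (fun j : ℕ => DoubleScale.mu α γ (2 * j + 1)) =
      fun j : ℕ => DoubleScale.mu α' γ' (2 * j + 1) := by
    -- A strictly increasing sequence is determined by its range.
    refine (hμ.range_inj hμ').1 (Subset.antisymm ?_ ?_)
    · rintro _ ⟨m, rfl⟩
      exact (h21 hββ.ge m).2
    · rintro _ ⟨m, rfl⟩
      exact (h12 hββ.le m).2
  exact DoubleScale.exponents_eq_of_mu_eq hαγ.2.1 hαγ'.2.1 fun j => congrFun hrange j
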